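/- Let $d\ge 1$, let $\Omega\subseteq\mathbb{R}^d$ be a bounded domain, $T>0$, $Q_T=(0,T)\times\Omega$, and write $(k*v)(t)=\int_0^t k(t-\tau)v(\tau)\,d\tau$. Assume: (i) $(k,l)$ is of type $\mathcal{PC}$: $k\in L^1_{loc}([0,\infty))$ is non-negative and non-increasing, $l\in L^1_{loc}([0,\infty))$, and $k*l=1$ in $(0,\infty)$; (ii) $A\in L^\infty(Q_T;\mathbb{R}^{d\times d})$ and there is $\nu>0$ with $(A(t,x)\xi,\xi)\ge\nu|\xi|^2$ for all $\xi\in\mathbb{R}^d$ and a.e. $(t,x)\in Q_T$; (iii) $\varphi\in C^1(\mathbb{R})$ is strictly increasing. For $u_0\in L^1(\Omega)$ and $f\in L^1(Q_T)$, a weak solution of $$\partial_t[k*(u-u_0)]-\operatorname{div}(A\nabla\varphi(u))=f\ \text{in }Q_T,\qquad u=0\ \text{on }(0,T)\times\partial\Omega,\qquad u(0,\cdot)=u_0\ \text{in }\Omega$$ is a function $u\in L^2(0,T;L^2(\Omega))$ such that $k*(u-u_0)\in{}_0W^{1,1}(0,T;H^{-1}(\Omega))$, $\varphi(u)\in L^2(0,T;H^1_0(\Omega))$,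 and $$\int_{Q_T}\big(-\eta_t\,[k*(u-u_0)]+(A\nabla\varphi(u),\nabla\eta)\big)\,dx\,dt=\int_{Q_T}f\,\eta\,dx\,dt$$ for all $\eta\in W^{1,1}(0,T;L^2(\Omega))\cap L^2(0,T;H^1_0(\Omega))$ with $\eta,\eta_t\in L^\infty(Q_T)$ and $\eta(T,\cdot)=0$. Here ${}_0V$ denotes the elements of $V$ that vanish at $t=0$. For $i=1,2$ let $u_{0,i}\in L^1(\Omega)$, $f_i\in L^1(Q_T)$, and let $u_i$ be a weak solution with data $(u_{0,i},f_i)$ (and the same $k,A,\varphi$) satisfying the regularity condition $k*(u_i-u_{0,i})\in{}_0W^{1,1}(0,T;L^1(\Omega))$. Then, with $y^+=\max\{y,0\}$ and $y^-=\max\{-y,0\}$, $$\|u_1-u_2\|_{L^1(Q_T)}\le T\|u_{0,1}-u_{0,2}\|_{L^1(\Omega)}+\|l\|_{L^1(0,T)}\|f_1-f_2\|_{L^1(Q_T)},$$ $$\int_{Q_T}(u_1-u_2)^+\le T\int_\Omega(u_{0,1}-u_{0,2})^++\|l\|_{L^1(0,T)}\int_{Q_T}(f_1-f_2)^+,$$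 $$\int_{Q_T}(u_1-u_2)^-\le T\int_\Omega(u_{0,1}-u_{0,2})^-+\|l\|_{L^1(0,T)}\int_{Q_T}(f_1-f_2)^-.$$ In particular, if $u_{0,1}\le u_{0,2}$ a.e. in $\Omega$ and $f_1\le f_2$ a.e. in $Q_T$, then $u_1\le u_2$ a.e. in $Q_T$. -/

import Mathlib

open MeasureTheory Set Filter Topology
open scoped ENNReal ContDiff

noncomputable section

namespace FracPME

/-- The space `ℝ^d` with its Euclidean norm. -/
abbrev Sp (d : ℕ) : Type := EuclideanSpace ℝ (Fin d)

variable {d : ℕ}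

/-- The cylinder `Q_T = (0,T) × Ω`. -/
def cyl (T : ℝ) (Ω : Set (Sp d)) : Set (ℝ × Sp d) := Ioo 0 T ×ˢ Ω

/-- The convolution `(k ∗ v)(t) = ∫_0^t k(t-τ) v(τ) dτ`. -/
def conv (k v : ℝ → ℝ) (t : ℝ) : ℝ := ∫ τ in (0 : ℝ)..t, k (t - τ) * v τ

/-- `(k, l) ∈ 𝒫𝒞`: `k ∈ L^1_loc([0,∞))` is non-negative and non-increasing on `(0,∞)`,
`l ∈ L^1_loc([0,∞))`, and `k ∗ l = 1` (almost everywhere) in `(0,∞)`. -/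
structure IsPC (k l : ℝ → ℝ) : Prop where
  k_locInt : ∀ a : ℝ, 0 < a → IntegrableOn k (Ioo 0 a)
  k_nonneg : ∀ t : ℝ, 0 < t → 0 ≤ k t
  k_antitone : AntitoneOn k (Ioi 0)
  l_locInt : ∀ a : ℝ, 0 < a → IntegrableOn l (Ioo 0 a)
  conv_eq_one : ∀ᵐ t ∂(volume.restrict (Ioi (0 : ℝ))), conv k l t = 1

/-- The action of a matrix on a vector of `ℝ^d`. -/
def mulVecE (M : Matrix (Fin d) (Fin d) ℝ) (ξ : Sp d) : Sp d :=
  WithLp.toLp 2 (M.mulVec (fun i => ξ i))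

/-- `A ∈ L^∞(Q_T; ℝ^{d×d})` is uniformly elliptic on `Q_T`. -/
structure HA (T : ℝ) (Ω : Set (Sp d)) (A : ℝ × Sp d → Matrix (Fin d) (Fin d) ℝ) : Prop where
  bounded : ∀ i j, MemLp (fun z => A z i j) ⊤ (volume.restrict (cyl T Ω))
  coercive : ∃ ν : ℝ, 0 < ν ∧ ∀ᵐ z ∂(volume.restrict (cyl T Ω)), ∀ ξ : Sp d,
    ν * ‖ξ‖ ^ 2 ≤ inner ℝ (mulVecE (A z) ξ) ξ

/-- `ψ ∈ C_c^∞(Ω)`. -/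
structure IsTest (Ω : Set (Sp d)) (ψ : Sp d → ℝ) : Prop where
  smooth : ContDiff ℝ ∞ ψ
  compact : HasCompactSupport ψ
  supp : tsupport ψ ⊆ Ω

/-- The Hilbert space `L^2(Ω) × L^2(Ω; ℝ^d)`, in which `H^1` is embedded by `w ↦ (w, ∇w)`. -/
abbrev PairSpace (Ω : Set (Sp d)) : Type :=
  WithLp 2 (Lp ℝ 2 (volume.restrict Ω) × Lp (Sp d) 2 (volume.restrict Ω))

/-- `p` is the pair `(ψ, ∇ψ)`. -/
def IsPairOf (Ω : Set (Sp d)) (p : PairSpace Ω) (ψ : Sp d → ℝ) : Prop :=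
  (p.fst : Sp d → ℝ) =ᵐ[volume.restrict Ω] ψ ∧
    (p.snd : Sp d → Sp d) =ᵐ[volume.restrict Ω] fun x => gradient ψ x

/-- `H^1_0(Ω)`, the closure of `C_c^∞(Ω)` in the `H^1`-norm `(‖w‖_2^2 + ‖∇w‖_2^2)^{1/2}`; an
element is a pair `(w, ∇w)`. (The pairs `(ψ, ∇ψ)` form a subspace, so that the span adds nothing.) -/
def H10 (Ω : Set (Sp d)) : Submodule ℝ (PairSpace Ω) :=
  (Submodule.span ℝ {p : PairSpace Ω | ∃ ψ, IsTest Ω ψ ∧ IsPairOf Ω p ψ}).topologicalClosure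

/-- `H^{-1}(Ω)`, the dual space of `H^1_0(Ω)`. -/
abbrev Hneg1 (Ω : Set (Sp d)) : Type := StrongDual ℝ (H10 Ω)

/-- The function `w : Ω → ℝ` belongs to `H^1_0(Ω)` and its weak gradient is `G`. -/
def HasH10Grad (Ω : Set (Sp d)) (w : Sp d → ℝ) (G : Sp d → Sp d) : Prop :=
  ∃ p ∈ H10 Ω, (p.fst : Sp d → ℝ) =ᵐ[volume.restrict Ω] w ∧
    (p.snd : Sp d → Sp d) =ᵐ[volume.restrict Ω] G

/-- `w ∈ L^2(0,T; H^1_0(Ω))`, with spatial weak gradient `G`. -/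
structure MemL2H10 (T : ℝ) (Ω : Set (Sp d)) (w : ℝ × Sp d → ℝ) (G : ℝ × Sp d → Sp d) :
    Prop where
  memLp : MemLp w 2 (volume.restrict (cyl T Ω))
  memLp_grad : MemLp G 2 (volume.restrict (cyl T Ω))
  slice : ∀ᵐ t ∂(volume.restrict (Ioo 0 T)),
    HasH10Grad Ω (fun x => w (t, x)) (fun x => G (t, x))

/-- `w ∈ L^1(0,T; L^p(Ω))` (for `p < ∞`). -/
def MemL1Lp (T : ℝ) (Ω : Set (Sp d)) (p : ℝ≥0∞) (w : ℝ × Sp d → ℝ) : Prop :=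
  AEStronglyMeasurable w (volume.restrict (cyl T Ω)) ∧
    ∫⁻ t in Ioo 0 T, eLpNorm (fun x => w (t, x)) p (volume.restrict Ω) < ⊤

/-- `w ∈ W^{1,1}(0,T; L^p(Ω))` (for `p < ∞`), with weak time derivative `w'` and `w(0) = a`:
`w` is the primitive of `w' ∈ L^1(0,T; L^p(Ω))` with initial value `a ∈ L^p(Ω)`. -/
structure HasW11Deriv (T : ℝ) (Ω : Set (Sp d)) (p : ℝ≥0∞) (w w' : ℝ × Sp d → ℝ)
    (a : Sp d → ℝ) : Prop where
  mem : MemL1Lp T Ω p w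
  mem_deriv : MemL1Lp T Ω p w'
  mem_init : MemLp a p (volume.restrict Ω)
  primitive : ∀ᵐ z ∂(volume.restrict (cyl T Ω)),
    w z = a z.2 + ∫ s in (0 : ℝ)..z.1, w' (s, z.2)

/-- `v ∈ ₀W^{1,1}(0,T; X)`: `v` is the primitive, vanishing at `t = 0`, of a Bochner integrable
function. -/
def Mem0W11 {X : Type*} [NormedAddCommGroup X] [NormedSpace ℝ X] (T : ℝ) (v : ℝ → X) : Prop :=
  ∃ g : ℝ → X, IntegrableOn g (Ioo 0 T) ∧
    ∀ᵐ t ∂(volume.restrict (Ioo 0 T)), v t = ∫ s in (0 : ℝ)..t, g s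

/-- The function `w ∈ L^1(Ω)`, as a distribution on `Ω`, is the element `F` of `H^{-1}(Ω)`. -/
def RepresentsHneg1 (Ω : Set (Sp d)) (w : Sp d → ℝ) (F : Hneg1 Ω) : Prop :=
  IntegrableOn w Ω ∧ ∀ ψ : Sp d → ℝ, IsTest Ω ψ → ∀ p : H10 Ω, IsPairOf Ω p.1 ψ →
    F p = ∫ x in Ω, w x * ψ x

/-- The function `k ∗ (u - u₀)` on `Q_T`. -/
def memory (k : ℝ → ℝ) (u₀ : Sp d → ℝ) (u : ℝ × Sp d → ℝ) (z : ℝ × Sp d) : ℝ :=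
  conv k (fun τ => u (τ, z.2) - u₀ z.2) z.1

/-- `w ∈ W_φ(T, u₀)`: `w ∈ L^2(0,T; L^2(Ω))`, `k ∗ (w - u₀) ∈ ₀W^{1,1}(0,T; H^{-1}(Ω))` and
`φ(w) ∈ L^2(0,T; H^1_0(Ω))`. -/
structure MemWphi (T : ℝ) (Ω : Set (Sp d)) (k φ : ℝ → ℝ) (u₀ : Sp d → ℝ)
    (w : ℝ × Sp d → ℝ) : Prop where
  memLp : MemLp w 2 (volume.restrict (cyl T Ω))
  memory_mem : ∃ F : ℝ → Hneg1 Ω,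
    (∀ᵐ t ∂(volume.restrict (Ioo 0 T)),
      RepresentsHneg1 Ω (fun x => memory k u₀ w (t, x)) (F t)) ∧ Mem0W11 T F
  phi_mem : ∃ G : ℝ × Sp d → Sp d, MemL2H10 T Ω (fun z => φ (w z)) G

/-- `η` is an admissible test function with time derivative `ηt` and spatial gradient `Gη`:
`η ∈ W^{1,1}(0,T; L^2(Ω)) ∩ L^2(0,T; H^1_0(Ω))`, `η(T, ·) = 0`, and `η`, `ηt` are bounded. The
boundedness is what makes `ηt (k ∗ (u - u₀))` and `f η` integrable when `u₀` and `f` are merely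
`L^1`. Fewer test functions make the notion of weak solution below wider. -/
structure IsTestFunction (T : ℝ) (Ω : Set (Sp d)) (η ηt : ℝ × Sp d → ℝ)
    (Gη : ℝ × Sp d → Sp d) : Prop where
  w11 : ∃ a : Sp d → ℝ, HasW11Deriv T Ω 2 η ηt a ∧
    ∀ᵐ x ∂(volume.restrict Ω), a x + ∫ s in (0 : ℝ)..T, ηt (s, x) = 0
  l2h10 : MemL2H10 T Ω η Gη
  bounded : MemLp η ⊤ (volume.restrict (cyl T Ω))
  bounded_deriv : MemLp ηt ⊤ (volume.restrict (cyl T Ω))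

/-- `u` is a weak solution of `∂_t[k ∗ (u - u₀)] - div(A ∇φ(u)) = f` in `Q_T`, `u = 0` on
`(0,T) × ∂Ω`, `u(0,·) = u₀` in `Ω`. -/
structure IsWeakSolution (T : ℝ) (Ω : Set (Sp d)) (k : ℝ → ℝ)
    (A : ℝ × Sp d → Matrix (Fin d) (Fin d) ℝ) (φ : ℝ → ℝ) (u₀ : Sp d → ℝ)
    (f u : ℝ × Sp d → ℝ) : Prop where
  mem : MemWphi T Ω k φ u₀ u
  weak : ∃ G : ℝ × Sp d → Sp d, MemL2H10 T Ω (fun z => φ (u z)) G ∧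
    ∀ (η ηt : ℝ × Sp d → ℝ) (Gη : ℝ × Sp d → Sp d), IsTestFunction T Ω η ηt Gη →
      ∫ z in cyl T Ω, (-(ηt z) * memory k u₀ u z + inner ℝ (mulVecE (A z) (G z)) (Gη z))
        = ∫ z in cyl T Ω, f z * η z

/-- The regularity condition `k ∗ (u - u₀) ∈ ₀W^{1,1}(0,T; L^1(Ω))`. -/
def RegularMemory (T : ℝ) (Ω : Set (Sp d)) (k : ℝ → ℝ) (u₀ : Sp d → ℝ)
    (u : ℝ × Sp d → ℝ) : Prop :=
  ∃ h : ℝ × Sp d → ℝ, HasW11Deriv T Ω 1 (memory k u₀ u) h 0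

end FracPME

end

/-!
Monotonicity of the diffusion in `L¹`, combined with a positivity property of the kernel `k`.

Let `u = u₁ - u₂` and `w = φ(u₁) - φ(u₂)`, which have the same sign, and let `h = h₁ - h₂`,
`f = f₁ - f₂`, where `hᵢ ∈ L¹(Q_T)` is the time derivative of `k ∗ (uᵢ - u₀ᵢ)` granted by the
regularity assumption. After an integration by parts in time the equations no longer contain the
time derivative of the test function, so that Steklov averages of the test function
(`isTestFunction_steklov`) extend them to all bounded functions in `L²(0,T; H^1_0(Ω))`, without any
regularity in time (`identity_of_memL2H10`). By the chain rule in `H^1_0(Ω)` (`HasH10Grad.comp`),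
the function `ψ(t) H(w)` is admissible for every bounded `ψ ≥ 0` and every smooth non-decreasing
approximation `H` of the indicator function of `(0, ∞)`. The diffusion term
`∫ ψ H'(w) (A ∇w, ∇w)` is non-negative by ellipticity, and in the limit
`∫ ψ h 1_{u > 0} ≤ ∫ ψ f 1_{u > 0}` (`integral_heaviside_le`).

The choice `ψ(t) = ∫_0^{T-t} l` turns the left-hand side into a bound for `∫ u⁺`. This is a scalar
statement for almost every fixed `x`: if `∂ₜ (k ∗ (v - v₀)) = g` on `(0, T)`, then
`∫ v⁺ ≤ T v₀⁺ + ∫ ψ 1_{v > 0} g` (`IsPC.integral_pos_part_le`). Formally, a convex function `Ψ`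
satisfies `Ψ'(v) ∂ₜ (k ∗ (v - v₀)) ≥ ∂ₜ (k ∗ (Ψ(v) - Ψ(v₀)))`, and integrating
`∂ₜ (k ∗ y)` against `ψ` gives `(1 ∗ l ∗ ∂ₜ (k ∗ y))(T) = (l ∗ k ∗ y)(T) = ∫ y`, because
`l ∗ k = 1`. To make this rigorous, `k` is approximated in `L¹(0,T)` by kernels `a - ∫₀ᵗ κ` with `κ ≥ 0`
(`IsPC.exists_regular_approx`), for which the convexity inequality is elementary
(`convexity_inequality`); the limit is taken first for polynomial data `g`, and then, as
`v - v₀ = l ∗ g` depends continuously on `g` in `L¹(0,T)`, for all integrable data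
(`IsPC.integral_antideriv_le`). The same inequality shows that `∫₀ᵗ l ≥ 0`
(`IsPC.primitive_nonneg`), so that `ψ ≥ 0`.

Together these give the estimate for `(u₁ - u₂)⁺` (`integral_pos_part_sub_le`). Exchanging the two
solutions yields the negative part, and the sum is the estimate in `L¹`.
-/

noncomputable section

namespace FracPME

/-! ### The Volterra convolution -/

theorem conv_comm (f g : ℝ → ℝ) (t : ℝ) : conv f g t = conv g f t := by
  unfold conv
  have := intervalIntegral.integral_comp_sub_left (a := 0) (b := t)
    (fun τ => f τ * g (t - τ)) t
  simp only [sub_sub_cancel, sub_self, sub_zero] at this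
  rw [this]
  exact intervalIntegral.integral_congr fun τ _ => mul_comm _ _

theorem conv_one_left (g : ℝ → ℝ) (t : ℝ) : conv (fun _ => 1) g t = ∫ s in (0 : ℝ)..t, g s := by
  simp [conv]

/-- On `(0, T]`, the Volterra convolution is the convolution on `ℝ` of the functions cut off outside
`(0, T)`. -/
theorem conv_eq_convolution {T : ℝ} (f g : ℝ → ℝ) {t : ℝ} (ht : t ∈ Ioc 0 T) :
    conv f g t = convolution (indicator (Ioo 0 T) f) (indicator (Ioo 0 T) g)
      (ContinuousLinearMap.mul ℝ ℝ) volume t := by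
  rw [convolution_eq_swap, conv, intervalIntegral.integral_of_le ht.1.le,
    integral_Ioc_eq_integral_Ioo,
    ← integral_indicator measurableSet_Ioo]
  congr 1
  ext τ
  simp only [indicator, mem_Ioo, ContinuousLinearMap.mul_apply']
  have h1 := ht.1
  have h2 := ht.2
  by_cases h : 0 < τ ∧ τ < t
  · rw [if_pos h, if_pos ⟨by linarith [h.2], by linarith [h.1]⟩, if_pos ⟨h.1, by linarith [h.2]⟩]
  · rw [if_neg h]
    by_cases h' : 0 < τ ∧ τ < T
    · rw [if_neg (fun h'' => h ⟨h'.1, by linarith [h''.1]⟩), zero_mul]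
    · rw [if_neg h', mul_zero]

theorem conv_congr {T : ℝ} {f f' g g' : ℝ → ℝ} (hf : f =ᵐ[volume.restrict (Ioo 0 T)] f')
    (hg : g =ᵐ[volume.restrict (Ioo 0 T)] g') {t : ℝ} (ht : t ∈ Ioc 0 T) :
    conv f g t = conv f' g' t := by
  rw [conv_eq_convolution f g ht, conv_eq_convolution f' g' ht]
  rw [convolution_congr _ ((ae_eq_restrict_iff_indicator_ae_eq measurableSet_Ioo).1 hf)
    ((ae_eq_restrict_iff_indicator_ae_eq measurableSet_Ioo).1 hg)]

section

variable {T : ℝ} {f f' g g' h : ℝ → ℝ}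

theorem conv_ae_eq_convolution (T : ℝ) (f g : ℝ → ℝ) :
    conv f g =ᵐ[volume.restrict (Ioo 0 T)]
      convolution (indicator (Ioo 0 T) f) (indicator (Ioo 0 T) g)
        (ContinuousLinearMap.mul ℝ ℝ) volume := by
  filter_upwards [ae_restrict_mem measurableSet_Ioo] with t ht
  exact conv_eq_convolution f g ⟨ht.1, ht.2.le⟩

theorem integrableOn_conv (hf : IntegrableOn f (Ioo 0 T)) (hg : IntegrableOn g (Ioo 0 T)) :
    IntegrableOn (conv f g) (Ioo 0 T) := by
  refine Integrable.congr ?_ (conv_ae_eq_convolution T f g).symm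
  exact (Integrable.integrable_convolution _ (hf.integrable_indicator measurableSet_Ioo)
    (hg.integrable_indicator measurableSet_Ioo)).integrableOn

/-- The integral defining the convolution converges absolutely for almost every `t`. -/
theorem ae_integrableOn_conv (hf : IntegrableOn f (Ioo 0 T)) (hg : IntegrableOn g (Ioo 0 T)) :
    ∀ᵐ t ∂(volume.restrict (Ioo 0 T)),
      IntervalIntegrable (fun τ => f (t - τ) * g τ) volume 0 t := by
  have := (Integrable.ae_convolution_exists (ContinuousLinearMap.mul ℝ ℝ)
    (hg.integrable_indicator measurableSet_Ioo) (hf.integrable_indicator measurableSet_Ioo))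
  filter_upwards [ae_restrict_of_ae this, ae_restrict_mem measurableSet_Ioo] with t ht htT
  rw [intervalIntegrable_iff_integrableOn_Ioo_of_le htT.1.le]
  refine (ht.integrableOn (s := Ioo 0 t)).congr_fun ?_ measurableSet_Ioo
  intro τ hτ
  have h1 : t - τ ∈ Ioo 0 T := ⟨by linarith [hτ.2], by linarith [hτ.1, htT.2]⟩
  have h2 : τ ∈ Ioo 0 T := ⟨hτ.1, by linarith [hτ.2, htT.2]⟩
  simp [h1, h2, mul_comm]

theorem conv_add_right (hf : IntegrableOn f (Ioo 0 T)) (hg : IntegrableOn g (Ioo 0 T))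
    (hh : IntegrableOn h (Ioo 0 T)) :
    conv f (fun t => g t + h t) =ᵐ[volume.restrict (Ioo 0 T)] fun t => conv f g t + conv f h t := by
  filter_upwards [ae_integrableOn_conv hf hg, ae_integrableOn_conv hf hh] with t h1 h2
  simp only [conv, mul_add]
  exact intervalIntegral.integral_add h1 h2

theorem conv_sub_right (hf : IntegrableOn f (Ioo 0 T)) (hg : IntegrableOn g (Ioo 0 T))
    (hh : IntegrableOn h (Ioo 0 T)) :
    conv f (fun t => g t - h t) =ᵐ[volume.restrict (Ioo 0 T)] fun t => conv f g t - conv f h t := by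
  filter_upwards [ae_integrableOn_conv hf hg, ae_integrableOn_conv hf hh] with t h1 h2
  simp only [conv, mul_sub]
  exact intervalIntegral.integral_sub h1 h2

theorem conv_const_mul_right (c : ℝ) (f g : ℝ → ℝ) (t : ℝ) :
    conv f (fun s => c * g s) t = c * conv f g t := by
  simp only [conv, ← intervalIntegral.integral_const_mul]
  congr 1; ext; ring

theorem conv_const_mul_left (c : ℝ) (f g : ℝ → ℝ) (t : ℝ) :
    conv (fun s => c * f s) g t = c * conv f g t := by
  simp only [conv, ← intervalIntegral.integral_const_mul, mul_assoc]

theorem indicator_conv_eq (T : ℝ) (f g : ℝ → ℝ) :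
    indicator (Ioo 0 T) (conv f g) = indicator (Ioo 0 T)
      (convolution (indicator (Ioo 0 T) f) (indicator (Ioo 0 T) g)
        (ContinuousLinearMap.mul ℝ ℝ) volume) := by
  ext t
  by_cases ht : t ∈ Ioo 0 T
  · simp only [ht, indicator_of_mem]; exact conv_eq_convolution f g ⟨ht.1, ht.2.le⟩
  · simp [ht]

/-- The values at `t ≤ T` of the convolution with a function supported in `(0, T)` only involve the
values of the other factor on `(-∞, T)`. -/
theorem convolution_congr_on (F F' G : ℝ → ℝ) (h : ∀ t ∈ Ioo 0 T, F t = F' t)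
    (hF : ∀ t ≤ 0, F t = 0) (hF' : ∀ t ≤ 0, F' t = 0) {t : ℝ} (ht : t ∈ Ioc 0 T) :
    convolution F (indicator (Ioo 0 T) G) (ContinuousLinearMap.mul ℝ ℝ) volume t =
    convolution F' (indicator (Ioo 0 T) G) (ContinuousLinearMap.mul ℝ ℝ) volume t := by
  rw [convolution_eq_swap, convolution_eq_swap]
  congr 1
  ext s
  by_cases hs : s ∈ Ioo 0 T
  · congr 2
    rcases le_or_gt (t - s) 0 with h0 | h0
    · rw [hF _ h0, hF' _ h0]
    · exact h _ ⟨h0, by linarith [hs.1, ht.2]⟩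
  · simp [hs]

theorem convolution_indicator_of_nonpos (F G : ℝ → ℝ) {t : ℝ} (ht : t ≤ 0) :
    convolution (indicator (Ioo 0 T) F) (indicator (Ioo 0 T) G)
      (ContinuousLinearMap.mul ℝ ℝ) volume t = 0 := by
  rw [convolution_eq_swap]
  rw [integral_eq_zero_of_ae]
  refine Eventually.of_forall fun s => ?_
  by_cases hs : s ∈ Ioo 0 T
  · have : t - s ∉ Ioo 0 T := fun h => by linarith [h.1, hs.1]
    simp [this]
  · simp [hs]

theorem convolution_mul_comm (F G : ℝ → ℝ) :
    convolution F G (ContinuousLinearMap.mul ℝ ℝ) volume =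
      convolution G F (ContinuousLinearMap.mul ℝ ℝ) volume := by
  rw [← convolution_flip]
  congr 1
  ext
  simp

/-- Associativity at a point `t` at which the triple convolution converges absolutely. -/
theorem conv_assoc_of_exists (hf : IntegrableOn f (Ioo 0 T)) (hg : IntegrableOn g (Ioo 0 T))
    (hh : IntegrableOn h (Ioo 0 T)) {t : ℝ} (ht : t ∈ Ioc 0 T)
    (hex : ConvolutionExistsAt (fun x => ‖indicator (Ioo 0 T) f x‖)
      (convolution (fun x => ‖indicator (Ioo 0 T) g x‖) (fun x => ‖indicator (Ioo 0 T) h x‖)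
        (ContinuousLinearMap.mul ℝ ℝ) volume) t (ContinuousLinearMap.mul ℝ ℝ) volume) :
    conv (conv f g) h t = conv f (conv g h) t := by
  have hf' := hf.integrable_indicator measurableSet_Ioo
  have hg' := hg.integrable_indicator measurableSet_Ioo
  have hh' := hh.integrable_indicator measurableSet_Ioo
  have key := convolution_assoc (ContinuousLinearMap.mul ℝ ℝ) (ContinuousLinearMap.mul ℝ ℝ)
    (ContinuousLinearMap.mul ℝ ℝ) (ContinuousLinearMap.mul ℝ ℝ) (fun x y z => mul_assoc x y z)
    hf'.aestronglyMeasurable hg'.aestronglyMeasurable hh'.aestronglyMeasurable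
    (hf'.ae_convolution_exists _ hg') (hg'.norm.ae_convolution_exists _ hh'.norm) hex
  have e1 : conv (conv f g) h t = convolution (convolution (indicator (Ioo 0 T) f)
      (indicator (Ioo 0 T) g) (ContinuousLinearMap.mul ℝ ℝ) volume) (indicator (Ioo 0 T) h)
      (ContinuousLinearMap.mul ℝ ℝ) volume t := by
    rw [conv_eq_convolution _ _ ht, indicator_conv_eq]
    refine convolution_congr_on _ _ _ (fun s hs => indicator_of_mem hs _) (fun s hs => ?_)
      (fun s hs => convolution_indicator_of_nonpos _ _ hs) ht
    exact indicator_of_notMem (fun h => by linarith [h.1]) _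
  have e2 : conv f (conv g h) t = convolution (indicator (Ioo 0 T) f)
      (convolution (indicator (Ioo 0 T) g) (indicator (Ioo 0 T) h)
      (ContinuousLinearMap.mul ℝ ℝ) volume) (ContinuousLinearMap.mul ℝ ℝ) volume t := by
    rw [conv_comm, conv_eq_convolution _ _ ht, indicator_conv_eq, convolution_mul_comm _
      (convolution (indicator (Ioo 0 T) g) _ _ _)]
    refine convolution_congr_on _ _ _ (fun s hs => indicator_of_mem hs _) (fun s hs => ?_)
      (fun s hs => convolution_indicator_of_nonpos _ _ hs) ht
    exact indicator_of_notMem (fun h => by linarith [h.1]) _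
  rw [e1, e2, key]

theorem conv_assoc (hf : IntegrableOn f (Ioo 0 T)) (hg : IntegrableOn g (Ioo 0 T))
    (hh : IntegrableOn h (Ioo 0 T)) :
    conv (conv f g) h =ᵐ[volume.restrict (Ioo 0 T)] conv f (conv g h) := by
  have hf' := hf.integrable_indicator measurableSet_Ioo
  have hg' := hg.integrable_indicator measurableSet_Ioo
  have hh' := hh.integrable_indicator measurableSet_Ioo
  have := hf'.norm.ae_convolution_exists (ContinuousLinearMap.mul ℝ ℝ)
    (hg'.norm.integrable_convolution (ContinuousLinearMap.mul ℝ ℝ) hh'.norm)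
  filter_upwards [ae_restrict_of_ae this, ae_restrict_mem measurableSet_Ioo] with t h1 h2
  exact conv_assoc_of_exists hf hg hh ⟨h2.1, h2.2.le⟩ h1

/-- If the first factor is the constant `1`, then associativity holds at every point, in particular
at `t = T`, and not only almost everywhere. -/
theorem conv_one_conv_assoc (hg : IntegrableOn g (Ioo 0 T))
    (hh : IntegrableOn h (Ioo 0 T)) {t : ℝ} (ht : t ∈ Ioc 0 T) :
    conv (conv (fun _ => 1) g) h t = ∫ s in (0 : ℝ)..t, conv g h s := by
  rw [← conv_one_left]
  have hg' := hg.integrable_indicator measurableSet_Ioo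
  have hh' := hh.integrable_indicator measurableSet_Ioo
  refine conv_assoc_of_exists (by simp) hg hh ht ?_
  have hi := (hg'.norm.integrable_convolution (ContinuousLinearMap.mul ℝ ℝ) hh'.norm)
  unfold ConvolutionExistsAt
  refine (hi.comp_sub_left t).bdd_mul (c := 1) ?_ ?_
  · exact ((measurable_const.indicator measurableSet_Ioo).norm).aestronglyMeasurable
  · refine Eventually.of_forall fun s => ?_
    simp only [norm_norm]
    exact (norm_indicator_le_norm_self _ _).trans (by simp)

/-- Young's inequality in `L^1`. -/
theorem integral_abs_conv_le (hf : IntegrableOn f (Ioo 0 T)) (hg : IntegrableOn g (Ioo 0 T)) :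
    ∫ t in Ioo 0 T, |conv f g t| ≤ (∫ t in Ioo 0 T, |f t|) * ∫ t in Ioo 0 T, |g t| := by
  have hf' := hf.integrable_indicator measurableSet_Ioo
  have hg' := hg.integrable_indicator measurableSet_Ioo
  have hi := (hf'.norm.integrable_convolution (ContinuousLinearMap.mul ℝ ℝ) hg'.norm)
  have e := integral_convolution (ContinuousLinearMap.mul ℝ ℝ) hf'.norm hg'.norm (μ := volume)
      (ν := volume)
  have ef : ∫ t in Ioo 0 T, |f t| = ∫ t, ‖indicator (Ioo 0 T) f t‖ := by
    rw [← integral_indicator measurableSet_Ioo]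
    congr 1; ext t; rw [norm_indicator_eq_indicator_norm]; rfl
  have eg : ∫ t in Ioo 0 T, |g t| = ∫ t, ‖indicator (Ioo 0 T) g t‖ := by
    rw [← integral_indicator measurableSet_Ioo]
    congr 1; ext t; rw [norm_indicator_eq_indicator_norm]; rfl
  rw [ef, eg]
  refine le_of_le_of_eq ?_ e
  have hpos : ∀ t, ‖convolution (indicator (Ioo 0 T) f) (indicator (Ioo 0 T) g)
      (ContinuousLinearMap.mul ℝ ℝ) volume t‖ ≤ convolution (fun x => ‖indicator (Ioo 0 T) f x‖)
        (fun x => ‖indicator (Ioo 0 T) g x‖) (ContinuousLinearMap.mul ℝ ℝ) volume t := by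
    intro t
    refine (norm_integral_le_integral_norm _).trans (le_of_eq ?_)
    simp [convolution]
  refine le_trans ?_ (setIntegral_le_integral hi
    (Eventually.of_forall fun t => (norm_nonneg _).trans (hpos t)) (s := Ioo 0 T))
  refine setIntegral_mono_on ?_ hi.integrableOn measurableSet_Ioo ?_
  · exact (integrableOn_conv hf hg).norm
  · intro t ht
    rw [conv_eq_convolution f g ⟨ht.1, ht.2.le⟩]
    exact hpos t

end

/-! ### Regular kernels and the convexity inequality -/

/-- The antiderivative of `H` that vanishes at `0`; it is convex if `H` is monotone. -/
def antideriv (H : ℝ → ℝ) (y : ℝ) : ℝ := ∫ s in (0 : ℝ)..y, H s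

theorem antideriv_sub {H : ℝ → ℝ} (hc : Continuous H) (a b : ℝ) :
    antideriv H b - antideriv H a = ∫ s in a..b, H s :=
  intervalIntegral.integral_interval_sub_left (hc.intervalIntegrable _ _)
    (hc.intervalIntegrable _ _)

/-- The graph of `antideriv H` lies above its tangents. -/
theorem antideriv_convex {H : ℝ → ℝ} (hc : Continuous H) (hm : Monotone H) (a b : ℝ) :
    H a * (b - a) ≤ antideriv H b - antideriv H a := by
  rw [antideriv_sub hc]
  rcases le_total a b with h | h
  · have := intervalIntegral.integral_mono_on (f := fun _ => H a) (g := H) (μ := volume) h (by simp)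
      (hc.intervalIntegrable _ _) (fun x hx => hm hx.1)
    simpa [mul_comm] using this
  · have := intervalIntegral.integral_mono_on (f := H) (g := fun _ => H a) (μ := volume) h
      (hc.intervalIntegrable _ _) (by simp) (fun x hx => hm hx.2)
    rw [intervalIntegral.integral_symm]
    simp only [intervalIntegral.integral_const, smul_eq_mul] at this
    linarith

theorem abs_antideriv_sub_le {H : ℝ → ℝ} (hc : Continuous H) (hb : ∀ y, |H y| ≤ 1) (a b : ℝ) :
    |antideriv H b - antideriv H a| ≤ |b - a| := by
  rw [antideriv_sub hc]
  simpa using intervalIntegral.norm_integral_le_of_norm_le_const (f := H) (C := 1) (a := a) (b := b)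
    (fun x _ => hb x)

theorem continuous_antideriv {H : ℝ → ℝ} (hc : Continuous H) : Continuous (antideriv H) :=
  intervalIntegral.continuous_primitive (fun a b => hc.intervalIntegrable a b) 0

theorem IsPC.intervalIntegrable_k {k l : ℝ → ℝ} (h : IsPC k l) {a b : ℝ} (ha : 0 ≤ a) (hb : 0 ≤ b) :
    IntervalIntegrable k volume a b := by
  have : ∀ c : ℝ, 0 ≤ c → IntervalIntegrable k volume 0 c := by
    intro c hc
    rcases hc.eq_or_lt with rfl | hc'
    · simp
    · rw [intervalIntegrable_iff_integrableOn_Ioo_of_le hc]; exact h.k_locInt c hc'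
  exact (this a ha).symm.trans (this b hb)

/-- Averaging a non-increasing kernel `k` over the intervals `[t, t + δ]` gives kernels
`a - ∫₀ᵗ κ` with `κ ≥ 0` integrable, which converge to `k` in `L¹(0,T)`. -/
theorem IsPC.exists_regular_approx {k l : ℝ → ℝ} (h : IsPC k l) {T : ℝ} (hT : 0 < T) :
    ∃ (a : ℕ → ℝ) (κ : ℕ → ℝ → ℝ), (∀ n, IntegrableOn (κ n) (Ioo 0 T)) ∧
      (∀ n, ∀ t ∈ Ioo 0 T, 0 ≤ κ n t) ∧ (∀ n, ∀ t ∈ Icc 0 T, ∫ s in (0 : ℝ)..t, κ n s ≤ a n) ∧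
      Tendsto (fun n => ∫ t in Ioo 0 T, |a n - (∫ s in (0 : ℝ)..t, κ n s) - k t|) atTop (𝓝 0) := by
  -- `a n` is the mean of `k` over `[0, δ n]`, and `κ n t = (k t - k (t + δ n)) / δ n`
  set δ : ℕ → ℝ := fun n => 1 / ((n : ℝ) + 1) with hδ
  have hδp : ∀ n, 0 < δ n := fun n => by positivity
  have hki := fun {a b : ℝ} (ha : 0 ≤ a) (hb : 0 ≤ b) => h.intervalIntegrable_k ha hb
  have hshift : ∀ n {a b : ℝ}, 0 ≤ a → 0 ≤ b →
      IntervalIntegrable (fun t => k (t + δ n)) volume a b := fun n a b ha hb => by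
    have := (hki (a := a + δ n) (b := b + δ n)
        (by linarith [hδp n]) (by linarith [hδp n])).comp_add_right (δ n)
    simpa using this
  have hprim : ∀ n, ∀ t, 0 ≤ t → ∫ s in (0 : ℝ)..t, (k s - k (s + δ n)) / δ n =
      (∫ s in (0 : ℝ)..δ n, k s) / δ n - (∫ s in t..(t + δ n), k s) / δ n := by
    intro n t ht
    rw [intervalIntegral.integral_div, intervalIntegral.integral_sub (hki le_rfl ht)
      (hshift n le_rfl ht), intervalIntegral.integral_comp_add_right, ← sub_div]
    congr 1
    have hd := (hδp n).le
    have e1 := intervalIntegral.integral_add_adjacent_intervals (hki le_rfl ht)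
      (hki (b := t + δ n) ht (by linarith))
    have e2 := intervalIntegral.integral_add_adjacent_intervals (hki le_rfl hd)
      (hki (b := t + δ n) hd (by linarith))
    simp only [zero_add]
    linarith
  have hlow : ∀ n t, 0 < t → k (t + δ n) ≤ (∫ s in t..(t + δ n), k s) / δ n := by
    intro n t ht
    rw [le_div_iff₀ (hδp n)]
    have := intervalIntegral.integral_mono_on (f := fun _ => k (t + δ n)) (g := k) (μ := volume)
      (a := t) (b := t + δ n) (by linarith [hδp n]) (by simp) (hki ht.le (by linarith [hδp n]))
      (fun x hx => h.k_antitone (lt_of_lt_of_le ht hx.1)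
        (by have := hδp n; simp only [mem_Ioi]; linarith) hx.2)
    simpa [mul_comm] using this
  have hup : ∀ n t, 0 < t → (∫ s in t..(t + δ n), k s) / δ n ≤ k t := by
    intro n t ht
    rw [div_le_iff₀ (hδp n)]
    have := intervalIntegral.integral_mono_on (f := k) (g := fun _ => k t) (μ := volume)
      (a := t) (b := t + δ n) (by linarith [hδp n]) (hki ht.le (by linarith [hδp n])) (by simp)
      (fun x hx => h.k_antitone ht (lt_of_lt_of_le ht hx.1) hx.1)
    simpa [mul_comm] using this
  have hpos : ∀ n t, 0 ≤ t → 0 ≤ (∫ s in t..(t + δ n), k s) / δ n := by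
    intro n t ht
    refine div_nonneg ?_ (hδp n).le
    rw [intervalIntegral.integral_of_le (by linarith [hδp n])]
    exact setIntegral_nonneg measurableSet_Ioc fun s hs => h.k_nonneg s (lt_of_le_of_lt ht hs.1)
  refine ⟨fun n => (∫ s in (0 : ℝ)..δ n, k s) / δ n, fun n t => (k t - k (t + δ n)) / δ n,
    fun n => ?_, fun n t ht => ?_, fun n t ht => ?_, ?_⟩
  · have := ((hki le_rfl hT.le).sub (hshift n le_rfl hT.le)).div_const (δ n)
    exact (intervalIntegrable_iff_integrableOn_Ioo_of_le hT.le).1 this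
  · refine div_nonneg (sub_nonneg.2 (h.k_antitone ht.1 (mem_Ioi.2 ?_) ?_)) (hδp n).le <;>
    linarith [hδp n, ht.1]
  · rw [hprim n t ht.1]
    linarith [hpos n t ht.1]
  -- the mean of `k` over `[t, t + δ]` lies between `k (t + δ)` and `k t`, and the integral of
  -- `k t - k (t + δ)` telescopes to at most `∫₀^δ k`
  · have hb : ∀ n, ∫ t in Ioo 0 T, |(∫ s in (0 : ℝ)..δ n, k s) / δ n -
        (∫ s in (0 : ℝ)..t, (k s - k (s + δ n)) / δ n) - k t| ≤ ∫ s in (0 : ℝ)..δ n, k s := by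
      intro n
      have hle : ∫ t in Ioo 0 T, |(∫ s in (0 : ℝ)..δ n, k s) / δ n -
        (∫ s in (0 : ℝ)..t, (k s - k (s + δ n)) / δ n) - k t| ≤
          ∫ t in Ioo 0 T, (k t - k (t + δ n)) := by
        refine integral_mono_of_nonneg (Eventually.of_forall fun _ => abs_nonneg _) ?_ ?_
        · exact (intervalIntegrable_iff_integrableOn_Ioo_of_le hT.le).1
            ((hki le_rfl hT.le).sub (hshift n le_rfl hT.le))
        · filter_upwards [ae_restrict_mem measurableSet_Ioo] with t ht
          rw [hprim n t ht.1.le, abs_le]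
          constructor <;> linarith [hlow n t ht.1, hup n t ht.1]
      refine hle.trans ?_
      rw [← integral_Ioc_eq_integral_Ioo, ← intervalIntegral.integral_of_le hT.le]
      have e := hprim n T hT.le
      rw [intervalIntegral.integral_div, ← sub_div, div_left_inj' (hδp n).ne'] at e
      have h0 := mul_nonneg (hpos n T hT.le) (hδp n).le
      rw [div_mul_cancel₀ _ (hδp n).ne'] at h0
      linarith
    have hδ0 : Tendsto δ atTop (𝓝 0) := tendsto_one_div_add_atTop_nhds_zero_nat
    have hc : ContinuousOn (fun x => ∫ s in (0 : ℝ)..x, k s) (uIcc 0 1) :=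
      intervalIntegral.continuousOn_primitive_interval
        (((intervalIntegrable_iff').1 (hki le_rfl zero_le_one)))
    have hc0 : Tendsto (fun n => ∫ s in (0 : ℝ)..δ n, k s) atTop (𝓝 0) := by
      have h1 := (hc 0 (by simp)).tendsto
      simp only [intervalIntegral.integral_same] at h1
      refine h1.comp (tendsto_nhdsWithin_iff.2 ⟨hδ0, Eventually.of_forall fun n => ?_⟩)
      rw [uIcc_of_le zero_le_one]
      refine ⟨(hδp n).le, ?_⟩
      rw [hδ]
      simp only [one_div]
      exact inv_le_one_of_one_le₀ (by linarith [n.cast_nonneg (α := ℝ)])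
    exact squeeze_zero (fun n => integral_nonneg fun _ => abs_nonneg _) hb hc0

section

variable {T : ℝ} {κ v : ℝ → ℝ}

theorem intervalIntegrable_conv_bdd {M : ℝ} (hκ : IntegrableOn κ (Ioo 0 T))
    (hv : AEStronglyMeasurable v (volume.restrict (Ioo 0 T))) (hM : ∀ t ∈ Ioo 0 T, |v t| ≤ M)
    {t : ℝ} (ht : t ∈ Ioc 0 T) :
    IntervalIntegrable (fun τ => κ (t - τ) * v τ) volume 0 t := by
  have h1 : IntervalIntegrable κ volume 0 t := by
    rw [intervalIntegrable_iff_integrableOn_Ioo_of_le ht.1.le]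
    exact hκ.mono_set (Ioo_subset_Ioo_right ht.2)
  have h2 : IntervalIntegrable (fun τ => κ (t - τ)) volume 0 t := by
    simpa using (h1.comp_sub_left t).symm
  rw [intervalIntegrable_iff_integrableOn_Ioo_of_le ht.1.le] at h2 ⊢
  refine Integrable.mul_bdd (c := M) h2 (hv.mono_set (Ioo_subset_Ioo_right ht.2)) ?_
  filter_upwards [ae_restrict_mem measurableSet_Ioo] with s hs
  exact hM s (Ioo_subset_Ioo_right ht.2 hs)

theorem abs_conv_le_of_bdd {M : ℝ} (hM0 : 0 ≤ M) (hκ : IntegrableOn κ (Ioo 0 T))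
    (hM : ∀ t ∈ Ioo 0 T, |v t| ≤ M) {t : ℝ} (ht : t ∈ Ioc 0 T) :
    |conv κ v t| ≤ M * ∫ s in Ioo 0 T, |κ s| := by
  have h1 : IntervalIntegrable κ volume 0 t := by
    rw [intervalIntegrable_iff_integrableOn_Ioo_of_le ht.1.le]
    exact hκ.mono_set (Ioo_subset_Ioo_right ht.2)
  have h2 : IntervalIntegrable (fun τ => κ (t - τ)) volume 0 t := by
    simpa using (h1.comp_sub_left t).symm
  have step : |conv κ v t| ≤ ∫ τ in (0:ℝ)..t, |κ (t - τ)| * M := by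
    rw [conv, ← Real.norm_eq_abs]
    refine intervalIntegral.norm_integral_le_of_norm_le ht.1.le ?_ (h2.abs.mul_const M)
    have : ∀ᵐ τ : ℝ, τ ≠ t := by simp [ae_iff]
    filter_upwards [this] with τ hne hτ
    rw [norm_mul]
    have h3 : τ < t := lt_of_le_of_ne hτ.2 hne
    exact mul_le_mul_of_nonneg_left (hM τ ⟨hτ.1, h3.trans_le ht.2⟩) (norm_nonneg _)
  refine step.trans ?_
  rw [intervalIntegral.integral_mul_const, mul_comm,
    intervalIntegral.integral_comp_sub_left (fun τ => |κ τ|), sub_self, sub_zero,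
    intervalIntegral.integral_of_le ht.1.le, integral_Ioc_eq_integral_Ioo]
  exact mul_le_mul_of_nonneg_left (setIntegral_mono_set hκ.abs
    (Eventually.of_forall fun _ => abs_nonneg _)
    (Ioo_subset_Ioo_right ht.2).eventuallyLE) hM0

/-- The convexity inequality `Ψ'(v) B(v - v₀) ≥ B(Ψ(v) - Ψ(v₀))` for the operator
`B y = a y - κ ∗ y`, which is the time derivative of the convolution with the kernel
`a - ∫₀ᵗ κ`. -/
theorem convexity_inequality {a M : ℝ} {H : ℝ → ℝ} (hc : Continuous H) (hm : Monotone H)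
    (hκ : IntegrableOn κ (Ioo 0 T)) (hκ0 : ∀ t ∈ Ioo 0 T, 0 ≤ κ t)
    (hv : AEStronglyMeasurable v (volume.restrict (Ioo 0 T))) (hM : ∀ t ∈ Ioo 0 T, |v t| ≤ M)
    (v₀ : ℝ) {t : ℝ} (ht : t ∈ Ioo 0 T) (ha : ∫ s in (0 : ℝ)..t, κ s ≤ a) :
    a * (antideriv H (v t) - antideriv H v₀)
        - conv κ (fun τ => antideriv H (v τ) - antideriv H v₀) t
      ≤ H (v t) * (a * (v t - v₀) - conv κ (fun τ => v τ - v₀) t) := by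
  have ht' : t ∈ Ioc 0 T := ⟨ht.1, ht.2.le⟩
  obtain ⟨C, hC⟩ := (isCompact_Icc (a := -M) (b := M)).exists_bound_of_continuousOn
    (continuous_antideriv hc).continuousOn
  have i1 : IntervalIntegrable (fun τ => κ (t - τ) * (antideriv H (v τ) - antideriv H v₀))
      volume 0 t := by
    refine intervalIntegrable_conv_bdd (M := C + |antideriv H v₀|)
      (v := fun τ => antideriv H (v τ) - antideriv H v₀) hκ
      (((continuous_antideriv hc).comp_aestronglyMeasurable hv).sub aestronglyMeasurable_const)
      (fun s hs => ?_) ht'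
    exact (abs_sub _ _).trans (add_le_add (hC _ (abs_le.1 (hM s hs))) le_rfl)
  have i2 : IntervalIntegrable (fun τ => κ (t - τ) * (v τ - v₀)) volume 0 t := by
    refine intervalIntegrable_conv_bdd (M := M + |v₀|) (v := fun τ => v τ - v₀) hκ
      (hv.sub aestronglyMeasurable_const)
      (fun s hs => ?_) ht'
    exact (abs_sub _ _).trans (add_le_add (hM s hs) le_rfl)
  have i3 := intervalIntegrable_conv_bdd (M := 1) (v := fun _ => 1) hκ aestronglyMeasurable_const
      (by simp) ht'
  -- the tangent inequality at `v t`, used with `v₀` for the part `a - ∫₀ᵗ κ ≥ 0` of the kernel and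
  -- with `v τ` under the convolution integral with `κ ≥ 0`
  set F : ℝ := antideriv H (v t) - antideriv H v₀ - H (v t) * (v t - v₀) with hF
  have hF0 : F ≤ 0 := by
    have := antideriv_convex hc hm (v t) v₀
    rw [hF]; linarith
  have key : conv κ (fun _ => 1) t * F ≤ conv κ (fun τ => antideriv H (v τ) - antideriv H v₀) t
      - H (v t) * conv κ (fun τ => v τ - v₀) t := by
    unfold conv
    rw [← intervalIntegral.integral_const_mul, ← intervalIntegral.integral_mul_const,
      ← intervalIntegral.integral_sub i1 (i2.const_mul _)]
    refine intervalIntegral.integral_mono_on_of_le_Ioo ht.1.le (i3.mul_const _)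
      (i1.sub (i2.const_mul _)) fun τ hτ => ?_
    have h0 := hκ0 (t - τ) ⟨by linarith [hτ.2], by linarith [hτ.1, ht.2]⟩
    have h1 : F ≤ antideriv H (v τ) - antideriv H v₀ - H (v t) * (v τ - v₀) := by
      have := antideriv_convex hc hm (v t) (v τ)
      rw [hF]; linarith
    have := mul_le_mul_of_nonneg_left h1 h0
    linarith
  rw [conv_comm, conv_one_left] at key
  have := mul_le_mul_of_nonpos_right ha hF0
  rw [hF] at this key
  linarith

end

/-! ### The derivative of the convolution with a regular kernel -/

/-- The regular kernel `a - ∫₀ᵗ κ`. -/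
def regKernel (a : ℝ) (κ : ℝ → ℝ) (t : ℝ) : ℝ := a - ∫ s in (0 : ℝ)..t, κ s

/-- The operator `y ↦ a y - κ ∗ y`, the time derivative of the convolution with
`regKernel a κ`. -/
def regDeriv (a : ℝ) (κ y : ℝ → ℝ) (t : ℝ) : ℝ := a * y t - conv κ y t

section

variable {T a c : ℝ} {κ l q y w g ψ H : ℝ → ℝ}

theorem integrableOn_regKernel (hκ : IntegrableOn κ (Ioo 0 T)) :
    IntegrableOn (regKernel a κ) (Ioo 0 T) := by
  have h1 : IntegrableOn (fun _ : ℝ => a) (Ioo 0 T) := by simp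
  have h2 := integrableOn_conv (f := fun _ => (1 : ℝ)) (T := T) (by simp) hκ
  refine (h1.sub h2).congr (Eventually.of_forall fun t => ?_)
  simp [regKernel, conv_one_left]

theorem integrableOn_regDeriv (hκ : IntegrableOn κ (Ioo 0 T)) (hy : IntegrableOn y (Ioo 0 T)) :
    IntegrableOn (regDeriv a κ y) (Ioo 0 T) :=
  (hy.const_mul a).sub (integrableOn_conv hκ hy)

theorem conv_comm_fun (f g : ℝ → ℝ) : conv f g = conv g f := funext fun t => conv_comm f g t

theorem integrableOn_primitive (hq : IntegrableOn q (Ioo 0 T)) :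
    IntegrableOn (fun t => ∫ s in (0 : ℝ)..t, q s) (Ioo 0 T) := by
  refine (integrableOn_conv (f := fun _ => (1 : ℝ)) (T := T) (by simp) hq).congr
    (Eventually.of_forall fun t => ?_)
  simp [conv_one_left]

/-- For `g = c + ∫₀ᵗ q`, the derivative can be moved from the convolution to `g`. -/
theorem regDeriv_primitive (hκ : IntegrableOn κ (Ioo 0 T)) (hq : IntegrableOn q (Ioo 0 T))
    (hg : ∀ t, g t = c + ∫ s in (0 : ℝ)..t, q s) :
    regDeriv a κ g =ᵐ[volume.restrict (Ioo 0 T)]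
      fun t => c * regKernel a κ t + conv (regKernel a κ) q t := by
  have h1 : IntegrableOn (fun _ : ℝ => (1 : ℝ)) (Ioo 0 T) := by simp
  have hc : IntegrableOn (fun _ : ℝ => c) (Ioo 0 T) := by simp
  have ha : IntegrableOn (fun _ : ℝ => a) (Ioo 0 T) := by simp
  have hgf : g = fun t => c + conv (fun _ => 1) q t := by
    ext t; rw [hg, conv_one_left]
  have e1 := conv_add_right hκ hc (integrableOn_conv h1 hq)
  have e2 := conv_assoc hκ h1 hq
  have e3 := conv_sub_right hq ha (integrableOn_conv hκ h1)
  filter_upwards [e1, e2, e3] with t h1 h2 h3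
  have e4 : regKernel a κ = fun t => a - conv κ (fun _ => 1) t := by
    ext s; rw [regKernel, conv_comm, conv_one_left]
  have e5 : conv κ (fun _ => c) t = c * ∫ s in (0 : ℝ)..t, κ s := by
    rw [← conv_one_left, conv_comm, ← conv_const_mul_left]; simp
  have e6 : conv q (fun _ => a) t = a * conv (fun _ => 1) q t := by
    rw [conv_comm, ← conv_const_mul_left]; simp
  rw [conv_comm (regKernel a κ), e4, h3, ← e4, conv_comm q (conv κ _), h2, regDeriv, hgf,
    h1, e5, e6,
    regKernel]
  ring

theorem regDeriv_conv (hκ : IntegrableOn κ (Ioo 0 T)) (hl : IntegrableOn l (Ioo 0 T))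
    (hg : IntegrableOn g (Ioo 0 T)) :
    regDeriv a κ (conv l g) =ᵐ[volume.restrict (Ioo 0 T)] conv l (regDeriv a κ g) := by
  have e1 := conv_sub_right hl (hg.const_mul a) (integrableOn_conv hκ hg)
  have e2 := conv_assoc hκ hg hl
  filter_upwards [e1, e2] with t h1 h2
  unfold regDeriv
  rw [h1, conv_const_mul_right, conv_comm_fun l g, ← h2, conv_comm l]

/-- For a datum `g = c + ∫₀ᵗ q`, the regularized derivative of `l ∗ g` is expressed through
`l ∗ regKernel a κ`, which is close to `1` if the kernel is close to `k`. -/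
theorem regDeriv_conv_primitive (hκ : IntegrableOn κ (Ioo 0 T)) (hl : IntegrableOn l (Ioo 0 T))
    (hq : IntegrableOn q (Ioo 0 T)) (hg : ∀ t, g t = c + ∫ s in (0 : ℝ)..t, q s) :
    regDeriv a κ (conv l g) =ᵐ[volume.restrict (Ioo 0 T)]
      fun t => c * conv l (regKernel a κ) t + conv (conv l (regKernel a κ)) q t := by
  have hgi : IntegrableOn g (Ioo 0 T) := by
    rw [show g = fun t => c + ∫ s in (0 : ℝ)..t, q s from funext hg]
    exact Integrable.add (by simp) (integrableOn_primitive hq)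
  have hr := integrableOn_regKernel (a := a) hκ
  have e3 := regDeriv_primitive (a := a) hκ hq hg
  filter_upwards [regDeriv_conv (a := a) hκ hl hgi,
    conv_add_right hl (hr.const_mul c) (integrableOn_conv hr hq),
    conv_assoc hl hr hq, ae_restrict_mem measurableSet_Ioo] with t h1 h2 h3 ht
  rw [h1, conv_congr (ae_eq_refl l) e3 ⟨ht.1, ht.2.le⟩, h2, h3, conv_const_mul_right]

theorem IsPC.conv_l_k_ae {k l : ℝ → ℝ} (h : IsPC k l) (T : ℝ) :
    conv l k =ᵐ[volume.restrict (Ioo 0 T)] fun _ => 1 := by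
  rw [conv_comm_fun]
  exact ae_restrict_of_ae_restrict_of_subset Ioo_subset_Ioi_self h.conv_eq_one

/-- If the regular kernels converge to `k` in `L¹(0,T)`, then `l ∗ regKernel (a n) (κ n)`
converges to `l ∗ k = 1`. -/
theorem IsPC.tendsto_conv_regKernel {k l : ℝ → ℝ} (h : IsPC k l) (hT : 0 < T)
    {a : ℕ → ℝ} {κ : ℕ → ℝ → ℝ} (hκ : ∀ n, IntegrableOn (κ n) (Ioo 0 T))
    (hlim : Tendsto (fun n => ∫ t in Ioo 0 T, |a n - (∫ s in (0 : ℝ)..t, κ n s) - k t|)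
      atTop (𝓝 0)) :
    Tendsto (fun n => ∫ t in Ioo 0 T, |conv l (regKernel (a n) (κ n)) t - 1|) atTop (𝓝 0) := by
  have hl := h.l_locInt T hT
  have hk := h.k_locInt T hT
  have hb : ∀ n, ∫ t in Ioo 0 T, |conv l (regKernel (a n) (κ n)) t - 1| ≤
      (∫ t in Ioo 0 T, |l t|) * ∫ t in Ioo 0 T, |a n - (∫ s in (0 : ℝ)..t, κ n s) - k t| := by
    intro n
    have hr := integrableOn_regKernel (a := a n) (hκ n)
    refine le_of_eq_of_le (integral_congr_ae ?_) (integral_abs_conv_le hl (hr.sub hk))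
    filter_upwards [conv_sub_right hl hr hk, h.conv_l_k_ae T] with t h1 h2
    rw [← h2, ← h1]
    rfl
  refine squeeze_zero (fun n => integral_nonneg fun _ => abs_nonneg _) hb ?_
  simpa using hlim.const_mul (∫ t in Ioo 0 T, |l t|)

/-- For `w = l ∗ g`, the regularized derivatives of `w` converge to `∂ₜ (k ∗ w) = g` in
`L¹(0,T)`. -/
theorem IsPC.tendsto_regDeriv {k l : ℝ → ℝ} (h : IsPC k l) (hT : 0 < T)
    {a : ℕ → ℝ} {κ : ℕ → ℝ → ℝ} (hκ : ∀ n, IntegrableOn (κ n) (Ioo 0 T))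
    (hlim : Tendsto (fun n => ∫ t in Ioo 0 T, |a n - (∫ s in (0 : ℝ)..t, κ n s) - k t|) atTop (𝓝 0))
    (hq : IntegrableOn q (Ioo 0 T)) (hg : ∀ t, g t = c + ∫ s in (0 : ℝ)..t, q s) :
    Tendsto (fun n => ∫ t in Ioo 0 T, |regDeriv (a n) (κ n) (conv l g) t - g t|) atTop (𝓝 0) := by
  have hl := h.l_locInt T hT
  have hm := h.tendsto_conv_regKernel hT hκ hlim
  have h1 : IntegrableOn (fun _ : ℝ => (1 : ℝ)) (Ioo 0 T) := by simp
  have hb : ∀ n, ∫ t in Ioo 0 T, |regDeriv (a n) (κ n) (conv l g) t - g t| ≤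
      |c| * (∫ t in Ioo 0 T, |conv l (regKernel (a n) (κ n)) t - 1|) +
      (∫ t in Ioo 0 T, |q t|) * (∫ t in Ioo 0 T, |conv l (regKernel (a n) (κ n)) t - 1|) := by
    intro n
    have hmi := integrableOn_conv hl (integrableOn_regKernel (a := a n) (hκ n))
    have hmi1 : IntegrableOn (fun t => conv l (regKernel (a n) (κ n)) t - 1) (Ioo 0 T) := hmi.sub h1
    refine le_trans ?_ (add_le_add le_rfl (integral_abs_conv_le hq hmi1))
    rw [← integral_const_mul, ← integral_add (hmi1.abs.const_mul _) (integrableOn_conv hq hmi1).abs]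
    refine integral_mono_of_nonneg (Eventually.of_forall fun _ => abs_nonneg _)
      ((hmi1.abs.const_mul _).add (integrableOn_conv hq hmi1).abs) ?_
    filter_upwards [regDeriv_conv_primitive (a := a n) (hκ n) hl hq hg, conv_sub_right hq hmi h1]
      with t e1 e2
    rw [e1, e2, hg, conv_comm q (fun _ => 1), conv_one_left, conv_comm q, ← abs_mul]
    refine le_trans (le_of_eq ?_) (abs_add_le _ _)
    congr 1; ring
  refine squeeze_zero (fun n => integral_nonneg fun _ => abs_nonneg _) hb ?_
  simpa using (hm.const_mul |c|).add (hm.const_mul (∫ t in Ioo 0 T, |q t|))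

theorem integrableOn_of_bdd {M : ℝ} (hy : AEStronglyMeasurable y (volume.restrict (Ioo 0 T)))
    (hM : ∀ t ∈ Ioo 0 T, |y t| ≤ M) : IntegrableOn y (Ioo 0 T) :=
  Integrable.of_bound hy M (by
    filter_upwards [ae_restrict_mem measurableSet_Ioo] with t ht using hM t ht)

/-- `convexity_inequality` for `v = v₀ + w`, integrated against a non-negative weight `ψ`. -/
theorem weighted_convexity_inequality {M C v₀ : ℝ} (hc : Continuous H) (hm : Monotone H)
    (hb : ∀ y, |H y| ≤ 1)
    (hκ : IntegrableOn κ (Ioo 0 T)) (hκ0 : ∀ t ∈ Ioo 0 T, 0 ≤ κ t)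
    (ha : ∀ t ∈ Ioo 0 T, ∫ s in (0 : ℝ)..t, κ s ≤ a)
    (hw : AEStronglyMeasurable w (volume.restrict (Ioo 0 T))) (hM : ∀ t ∈ Ioo 0 T, |w t| ≤ M)
    (hψ : AEStronglyMeasurable ψ (volume.restrict (Ioo 0 T))) (hψC : ∀ t ∈ Ioo 0 T, |ψ t| ≤ C)
    (hψ0 : ∀ t ∈ Ioo 0 T, 0 ≤ ψ t) :
    ∫ t in Ioo 0 T, ψ t * regDeriv a κ (fun t => antideriv H (v₀ + w t) - antideriv H v₀) t ≤
      ∫ t in Ioo 0 T, ψ t * (H (v₀ + w t) * regDeriv a κ w t) := by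
  have hv : AEStronglyMeasurable (fun t => v₀ + w t) (volume.restrict (Ioo 0 T)) :=
    aestronglyMeasurable_const.add hw
  have hψC' : ∀ᵐ t ∂(volume.restrict (Ioo 0 T)), ‖ψ t‖ ≤ C := by
    filter_upwards [ae_restrict_mem measurableSet_Ioo] with t ht using hψC t ht
  have hyi : IntegrableOn (fun t => antideriv H (v₀ + w t) - antideriv H v₀) (Ioo 0 T) := by
    refine integrableOn_of_bdd (M := M) (((continuous_antideriv hc).comp_aestronglyMeasurable
      hv).sub aestronglyMeasurable_const) fun t ht => ?_
    refine (abs_antideriv_sub_le hc hb _ _).trans ?_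
    simpa using hM t ht
  have hwi : IntegrableOn w (Ioo 0 T) := integrableOn_of_bdd hw hM
  refine setIntegral_mono_on ?_ ?_ measurableSet_Ioo fun t ht => ?_
  · exact (integrableOn_regDeriv hκ hyi).bdd_mul hψ hψC'
  · refine Integrable.bdd_mul (c := C) ?_ hψ hψC'
    exact (integrableOn_regDeriv hκ hwi).bdd_mul (hc.comp_aestronglyMeasurable hv) (c := 1)
      (Eventually.of_forall fun t => hb _)
  · refine mul_le_mul_of_nonneg_left ?_ (hψ0 t ht)
    have := convexity_inequality (v := fun t => v₀ + w t) (M := |v₀| + M) hc hm hκ hκ0 hv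
      (fun s hs => (abs_add_le _ _).trans (add_le_add le_rfl (hM s hs))) v₀ ht (ha t ht)
    simpa [regDeriv] using this

theorem tendsto_weighted_integral {C : ℝ} {F : ℕ → ℝ → ℝ} {θ : ℝ → ℝ}
    (hF : ∀ n, IntegrableOn (F n) (Ioo 0 T)) (hg : IntegrableOn g (Ioo 0 T))
    (hlim : Tendsto (fun n => ∫ t in Ioo 0 T, |F n t - g t|) atTop (𝓝 0))
    (hθ : AEStronglyMeasurable θ (volume.restrict (Ioo 0 T))) (hθC : ∀ t ∈ Ioo 0 T, |θ t| ≤ C) :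
    Tendsto (fun n => ∫ t in Ioo 0 T, θ t * F n t) atTop (𝓝 (∫ t in Ioo 0 T, θ t * g t)) := by
  have hC' : ∀ᵐ t ∂(volume.restrict (Ioo 0 T)), ‖θ t‖ ≤ C := by
    filter_upwards [ae_restrict_mem measurableSet_Ioo] with t ht using hθC t ht
  rw [tendsto_iff_norm_sub_tendsto_zero]
  refine squeeze_zero (fun n => norm_nonneg _) (fun n => ?_) (by simpa using hlim.const_mul C)
  rw [← integral_sub ((hF n).bdd_mul hθ hC') (hg.bdd_mul hθ hC'), ← integral_const_mul]
  refine norm_integral_le_of_norm_le (((hF n).sub hg).abs.const_mul C) ?_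
  filter_upwards [hC'] with t ht
  rw [← mul_sub, norm_mul]
  exact mul_le_mul_of_nonneg_right ht (norm_nonneg _)

/-- With the weight `t ↦ ∫₀^{T-t} l`, the integral of the regularized derivative of `y` is
`((l ∗ regKernel a κ) ∗ y)(T)`, which is close to `∫₀ᵀ y`. -/
theorem integral_weight_regDeriv (hT : 0 < T) (hκ : IntegrableOn κ (Ioo 0 T))
    (hl : IntegrableOn l (Ioo 0 T))
    (hy : IntegrableOn y (Ioo 0 T)) :
    ∫ t in Ioo 0 T, (∫ s in (0 : ℝ)..(T - t), l s) * regDeriv a κ y t =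
      conv y (conv l (regKernel a κ)) T := by
  have hTT : T ∈ Ioc 0 T := ⟨hT, le_rfl⟩
  have h1 : IntegrableOn (fun _ : ℝ => (1 : ℝ)) (Ioo 0 T) := by simp
  have hly := integrableOn_conv hl hy
  have hlκ := integrableOn_conv hl hκ
  have s1 : ∫ t in Ioo 0 T, (∫ s in (0 : ℝ)..(T - t), l s) * regDeriv a κ y t =
      conv (conv (fun _ => 1) l) (regDeriv a κ y) T := by
    rw [conv, intervalIntegral.integral_of_le hT.le, integral_Ioc_eq_integral_Ioo]
    simp only [conv_one_left]
  have s2 : conv l (regDeriv a κ y) =ᵐ[volume.restrict (Ioo 0 T)]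
      fun t => a * conv l y t - conv (conv l κ) y t := by
    filter_upwards [conv_sub_right hl (hy.const_mul a) (integrableOn_conv hκ hy),
      conv_assoc hl hκ hy]
      with t e1 e2
    rw [e2, ← conv_const_mul_right, ← e1]
    rfl
  have s3 : conv l (regKernel a κ) =ᵐ[volume.restrict (Ioo 0 T)]
      fun t => a * conv (fun _ => 1) l t - conv (fun _ => 1) (conv l κ) t := by
    filter_upwards [conv_sub_right hl (h1.const_mul a) (integrableOn_conv h1 hκ),
      conv_assoc h1 hl hκ, conv_assoc hl h1 hκ] with t e1 e2 e3
    rw [← e2, conv_comm_fun _ l, e3, ← conv_const_mul_right, ← e1]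
    congr 1; ext s
    simp [regKernel, conv_one_left]
  rw [s1, conv_one_conv_assoc hl (integrableOn_regDeriv hκ hy) hTT,
    intervalIntegral.integral_of_le hT.le,
    integral_Ioc_eq_integral_Ioo, integral_congr_ae s2,
    integral_sub (hly.const_mul a) (integrableOn_conv hlκ hy), integral_const_mul,
    conv_congr (ae_eq_refl y) s3 hTT]
  have hbdd : ∀ f : ℝ → ℝ, IntegrableOn f (Ioo 0 T) → ∀ b : ℝ,
      IntervalIntegrable (fun τ => y (T - τ) * (b * conv (fun _ => 1) f τ)) volume 0 T := by
    intro f hf b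
    refine intervalIntegrable_conv_bdd (M := |b| * (1 * ∫ s in Ioo 0 T, |f s|))
      (v := fun τ => b * conv (fun _ => 1) f τ) hy
      ((integrableOn_conv h1 hf).const_mul b).aestronglyMeasurable (fun t ht => ?_) hTT
    rw [abs_mul, conv_comm]
    exact mul_le_mul_of_nonneg_left
      (abs_conv_le_of_bdd zero_le_one hf (by simp) ⟨ht.1, ht.2.le⟩) (abs_nonneg b)
  have hi1 := hbdd l hl a
  have hi2 := hbdd (conv l κ) hlκ 1
  simp only [one_mul] at hi2
  have s4 : conv y (fun t => a * conv (fun _ => 1) l t - conv (fun _ => 1) (conv l κ) t) T =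
      conv y (fun t => a * conv (fun _ => 1) l t) T - conv y (conv (fun _ => 1) (conv l κ)) T := by
    simp only [conv, mul_sub]
    exact intervalIntegral.integral_sub hi1 hi2
  rw [s4, conv_const_mul_right, conv_comm y, conv_comm y, conv_one_conv_assoc hl hy hTT,
    conv_one_conv_assoc hlκ hy hTT,
    intervalIntegral.integral_of_le hT.le, intervalIntegral.integral_of_le hT.le,
    integral_Ioc_eq_integral_Ioo, integral_Ioc_eq_integral_Ioo]

end

/-! ### The integrated convexity inequality for regular data -/

section

variable {T c : ℝ} {k l q y w g ψ H : ℝ → ℝ}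

theorem tendsto_conv_of_tendsto_one {M : ℝ} {m : ℕ → ℝ → ℝ} (hT : 0 < T)
    (hm : ∀ n, IntegrableOn (m n) (Ioo 0 T))
    (hlim : Tendsto (fun n => ∫ t in Ioo 0 T, |m n t - 1|) atTop (𝓝 0))
    (hy : AEStronglyMeasurable y (volume.restrict (Ioo 0 T))) (hM : ∀ t ∈ Ioo 0 T, |y t| ≤ M) :
    Tendsto (fun n => conv y (m n) T) atTop (𝓝 (∫ t in Ioo 0 T, y t)) := by
  have hTT : T ∈ Ioc 0 T := ⟨hT, le_rfl⟩
  have h1 : IntegrableOn (fun _ : ℝ => (1 : ℝ)) (Ioo 0 T) := by simp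
  have hM0 : 0 ≤ M := (abs_nonneg _).trans (hM (T / 2) ⟨by linarith, by linarith⟩)
  rw [tendsto_iff_norm_sub_tendsto_zero]
  refine squeeze_zero (fun n => norm_nonneg _) (fun n => ?_) (by simpa using hlim.const_mul M)
  have e : conv y (m n) T - ∫ t in Ioo 0 T, y t = conv (fun t => m n t - 1) y T := by
    have e1 : ∫ t in Ioo 0 T, y t = conv (fun _ => 1) y T := by
      rw [conv_one_left, intervalIntegral.integral_of_le hT.le, integral_Ioc_eq_integral_Ioo]
    have i1 := intervalIntegrable_conv_bdd (hm n) hy hM hTT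
    have i2 := intervalIntegrable_conv_bdd h1 hy hM hTT
    rw [e1, conv_comm y]
    simp only [conv, sub_mul]
    exact (intervalIntegral.integral_sub i1 i2).symm
  rw [e]
  exact abs_conv_le_of_bdd (κ := fun t => m n t - 1) hM0 ((hm n).sub h1) hM hTT

theorem aestronglyMeasurable_conv {f : ℝ → ℝ} (hf : IntegrableOn f (Ioo 0 T))
    (hg : IntegrableOn g (Ioo 0 T)) :
    AEStronglyMeasurable (conv f g) (volume.restrict (Ioo 0 T)) :=
  (integrableOn_conv hf hg).aestronglyMeasurable

/-- The integral of `regDeriv a κ y` over `(0, T)` is the convolution of `y` with the non-negative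
kernel `regKernel a κ` at time `T`. -/
theorem integral_regDeriv_nonneg {a M : ℝ} {κ : ℝ → ℝ} (hT : 0 < T) (hκ : IntegrableOn κ (Ioo 0 T))
    (ha : ∀ t ∈ Icc 0 T, ∫ s in (0 : ℝ)..t, κ s ≤ a)
    (hy : AEStronglyMeasurable y (volume.restrict (Ioo 0 T))) (hM : ∀ t ∈ Ioo 0 T, |y t| ≤ M)
    (hy0 : ∀ t ∈ Ioo 0 T, 0 ≤ y t) :
    0 ≤ ∫ t in Ioo 0 T, regDeriv a κ y t := by
  have hTT : T ∈ Ioc 0 T := ⟨hT, le_rfl⟩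
  have h1 : IntegrableOn (fun _ : ℝ => a) (Ioo 0 T) := by simp
  have hyi := integrableOn_of_bdd hy hM
  have i1 := intervalIntegrable_conv_bdd h1 hy hM hTT
  have i2 := intervalIntegrable_conv_bdd
      (integrableOn_conv (f := fun _ => (1 : ℝ)) (by simp) hκ) hy hM hTT
  have e : ∫ t in Ioo 0 T, regDeriv a κ y t = conv (regKernel a κ) y T := by
    have e1 : conv (regKernel a κ) y T =
        conv (fun _ => a) y T - conv (conv (fun _ => 1) κ) y T := by
      rw [conv, conv, conv, ← intervalIntegral.integral_sub i1 i2]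
      simp only [regKernel, conv_one_left, sub_mul]
    rw [e1, conv_one_conv_assoc hκ hyi hTT, conv, intervalIntegral.integral_of_le hT.le,
      intervalIntegral.integral_of_le hT.le, integral_Ioc_eq_integral_Ioo,
        integral_Ioc_eq_integral_Ioo]
    exact integral_sub (hyi.const_mul a) (integrableOn_conv hκ hyi)
  rw [e, conv, intervalIntegral.integral_of_le hT.le, integral_Ioc_eq_integral_Ioo]
  refine setIntegral_nonneg measurableSet_Ioo fun τ hτ => mul_nonneg ?_ (hy0 τ hτ)
  exact sub_nonneg.2 (ha _ ⟨by linarith [hτ.2], by linarith [hτ.1]⟩)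

/-- The primitive of `l` is nonnegative: it solves `∂ₜ (k ∗ L) = 1`, so that the convexity
inequality for a convex function vanishing on `[0, ∞)` applies to it. -/
theorem IsPC.ae_primitive_nonneg (h : IsPC k l) (hT : 0 < T) :
    ∀ᵐ t ∂(volume.restrict (Ioo 0 T)), 0 ≤ conv l (fun _ => 1) t := by
  obtain ⟨a, κ, hκ, hκ0, ha, hlim⟩ := h.exists_regular_approx hT
  have hl := h.l_locInt T hT
  have h1 : IntegrableOn (fun _ : ℝ => (1 : ℝ)) (Ioo 0 T) := by simp
  have h0 : IntegrableOn (fun _ : ℝ => (0 : ℝ)) (Ioo 0 T) := by simp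
  have htend := h.tendsto_regDeriv (q := fun _ => 0) (g := fun _ => 1) (c := 1) hT hκ hlim h0
      (by simp)
  set L := conv l (fun _ => 1) with hL
  have hLm := aestronglyMeasurable_conv hl h1
  -- `antideriv H` is non-negative and vanishes exactly on `[0, ∞)`
  set H : ℝ → ℝ := fun y => max (-1) (min y 0) with hH
  have hHc : Continuous H := by fun_prop
  have hHm : Monotone H := fun x y hxy => max_le_max le_rfl (min_le_min hxy le_rfl)
  have hHn : ∀ y, H y ≤ 0 := fun y => max_le (by norm_num) (min_le_right _ _)
  have hHb : ∀ y, |H y| ≤ 1 := fun y => abs_le.2 ⟨le_max_left _ _, (hHn y).trans zero_le_one⟩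
  have hΨ : ∀ y, 0 ≤ antideriv H y - antideriv H 0 := by
    intro y
    have := antideriv_convex hHc hHm 0 y
    simpa [hH] using this
  have hLM : ∀ t ∈ Ioo 0 T, |L t| ≤ 1 * ∫ s in Ioo 0 T, |l s| := fun t ht =>
    abs_conv_le_of_bdd zero_le_one hl (by simp) ⟨ht.1, ht.2.le⟩
  have hnonneg : ∀ n, 0 ≤ ∫ t in Ioo 0 T, H (L t) * regDeriv (a n) (κ n) L t := by
    intro n
    have hwc := weighted_convexity_inequality (ψ := fun _ => 1) (C := 1) (v₀ := 0) hHc hHm hHb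
        (hκ n) (hκ0 n)
      (fun t ht => ha n t ⟨ht.1.le, ht.2.le⟩) hLm hLM aestronglyMeasurable_const (by simp) (by simp)
    simp only [one_mul, zero_add] at hwc
    refine le_trans ?_ hwc
    refine integral_regDeriv_nonneg (M := 1 * ∫ s in Ioo 0 T, |l s|) hT (hκ n) (ha n)
      (((continuous_antideriv hHc).comp_aestronglyMeasurable hLm).sub aestronglyMeasurable_const)
      (fun t ht => ?_) fun t _ => hΨ _
    refine (abs_antideriv_sub_le hHc hHb _ _).trans ?_
    simpa using hLM t ht
  have hLi := integrableOn_conv hl h1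
  have hlim2 := tendsto_weighted_integral (C := 1) (θ := fun t => H (L t))
    (fun n => integrableOn_regDeriv (a := a n) (hκ n) hLi) h1 htend
    (hHc.comp_aestronglyMeasurable hLm) (fun t _ => hHb _)
  have h3 := ge_of_tendsto' hlim2 hnonneg
  simp only [mul_one] at h3
  have hHi : IntegrableOn (fun t => H (L t)) (Ioo 0 T) :=
    integrableOn_of_bdd (hHc.comp_aestronglyMeasurable hLm) fun t _ => hHb _
  have h4 : ∫ t in Ioo 0 T, -H (L t) = 0 := by
    refine le_antisymm ?_ (integral_nonneg fun t => neg_nonneg.2 (hHn _))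
    rw [integral_neg]; linarith
  rw [integral_eq_zero_iff_of_nonneg (fun t => neg_nonneg.2 (hHn _)) hHi.neg] at h4
  filter_upwards [h4] with t ht
  have ht' : H (L t) = 0 := by simpa using ht
  by_contra hneg
  have : H (L t) < 0 := max_lt (by norm_num) ((min_le_left _ _).trans_lt (not_le.1 hneg))
  linarith

theorem IsPC.intervalIntegrable_l (h : IsPC k l) {b : ℝ} (hb : 0 ≤ b) :
    IntervalIntegrable l volume 0 b := by
  rcases hb.eq_or_lt with rfl | hb'
  · simp
  · rw [intervalIntegrable_iff_integrableOn_Ioo_of_le hb]; exact h.l_locInt b hb'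

theorem IsPC.continuousOn_primitive_l (h : IsPC k l) (hT : 0 < T) :
    ContinuousOn (fun t => ∫ s in (0 : ℝ)..t, l s) (Icc 0 T) := by
  rw [← uIcc_of_le hT.le]
  exact intervalIntegral.continuousOn_primitive_interval
    ((intervalIntegrable_iff').1 (h.intervalIntegrable_l hT.le))

/-- By continuity, the bound of `IsPC.ae_primitive_nonneg` holds for all times. -/
theorem IsPC.primitive_nonneg (h : IsPC k l) {t : ℝ} (ht : 0 ≤ t) :
    0 ≤ ∫ s in (0 : ℝ)..t, l s := by
  rcases ht.eq_or_lt with rfl | ht0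
  · simp
  have hT : 0 < t + 1 := by linarith
  have hc : ContinuousOn (fun t => ∫ s in (0 : ℝ)..t, l s) (Ioo 0 (t + 1)) :=
    (h.continuousOn_primitive_l hT).mono Ioo_subset_Icc_self
  have hae : (fun t => min (∫ s in (0 : ℝ)..t, l s) 0) =ᵐ[volume.restrict (Ioo 0 (t + 1))]
      fun _ => 0 := by
    filter_upwards [h.ae_primitive_nonneg hT] with s hs
    rw [conv_comm, conv_one_left] at hs
    exact min_eq_right hs
  have := Measure.eqOn_Ioo_of_ae_eq volume hae (hc.inf continuousOn_const) continuousOn_const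
    ⟨ht0, by linarith⟩
  exact min_eq_right_iff.1 this

theorem IsPC.primitive_le (h : IsPC k l) {t : ℝ} (ht : t ∈ Icc 0 T) :
    ∫ s in (0 : ℝ)..t, l s ≤ ∫ s in Ioo 0 T, |l s| := by
  rcases ht.1.eq_or_lt with rfl | ht0
  · simpa using integral_nonneg (fun _ => abs_nonneg _)
  refine (le_abs_self _).trans ((intervalIntegral.abs_integral_le_integral_abs ht.1).trans ?_)
  rw [intervalIntegral.integral_of_le ht.1, integral_Ioc_eq_integral_Ioo]
  exact setIntegral_mono_set (h.l_locInt T (ht0.trans_le ht.2)).abs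
    (Eventually.of_forall fun _ => abs_nonneg _) (Ioo_subset_Ioo_right ht.2).eventuallyLE

theorem IsPC.abs_weight_le (h : IsPC k l) {t : ℝ} (ht : t ∈ Ioo 0 T) :
    |∫ s in (0 : ℝ)..(T - t), l s| ≤ ∫ s in Ioo 0 T, |l s| := by
  rw [abs_of_nonneg (h.primitive_nonneg (by linarith [ht.2]))]
  exact h.primitive_le ⟨by linarith [ht.2], by linarith [ht.1]⟩

theorem IsPC.continuousOn_weight (h : IsPC k l) (hT : 0 < T) :
    ContinuousOn (fun t => ∫ s in (0 : ℝ)..(T - t), l s) (Icc 0 T) :=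
  (h.continuousOn_primitive_l hT).comp (by fun_prop)
    fun t ht => ⟨by linarith [ht.2], by linarith [ht.1]⟩

theorem IsPC.aestronglyMeasurable_weight (h : IsPC k l) (hT : 0 < T) :
    AEStronglyMeasurable (fun t => ∫ s in (0 : ℝ)..(T - t), l s) (volume.restrict (Ioo 0 T)) :=
  ((h.continuousOn_weight hT).mono Ioo_subset_Icc_self).aestronglyMeasurable measurableSet_Ioo

/-- The integrated convexity inequality for `v = v₀ + l ∗ g` with a regular datum `g`. -/
theorem IsPC.integral_antideriv_le_of_primitive {M v₀ : ℝ} (h : IsPC k l) (hT : 0 < T)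
    (hHc : Continuous H) (hHm : Monotone H) (hHb : ∀ y, |H y| ≤ 1)
    (hq : IntegrableOn q (Ioo 0 T)) (hg : ∀ t, g t = c + ∫ s in (0 : ℝ)..t, q s)
    (hgM : ∀ t ∈ Ioo 0 T, |g t| ≤ M) :
    ∫ t in Ioo 0 T, (antideriv H (v₀ + conv l g t) - antideriv H v₀) ≤
      ∫ t in Ioo 0 T, (∫ s in (0 : ℝ)..(T - t), l s) * (H (v₀ + conv l g t) * g t) := by
  obtain ⟨a, κ, hκ, hκ0, ha, hlim⟩ := h.exists_regular_approx hT
  have hl := h.l_locInt T hT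
  have hM0 : 0 ≤ M := (abs_nonneg _).trans (hgM (T / 2) ⟨by linarith, by linarith⟩)
  have hgi : IntegrableOn g (Ioo 0 T) := by
    rw [show g = fun t => c + ∫ s in (0 : ℝ)..t, q s from funext hg]
    exact Integrable.add (by simp) (integrableOn_primitive hq)
  have htend := h.tendsto_regDeriv hT hκ hlim hq hg
  have hwi := integrableOn_conv hl hgi
  have hwm := hwi.aestronglyMeasurable
  have hwM : ∀ t ∈ Ioo 0 T, |conv l g t| ≤ M * ∫ s in Ioo 0 T, |l s| := fun t ht =>
    abs_conv_le_of_bdd hM0 hl hgM ⟨ht.1, ht.2.le⟩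
  have hvm : AEStronglyMeasurable (fun t => v₀ + conv l g t) (volume.restrict (Ioo 0 T)) :=
    aestronglyMeasurable_const.add hwm
  have hym : AEStronglyMeasurable (fun t => antideriv H (v₀ + conv l g t) - antideriv H v₀)
    (volume.restrict (Ioo 0 T)) :=
    ((continuous_antideriv hHc).comp_aestronglyMeasurable hvm).sub aestronglyMeasurable_const
  have hyM : ∀ t ∈ Ioo 0 T, |antideriv H (v₀ + conv l g t) - antideriv H v₀| ≤
      M * ∫ s in Ioo 0 T, |l s| := fun t ht => by
    refine (abs_antideriv_sub_le hHc hHb _ _).trans ?_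
    simpa using hwM t ht
  have hψ0 : ∀ t ∈ Ioo 0 T, 0 ≤ ∫ s in (0 : ℝ)..(T - t), l s := fun t ht =>
    h.primitive_nonneg (by linarith [ht.2])
  have hψm := h.aestronglyMeasurable_weight hT
  have hle : ∀ n, conv (fun t => antideriv H (v₀ + conv l g t) - antideriv H v₀)
      (conv l (regKernel (a n) (κ n))) T ≤
      ∫ t in Ioo 0 T, ((∫ s in (0 : ℝ)..(T - t), l s) * H (v₀ + conv l g t)) *
        regDeriv (a n) (κ n) (conv l g) t := by
    intro n
    rw [← integral_weight_regDeriv hT (hκ n) hl (integrableOn_of_bdd hym hyM)]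
    simp only [mul_assoc]
    exact weighted_convexity_inequality hHc hHm hHb (hκ n) (hκ0 n)
      (fun t ht => ha n t ⟨ht.1.le, ht.2.le⟩) hwm hwM hψm (fun t ht => h.abs_weight_le ht) hψ0
  have h1 := tendsto_conv_of_tendsto_one hT
    (fun n => integrableOn_conv hl (integrableOn_regKernel (a := a n) (hκ n)))
    (h.tendsto_conv_regKernel hT hκ hlim) hym hyM
  have h2 := tendsto_weighted_integral (C := (∫ s in Ioo 0 T, |l s|) * 1)
    (θ := fun t => (∫ s in (0 : ℝ)..(T - t), l s) * H (v₀ + conv l g t))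
    (fun n => integrableOn_regDeriv (a := a n) (hκ n) hwi) hgi htend
    (hψm.mul (hHc.comp_aestronglyMeasurable hvm)) (fun t ht => by
      rw [abs_mul]
      exact mul_le_mul (h.abs_weight_le ht) (hHb _) (abs_nonneg _)
        (integral_nonneg fun _ => abs_nonneg _))
  simp only [mul_assoc] at h2 hle
  exact le_of_tendsto_of_tendsto' h1 h2 hle

/-- Polynomials are dense in `L¹(0,T)`. -/
theorem exists_polynomial_integral_abs_sub_le (hT : 0 < T) (hg : IntegrableOn g (Ioo 0 T)) {ε : ℝ}
    (hε : 0 < ε) : ∃ p : Polynomial ℝ, ∫ t in Ioo 0 T, |g t - p.eval t| ≤ ε := by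
  obtain ⟨f, -, hf, hfc, hfi⟩ :=
    Integrable.exists_hasCompactSupport_integral_sub_le hg (half_pos hε)
  obtain ⟨p, hp⟩ := exists_polynomial_near_of_continuousOn 0 T f hfc.continuousOn (ε / (2 * T))
    (by positivity)
  refine ⟨p, ?_⟩
  have hpi : IntegrableOn (fun t => p.eval t) (Ioo 0 T) :=
    (p.continuous.integrableOn_Icc).mono_set Ioo_subset_Icc_self
  have e1 : ∫ t in Ioo 0 T, |g t - p.eval t| ≤
      ∫ t in Ioo 0 T, (‖g t - f t‖ + ε / (2 * T)) := by
    refine setIntegral_mono_on (hg.sub hpi).abs ((hg.sub hfi).norm.add (by simp)) measurableSet_Ioo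
      fun t ht => ?_
    have h1 := hp t ⟨ht.1.le, ht.2.le⟩
    have h2 : g t - p.eval t = (g t - f t) - (p.eval t - f t) := by ring
    rw [h2, Real.norm_eq_abs]
    exact (abs_sub _ _).trans (add_le_add le_rfl h1.le)
  refine e1.trans ?_
  have hgf : Integrable (fun t => ‖g t - f t‖) (volume.restrict (Ioo 0 T)) := (hg.sub hfi).norm
  rw [integral_add hgf (by simp)]
  simp only [integral_const, smul_eq_mul, measureReal_restrict_apply_univ,
    Real.volume_real_Ioo_of_le hT.le, sub_zero]
  have : T * (ε / (2 * T)) = ε / 2 := by field_simp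
  linarith

theorem ae_eq_zero_of_primitive_ae_eq_zero (hT : 0 < T) (hg : IntegrableOn g (Ioo 0 T))
    (h0 : ∀ᵐ t ∂(volume.restrict (Ioo 0 T)), ∫ s in (0 : ℝ)..t, g s = 0) :
    g =ᵐ[volume.restrict (Ioo 0 T)] fun _ => 0 := by
  have hgi : IntervalIntegrable g volume 0 T := by
    rwa [intervalIntegrable_iff_integrableOn_Ioo_of_le hT.le]
  have hc : ContinuousOn (fun t => ∫ s in (0 : ℝ)..t, g s) (Ioo 0 T) := by
    refine ContinuousOn.mono (intervalIntegral.continuousOn_primitive_interval (b := T)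
      ((intervalIntegrable_iff').1 hgi)) ?_
    rw [uIcc_of_le hT.le]; exact Ioo_subset_Icc_self
  have heq := Measure.eqOn_Ioo_of_ae_eq (g := fun _ => (0 : ℝ)) volume h0 hc continuousOn_const
  filter_upwards [ae_restrict_of_ae hgi.ae_hasDerivAt_integral, ae_restrict_mem measurableSet_Ioo]
    with t ht htT
  have hd := ht (by rw [uIcc_of_le hT.le]; exact ⟨htT.1.le, htT.2.le⟩) 0 (by simp)
  have hd' : HasDerivAt (fun t => ∫ s in (0 : ℝ)..t, g s) 0 t :=
    (hasDerivAt_const t (0 : ℝ)).congr_of_eventuallyEq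
      (heq.eventuallyEq_of_mem (Ioo_mem_nhds htT.1 htT.2))
  exact hd.unique hd'

/-- Inversion of the convolution with `k`: if `k ∗ w = 1 ∗ g`, then `w = l ∗ g`. -/
theorem IsPC.eq_conv_of_conv_eq (h : IsPC k l) (hT : 0 < T) (hw : IntegrableOn w (Ioo 0 T))
    (hg : IntegrableOn g (Ioo 0 T))
    (hwg : ∀ᵐ t ∂(volume.restrict (Ioo 0 T)), conv k w t = ∫ s in (0 : ℝ)..t, g s) :
    w =ᵐ[volume.restrict (Ioo 0 T)] conv l g := by
  have hl := h.l_locInt T hT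
  have hk := h.k_locInt T hT
  have h1 : IntegrableOn (fun _ : ℝ => (1 : ℝ)) (Ioo 0 T) := by simp
  have hlg := integrableOn_conv hl hg
  have hwg' : conv k w =ᵐ[volume.restrict (Ioo 0 T)] conv (fun _ => 1) g := by
    filter_upwards [hwg] with t ht
    rw [ht, conv_one_left]
  -- `1 ∗ w = l ∗ k ∗ w = l ∗ 1 ∗ g = 1 ∗ (l ∗ g)`
  have key : ∀ᵐ t ∂(volume.restrict (Ioo 0 T)), ∫ s in (0 : ℝ)..t, (w s - conv l g s) = 0 := by
    filter_upwards [conv_assoc hl hk hw, conv_assoc hl h1 hg, conv_sub_right h1 hw hlg,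
      ae_restrict_mem measurableSet_Ioo] with t e1 e2 e3 ht
    have ht' : t ∈ Ioc 0 T := ⟨ht.1, ht.2.le⟩
    rw [← conv_one_left, e3, ← conv_congr (h.conv_l_k_ae T) (ae_eq_refl w) ht', e1,
      conv_congr (ae_eq_refl l) hwg' ht', ← e2, conv_comm_fun l, conv_one_conv_assoc hl hg ht',
      conv_one_left, sub_self]
  filter_upwards [ae_eq_zero_of_primitive_ae_eq_zero hT (hw.sub hlg) key] with t ht
  exact sub_eq_zero.1 ht

end

/-! ### The estimate for the positive part of a scalar solution -/

section

variable {T : ℝ} {k l w g H : ℝ → ℝ}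

/-- The integrated convexity inequality for solutions `v = v₀ + w` of `∂ₜ (k ∗ (v - v₀)) = g`. -/
theorem IsPC.integral_antideriv_le (h : IsPC k l) (hT : 0 < T)
    (hHc : Continuous H) (hHm : Monotone H) (hHb : ∀ y, |H y| ≤ 1)
    (hw : IntegrableOn w (Ioo 0 T)) (hg : IntegrableOn g (Ioo 0 T))
    (hwg : ∀ᵐ t ∂(volume.restrict (Ioo 0 T)), conv k w t = ∫ s in (0 : ℝ)..t, g s) (v₀ : ℝ) :
    ∫ t in Ioo 0 T, (antideriv H (v₀ + w t) - antideriv H v₀) ≤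
      ∫ t in Ioo 0 T, (∫ s in (0 : ℝ)..(T - t), l s) * (H (v₀ + w t) * g t) := by
  have hl := h.l_locInt T hT
  have hwl := h.eq_conv_of_conv_eq hT hw hg hwg
  choose p hp using fun n : ℕ => exists_polynomial_integral_abs_sub_le hT hg
    (ε := 1 / ((n : ℝ) + 1)) (by positivity)
  have hpi : ∀ n, IntegrableOn (fun t => (p n).eval t) (Ioo 0 T) := fun n =>
    ((p n).continuous.integrableOn_Icc).mono_set Ioo_subset_Icc_self
  set L := ∫ t in Ioo 0 T, |l t| with hL
  have hL0 : 0 ≤ L := integral_nonneg fun _ => abs_nonneg _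
  have hδ : Tendsto (fun n : ℕ => 1 / ((n : ℝ) + 1)) atTop (𝓝 0) :=
      tendsto_one_div_add_atTop_nhds_zero_nat
  set W : ℕ → ℝ → ℝ := fun n => conv l (fun t => (p n).eval t) with hW
  have hWi : ∀ n, IntegrableOn (W n) (Ioo 0 T) := fun n => integrableOn_conv hl (hpi n)
  have hWb : ∀ n, ∫ t in Ioo 0 T, |W n t - w t| ≤ L * (1 / ((n : ℝ) + 1)) := by
    intro n
    refine le_trans (le_of_eq ?_) ((integral_abs_conv_le hl (hg.sub (hpi n))).trans
      (mul_le_mul_of_nonneg_left (hp n) hL0))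
    refine integral_congr_ae ?_
    filter_upwards [hwl, conv_sub_right hl hg (hpi n)] with t h1 h2
    rw [h1, abs_sub_comm, ← h2]
    rfl
  have hWlim : Tendsto (fun n => ∫ t in Ioo 0 T, |W n t - w t|) atTop (𝓝 0) :=
    squeeze_zero (fun n => integral_nonneg fun _ => abs_nonneg _) hWb
      (by simpa using hδ.const_mul L)
  -- a subsequence of the solutions with polynomial data converges almost everywhere
  obtain ⟨ns, hns, hae⟩ : ∃ ns : ℕ → ℕ, StrictMono ns ∧ ∀ᵐ t ∂(volume.restrict (Ioo 0 T)),
      Tendsto (fun i => W (ns i) t) atTop (𝓝 (w t)) := by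
    refine TendstoInMeasure.exists_seq_tendsto_ae (tendstoInMeasure_of_tendsto_eLpNorm
      (p := 1) one_ne_zero (fun n => (hWi n).aestronglyMeasurable) hw.aestronglyMeasurable ?_)
    have e : ∀ n, eLpNorm (W n - w) 1 (volume.restrict (Ioo 0 T)) =
        ENNReal.ofReal (∫ t in Ioo 0 T, |W n t - w t|) := by
      intro n
      rw [eLpNorm_one_eq_lintegral_enorm, ← ofReal_integral_norm_eq_lintegral_enorm
        ((hWi n).sub hw)]
      rfl
    simp only [e]
    simpa using ENNReal.tendsto_ofReal hWlim
  have hψm := h.aestronglyMeasurable_weight hT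
  have hvm : AEStronglyMeasurable (fun t => v₀ + w t) (volume.restrict (Ioo 0 T)) :=
    aestronglyMeasurable_const.add hw.aestronglyMeasurable
  have hVm : ∀ n, AEStronglyMeasurable (fun t => v₀ + W n t) (volume.restrict (Ioo 0 T)) :=
    fun n => aestronglyMeasurable_const.add (hWi n).aestronglyMeasurable
  have hYi : ∀ z : ℝ → ℝ, IntegrableOn z (Ioo 0 T) →
      IntegrableOn (fun t => antideriv H (v₀ + z t) - antideriv H v₀) (Ioo 0 T) := by
    intro z hz
    refine Integrable.mono' hz.abs (((continuous_antideriv hHc).comp_aestronglyMeasurable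
      (aestronglyMeasurable_const.add hz.aestronglyMeasurable)).sub aestronglyMeasurable_const)
      (Eventually.of_forall fun t => ?_)
    simpa using abs_antideriv_sub_le hHc hHb v₀ (v₀ + z t)
  have hineq : ∀ n, ∫ t in Ioo 0 T, (antideriv H (v₀ + W n t) - antideriv H v₀) ≤
      ∫ t in Ioo 0 T, (∫ s in (0 : ℝ)..(T - t), l s) * (H (v₀ + W n t) * (p n).eval t) := by
    intro n
    obtain ⟨C, hC⟩ := (isCompact_Icc (a := (0 : ℝ)) (b := T)).exists_bound_of_continuousOn
      ((p n).continuous.continuousOn)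
    refine h.integral_antideriv_le_of_primitive (c := (p n).eval 0)
      (q := fun t => (p n).derivative.eval t) (M := C) hT hHc hHm hHb ?_ (fun t => ?_)
      (fun t ht => hC t ⟨ht.1.le, ht.2.le⟩)
    · exact ((p n).derivative.continuous.integrableOn_Icc).mono_set Ioo_subset_Icc_self
    · rw [intervalIntegral.integral_eq_sub_of_hasDerivAt (fun x _ => (p n).hasDerivAt x)
        ((p n).derivative.continuous.intervalIntegrable _ _)]
      ring
  have hlimL : Tendsto
      (fun i => ∫ t in Ioo 0 T, (antideriv H (v₀ + W (ns i) t) - antideriv H v₀)) atTop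
      (𝓝 (∫ t in Ioo 0 T, (antideriv H (v₀ + w t) - antideriv H v₀))) := by
    have : Tendsto (fun n => ∫ t in Ioo 0 T, 1 * (antideriv H (v₀ + W n t) - antideriv H v₀)) atTop
      (𝓝 (∫ t in Ioo 0 T, 1 * (antideriv H (v₀ + w t) - antideriv H v₀))) := by
      refine tendsto_weighted_integral (C := 1) (fun n => hYi _ (hWi n)) (hYi _ hw) ?_
        aestronglyMeasurable_const (by simp)
      refine squeeze_zero (fun n => integral_nonneg fun _ => abs_nonneg _) (fun n => ?_) hWlim
      refine integral_mono ((hYi _ (hWi n)).sub (hYi _ hw)).abs ((hWi n).sub hw).abs fun t => ?_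
      simpa using abs_antideriv_sub_le hHc hHb (v₀ + w t) (v₀ + W n t)
    simp only [one_mul] at this
    exact this.comp hns.tendsto_atTop
  have hbd : ∀ v : ℝ → ℝ, ∀ t ∈ Ioo 0 T, |(∫ s in (0 : ℝ)..(T - t), l s) * H (v t)| ≤ L * 1 := by
    intro v t ht
    rw [abs_mul]
    exact mul_le_mul (h.abs_weight_le ht) (hHb _) (abs_nonneg _) hL0
  have hbd' : ∀ v : ℝ → ℝ, ∀ᵐ t ∂(volume.restrict (Ioo 0 T)),
      ‖(∫ s in (0 : ℝ)..(T - t), l s) * H (v t)‖ ≤ L * 1 := by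
    intro v
    filter_upwards [ae_restrict_mem measurableSet_Ioo] with t ht using hbd v t ht
  have hθm : ∀ n, AEStronglyMeasurable (fun t => (∫ s in (0 : ℝ)..(T - t), l s) * H (v₀ + W n t))
      (volume.restrict (Ioo 0 T)) := fun n => hψm.mul (hHc.comp_aestronglyMeasurable (hVm n))
  -- the data converge in `L¹`, the other factors boundedly almost everywhere
  have hlimR : Tendsto (fun i => ∫ t in Ioo 0 T,
      ((∫ s in (0 : ℝ)..(T - t), l s) * H (v₀ + W (ns i) t)) * (p (ns i)).eval t) atTop
      (𝓝 (∫ t in Ioo 0 T, ((∫ s in (0 : ℝ)..(T - t), l s) * H (v₀ + w t)) * g t)) := by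
    have h1 : Tendsto (fun i => ∫ t in Ioo 0 T,
      ((∫ s in (0 : ℝ)..(T - t), l s) * H (v₀ + W (ns i) t)) * g t) atTop
      (𝓝 (∫ t in Ioo 0 T, ((∫ s in (0 : ℝ)..(T - t), l s) * H (v₀ + w t)) * g t)) := by
      refine tendsto_integral_of_dominated_convergence (fun t => L * 1 * |g t|)
        (fun i => (hθm (ns i)).mul hg.aestronglyMeasurable) (hg.abs.const_mul _) (fun i => ?_) ?_
      · filter_upwards [hbd' fun t => v₀ + W (ns i) t] with t ht
        rw [norm_mul]
        exact mul_le_mul_of_nonneg_right ht (norm_nonneg _)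
      · filter_upwards [hae] with t ht
        refine Tendsto.mul_const _ (Tendsto.const_mul _ ?_)
        exact (hHc.tendsto _).comp (ht.const_add v₀)
    have h2 : Tendsto (fun i => ∫ t in Ioo 0 T,
      ((∫ s in (0 : ℝ)..(T - t), l s) * H (v₀ + W (ns i) t)) * ((p (ns i)).eval t - g t)) atTop
        (𝓝 0) := by
      rw [tendsto_zero_iff_norm_tendsto_zero]
      refine squeeze_zero (fun i => norm_nonneg _) (fun i => ?_)
        (g := fun i => L * 1 * (1 / ((ns i : ℝ) + 1)))
        (by simpa using (hδ.comp hns.tendsto_atTop).const_mul (L * 1))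
      refine le_trans (norm_integral_le_of_norm_le
        (g := fun t => L * 1 * |g t - (p (ns i)).eval t|) ((hg.sub (hpi _)).abs.const_mul _) ?_) ?_
      · filter_upwards [hbd' fun t => v₀ + W (ns i) t] with t ht
        rw [norm_mul, abs_sub_comm]
        exact mul_le_mul_of_nonneg_right ht (norm_nonneg _)
      · rw [integral_const_mul]
        exact mul_le_mul_of_nonneg_left (hp _) (by linarith)
    have h3 := h1.add h2
    rw [add_zero] at h3
    refine h3.congr fun i => ?_
    have hd : IntegrableOn (fun t => (p (ns i)).eval t - g t) (Ioo 0 T) := (hpi _).sub hg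
    rw [← integral_add (hg.bdd_mul (hθm _) (hbd' _)) (hd.bdd_mul (hθm _) (hbd' _))]
    congr 1; ext t; ring
  simp only [mul_assoc] at hlimR
  exact le_of_tendsto_of_tendsto' hlimL hlimR fun i => hineq _

/-- A smooth non-decreasing approximation of the indicator function of `(0, ∞)`. -/
def posApprox (n : ℕ) (y : ℝ) : ℝ := Real.smoothTransition (n * y)

theorem contDiff_posApprox (n : ℕ) : ContDiff ℝ ∞ (posApprox n) :=
  Real.smoothTransition.contDiff.comp (contDiff_const.mul contDiff_id)

theorem continuous_posApprox (n : ℕ) : Continuous (posApprox n) := (contDiff_posApprox n).continuous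

theorem monotone_posApprox (n : ℕ) : Monotone (posApprox n) := fun _ _ hxy =>
  Real.smoothTransition.monotone (mul_le_mul_of_nonneg_left hxy n.cast_nonneg)

theorem posApprox_nonneg (n : ℕ) (y : ℝ) : 0 ≤ posApprox n y := Real.smoothTransition.nonneg _

theorem posApprox_le_one (n : ℕ) (y : ℝ) : posApprox n y ≤ 1 := Real.smoothTransition.le_one _

theorem abs_posApprox_le_one (n : ℕ) (y : ℝ) : |posApprox n y| ≤ 1 := by
  rw [abs_of_nonneg (posApprox_nonneg n y)]; exact posApprox_le_one n y

theorem posApprox_of_nonpos (n : ℕ) {y : ℝ} (hy : y ≤ 0) : posApprox n y = 0 :=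
  Real.smoothTransition.zero_of_nonpos (mul_nonpos_of_nonneg_of_nonpos n.cast_nonneg hy)

/-- The indicator function of `(0, ∞)`. -/
def heaviside (y : ℝ) : ℝ := if 0 < y then 1 else 0

theorem heaviside_nonneg (y : ℝ) : 0 ≤ heaviside y := by unfold heaviside; split_ifs <;> simp

theorem heaviside_le_one (y : ℝ) : heaviside y ≤ 1 := by unfold heaviside; split_ifs <;> simp

theorem measurable_heaviside : Measurable heaviside :=
  Measurable.ite measurableSet_Ioi measurable_const measurable_const

theorem tendsto_posApprox (y : ℝ) : Tendsto (fun n => posApprox n y) atTop (𝓝 (heaviside y)) := by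
  unfold heaviside
  split_ifs with hy
  · refine tendsto_const_nhds.congr' ?_
    obtain ⟨N, hN⟩ := exists_nat_ge (1 / y)
    filter_upwards [eventually_ge_atTop N] with n hn
    refine (Real.smoothTransition.one_of_one_le ?_).symm
    have : 1 / y ≤ n := hN.trans (by exact_mod_cast hn)
    rwa [div_le_iff₀ hy] at this
  · simp [posApprox_of_nonpos _ (not_lt.1 hy)]

theorem antideriv_posApprox_le (n : ℕ) (y : ℝ) : antideriv (posApprox n) y ≤ max y 0 := by
  unfold antideriv
  rcases le_total 0 y with hy | hy
  · have := intervalIntegral.integral_mono_on (f := posApprox n) (g := fun _ => 1) (μ := volume) hy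
      ((continuous_posApprox n).intervalIntegrable _ _) (by simp) fun s _ => posApprox_le_one n s
    simpa [hy] using this
  · have : ∫ s in (0 : ℝ)..y, posApprox n s = ∫ s in (0 : ℝ)..y, 0 :=
      intervalIntegral.integral_congr fun s hs => by
        rw [uIcc_of_ge hy] at hs
        exact posApprox_of_nonpos n hs.2
    rw [this]; simp

theorem le_antideriv_posApprox (n : ℕ) (y : ℝ) :
    max y 0 - 1 / ((n : ℝ) + 1) ≤ antideriv (posApprox (n + 1)) y := by
  have hc := continuous_posApprox (n + 1)
  have hm := monotone_posApprox (n + 1)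
  have hn : (0 : ℝ) < (n : ℝ) + 1 := by positivity
  have h0 : antideriv (posApprox (n + 1)) 0 = 0 := by simp [antideriv]
  have hnn : ∀ z, 0 ≤ antideriv (posApprox (n + 1)) z := by
    intro z
    have := antideriv_convex hc hm 0 z
    rw [posApprox_of_nonpos _ le_rfl, h0] at this
    linarith
  have h1 := antideriv_convex hc hm (1 / ((n : ℝ) + 1)) y
  have h2 : posApprox (n + 1) (1 / ((n : ℝ) + 1)) = 1 := by
    refine Real.smoothTransition.one_of_one_le (le_of_eq ?_)
    push_cast
    field_simp
  rw [h2] at h1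
  have h3 := hnn y
  have h4 := hnn (1 / ((n : ℝ) + 1))
  have h5 : 0 < 1 / ((n : ℝ) + 1) := by positivity
  rcases le_total 0 y with hy | hy
  · rw [max_eq_left hy]; linarith
  · rw [max_eq_right hy]; linarith

/-- The estimate for the positive part of a solution `v = v₀ + w` of the scalar equation
`∂ₜ (k ∗ (v - v₀)) = g`. -/
theorem IsPC.integral_pos_part_le (h : IsPC k l) (hT : 0 < T)
    (hw : IntegrableOn w (Ioo 0 T)) (hg : IntegrableOn g (Ioo 0 T))
    (hwg : ∀ᵐ t ∂(volume.restrict (Ioo 0 T)), conv k w t = ∫ s in (0 : ℝ)..t, g s) (v₀ : ℝ) :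
    ∫ t in Ioo 0 T, max (v₀ + w t) 0 ≤ T * max v₀ 0 +
      ∫ t in Ioo 0 T, (∫ s in (0 : ℝ)..(T - t), l s) * (heaviside (v₀ + w t) * g t) := by
  have hvi : IntegrableOn (fun t => v₀ + w t) (Ioo 0 T) := Integrable.add (by simp) hw
  have hψm := h.aestronglyMeasurable_weight hT
  have hle : ∀ n : ℕ, (∫ t in Ioo 0 T, max (v₀ + w t) 0) - T * (1 / ((n : ℝ) + 1)) - T * max v₀ 0 ≤
      ∫ t in Ioo 0 T, (∫ s in (0 : ℝ)..(T - t), l s) * (posApprox (n + 1) (v₀ + w t) * g t) := by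
    intro n
    refine le_trans ?_ (h.integral_antideriv_le hT (continuous_posApprox (n + 1))
      (monotone_posApprox _) (abs_posApprox_le_one _) hw hg hwg v₀)
    have hc : ∀ c : ℝ, ∫ t in Ioo 0 T, c = T * c := by
      intro c
      simp [Real.volume_real_Ioo_of_le hT.le]
    have hci : ∀ c : ℝ, IntegrableOn (fun _ => c) (Ioo 0 T) := fun c => by simp
    have hd : IntegrableOn (fun t => max (v₀ + w t) 0 - 1 / ((n : ℝ) + 1)) (Ioo 0 T) :=
      hvi.pos_part.sub (hci _)
    rw [← hc, ← hc, ← integral_sub hvi.pos_part (hci _), ← integral_sub hd (hci _)]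
    refine integral_mono (hd.sub (hci _)) ?_ fun t => ?_
    · refine Integrable.mono' hw.abs
        (((continuous_antideriv (continuous_posApprox _)).comp_aestronglyMeasurable
        hvi.aestronglyMeasurable).sub aestronglyMeasurable_const) (Eventually.of_forall fun t => ?_)
      simpa using abs_antideriv_sub_le (continuous_posApprox (n + 1)) (abs_posApprox_le_one _) v₀
        (v₀ + w t)
    · have h1 := le_antideriv_posApprox n (v₀ + w t)
      have h2 := antideriv_posApprox_le (n + 1) v₀
      simp only
      linarith
  have hδ : Tendsto (fun n : ℕ => 1 / ((n : ℝ) + 1)) atTop (𝓝 0) :=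
      tendsto_one_div_add_atTop_nhds_zero_nat
  have hL : Tendsto (fun n : ℕ => (∫ t in Ioo 0 T, max (v₀ + w t) 0) - T * (1 / ((n : ℝ) + 1)) -
      T * max v₀ 0)
      atTop (𝓝 ((∫ t in Ioo 0 T, max (v₀ + w t) 0) - T * max v₀ 0)) := by
    simpa using (hδ.const_mul T).const_sub _ |>.sub_const (T * max v₀ 0)
  have hR : Tendsto (fun n : ℕ => ∫ t in Ioo 0 T, (∫ s in (0 : ℝ)..(T - t), l s) *
      (posApprox (n + 1) (v₀ + w t) * g t)) atTop
      (𝓝 (∫ t in Ioo 0 T, (∫ s in (0 : ℝ)..(T - t), l s) * (heaviside (v₀ + w t) * g t))) := by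
    refine tendsto_integral_of_dominated_convergence (fun t => (∫ s in Ioo 0 T, |l s|) * |g t|)
      (fun n => hψm.mul (((continuous_posApprox _).comp_aestronglyMeasurable
        hvi.aestronglyMeasurable).mul hg.aestronglyMeasurable)) (hg.abs.const_mul _)
          (fun n => ?_) ?_
    · filter_upwards [ae_restrict_mem measurableSet_Ioo] with t ht
      rw [norm_mul, norm_mul]
      refine mul_le_mul (h.abs_weight_le ht) ?_
        (by positivity) (integral_nonneg fun _ => abs_nonneg _)
      exact mul_le_of_le_one_left (norm_nonneg _) (abs_posApprox_le_one _ _)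
    · refine Eventually.of_forall fun t => Tendsto.const_mul _ (Tendsto.mul_const _ ?_)
      exact (tendsto_posApprox _).comp (tendsto_add_atTop_nat 1)
  have := le_of_tendsto_of_tendsto' hL hR hle
  linarith

end

/-! ### The space `H^1_0(Ω)` -/

section

variable {d : ℕ} {Ω : Set (Sp d)} {w w' : Sp d → ℝ} {G G' : Sp d → Sp d}

theorem HasH10Grad.memLp (h : HasH10Grad Ω w G) : MemLp w 2 (volume.restrict Ω) := by
  obtain ⟨p, -, h1, -⟩ := h
  exact (Lp.memLp p.fst).ae_eq h1

theorem HasH10Grad.memLp_grad (h : HasH10Grad Ω w G) : MemLp G 2 (volume.restrict Ω) := by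
  obtain ⟨p, -, -, h2⟩ := h
  exact (Lp.memLp p.snd).ae_eq h2

theorem HasH10Grad.congr (h : HasH10Grad Ω w G) (hw : w =ᵐ[volume.restrict Ω] w')
    (hG : G =ᵐ[volume.restrict Ω] G') : HasH10Grad Ω w' G' := by
  obtain ⟨p, hp, h1, h2⟩ := h
  exact ⟨p, hp, h1.trans hw, h2.trans hG⟩

theorem hasH10Grad_zero (Ω : Set (Sp d)) : HasH10Grad Ω (fun _ => 0) (fun _ => 0) :=
  ⟨0, zero_mem _, Lp.coeFn_zero _ _ _, Lp.coeFn_zero _ _ _⟩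

theorem HasH10Grad.sub (h : HasH10Grad Ω w G) (h' : HasH10Grad Ω w' G') :
    HasH10Grad Ω (fun x => w x - w' x) (fun x => G x - G' x) := by
  obtain ⟨p, hp, h1, h2⟩ := h
  obtain ⟨p', hp', h1', h2'⟩ := h'
  refine ⟨p - p', sub_mem hp hp', ?_, ?_⟩
  · filter_upwards [Lp.coeFn_sub p.fst p'.fst, h1, h1'] with x e e1 e2
    rw [WithLp.sub_fst, e, Pi.sub_apply, e1, e2]
  · filter_upwards [Lp.coeFn_sub p.snd p'.snd, h2, h2'] with x e e1 e2
    rw [WithLp.sub_snd, e, Pi.sub_apply, e1, e2]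

theorem HasH10Grad.const_smul (h : HasH10Grad Ω w G) (c : ℝ) :
    HasH10Grad Ω (fun x => c * w x) (fun x => c • G x) := by
  obtain ⟨p, hp, h1, h2⟩ := h
  refine ⟨c • p, Submodule.smul_mem _ c hp, ?_, ?_⟩
  · filter_upwards [Lp.coeFn_smul c p.fst, h1] with x e e1
    rw [WithLp.smul_fst, e, Pi.smul_apply, e1, smul_eq_mul]
  · filter_upwards [Lp.coeFn_smul c p.snd, h2] with x e e1
    rw [WithLp.smul_snd, e, Pi.smul_apply, e1]

theorem inner_pairSpace (q p : PairSpace Ω) (h1 : (p.fst : Sp d → ℝ) =ᵐ[volume.restrict Ω] w)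
    (h2 : (p.snd : Sp d → Sp d) =ᵐ[volume.restrict Ω] G) :
    inner ℝ q p = (∫ x in Ω, inner ℝ (q.fst x) (w x)) + ∫ x in Ω, inner ℝ (q.snd x) (G x) := by
  rw [WithLp.prod_inner_apply, L2.inner_def, L2.inner_def]
  congr 1
  · refine integral_congr_ae ?_
    filter_upwards [h1] with x e
    rw [← e]; rfl
  · refine integral_congr_ae ?_
    filter_upwards [h2] with x e
    rw [← e]; rfl

theorem HasH10Grad.orthogonal (h : HasH10Grad Ω w G) {q : PairSpace Ω} (hq : q ∈ (H10 Ω)ᗮ) :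
    (∫ x in Ω, inner ℝ (q.fst x) (w x)) + ∫ x in Ω, inner ℝ (q.snd x) (G x) = 0 := by
  obtain ⟨p, hp, h1, h2⟩ := h
  rw [← inner_pairSpace q p h1 h2]
  exact (Submodule.mem_orthogonal' _ _).1 hq p hp

/-- As `H^1_0(Ω)` is a closed subspace of a Hilbert space, membership can be tested against its
orthogonal complement. -/
theorem hasH10Grad_of_orthogonal (hw : MemLp w 2 (volume.restrict Ω))
    (hG : MemLp G 2 (volume.restrict Ω))
    (h : ∀ q ∈ (H10 Ω)ᗮ,
      (∫ x in Ω, inner ℝ (q.fst x) (w x)) + ∫ x in Ω, inner ℝ (q.snd x) (G x) = 0) :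
    HasH10Grad Ω w G := by
  have hc : IsClosed (H10 Ω : Set (PairSpace Ω)) := Submodule.isClosed_topologicalClosure _
  have : CompleteSpace (H10 Ω) := hc.completeSpace_coe
  let P : PairSpace Ω := WithLp.toLp 2 (hw.toLp w, hG.toLp G)
  have h1 : (P.fst : Sp d → ℝ) =ᵐ[volume.restrict Ω] w := hw.coeFn_toLp
  have h2 : (P.snd : Sp d → Sp d) =ᵐ[volume.restrict Ω] G := hG.coeFn_toLp
  refine ⟨P, ?_, h1, h2⟩
  rw [← Submodule.orthogonal_orthogonal (H10 Ω), Submodule.mem_orthogonal]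
  intro q hq
  rw [inner_pairSpace q P h1 h2]
  exact h q hq

theorem IsTest.continuous_gradient {ψ : Sp d → ℝ} (h : IsTest Ω ψ) : Continuous (gradient ψ) :=
  (InnerProductSpace.toDual ℝ (Sp d)).symm.continuous.comp
    (h.smooth.continuous_fderiv (by simp))

theorem IsTest.hasCompactSupport_gradient {ψ : Sp d → ℝ} (h : IsTest Ω ψ) :
    HasCompactSupport (gradient ψ) :=
  (h.compact.fderiv (𝕜 := ℝ)).comp_left (g := (InnerProductSpace.toDual ℝ (Sp d)).symm) (map_zero _)

theorem IsTest.exists_isPairOf {ψ : Sp d → ℝ} (h : IsTest Ω ψ) :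
    ∃ p : PairSpace Ω, IsPairOf Ω p ψ := by
  have h1 : MemLp ψ 2 (volume.restrict Ω) :=
    (h.smooth.continuous.memLp_of_hasCompactSupport h.compact).restrict Ω
  have h2 : MemLp (gradient ψ) 2 (volume.restrict Ω) :=
    (h.continuous_gradient.memLp_of_hasCompactSupport h.hasCompactSupport_gradient).restrict Ω
  exact ⟨WithLp.toLp 2 (h1.toLp ψ, h2.toLp _), h1.coeFn_toLp, h2.coeFn_toLp⟩

theorem IsTest.hasH10Grad {ψ : Sp d → ℝ} (h : IsTest Ω ψ) : HasH10Grad Ω ψ (gradient ψ) := by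
  obtain ⟨p, hp⟩ := h.exists_isPairOf
  exact ⟨p, Submodule.le_topologicalClosure _ (Submodule.subset_span ⟨ψ, h, hp⟩), hp.1, hp.2⟩

theorem IsTest.hasGradientAt {ψ : Sp d → ℝ} (h : IsTest Ω ψ) (x : Sp d) :
    HasGradientAt ψ (gradient ψ x) x :=
  (h.smooth.differentiable (by simp) x).hasGradientAt

theorem IsTest.add {ψ χ : Sp d → ℝ} (h : IsTest Ω ψ) (h' : IsTest Ω χ) :
    IsTest Ω (fun x => ψ x + χ x) where
  smooth := h.smooth.add h'.smooth
  compact := h.compact.add h'.compact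
  supp := (tsupport_add ψ χ).trans (union_subset h.supp h'.supp)

theorem IsTest.const_mul {ψ : Sp d → ℝ} (h : IsTest Ω ψ) (c : ℝ) :
    IsTest Ω (fun x => c * ψ x) where
  smooth := contDiff_const.mul h.smooth
  compact := h.compact.mul_left
  supp := (tsupport_mul_subset_right (f := fun _ => c)).trans h.supp

theorem IsTest.comp {ψ : Sp d → ℝ} (h : IsTest Ω ψ) {H : ℝ → ℝ} (hH : ContDiff ℝ ∞ H)
    (h0 : H 0 = 0) : IsTest Ω (fun x => H (ψ x)) where
  smooth := hH.comp h.smooth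
  compact := h.compact.comp_left h0
  supp := (closure_mono (Function.support_comp_subset h0 ψ)).trans h.supp

theorem IsTest.gradient_comp {ψ : Sp d → ℝ} (h : IsTest Ω ψ) {H : ℝ → ℝ} (hH : ContDiff ℝ ∞ H)
    (x : Sp d) :
    gradient (fun x => H (ψ x)) x = deriv H (ψ x) • gradient ψ x := by
  refine HasGradientAt.gradient ?_
  rw [hasGradientAt_iff_hasFDerivAt, map_smul]
  exact ((hH.differentiable
    (by simp) (ψ x)).hasDerivAt).comp_hasFDerivAt x (h.hasGradientAt x).hasFDerivAt

/-- The pairs `(ψ, ∇ψ)` already form a subspace. -/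
theorem exists_isTest_of_mem_span {p : PairSpace Ω}
    (hp : p ∈ Submodule.span ℝ {p : PairSpace Ω | ∃ ψ, IsTest Ω ψ ∧ IsPairOf Ω p ψ}) :
    ∃ ψ, IsTest Ω ψ ∧ IsPairOf Ω p ψ := by
  induction hp using Submodule.span_induction with
  | mem p hp => exact hp
  | zero =>
    refine ⟨fun _ => 0, ⟨contDiff_const, HasCompactSupport.zero, by simp [tsupport]⟩, ?_, ?_⟩
    · exact Lp.coeFn_zero _ _ _
    · refine (Lp.coeFn_zero _ _ _).trans (Eventually.of_forall fun x => ?_)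
      exact (hasGradientAt_const x (0 : ℝ)).gradient.symm
  | add p p' _ _ h h' =>
    obtain ⟨ψ, h1, h2⟩ := h
    obtain ⟨χ, h1', h2'⟩ := h'
    refine ⟨fun x => ψ x + χ x, h1.add h1', ?_, ?_⟩
    · filter_upwards [Lp.coeFn_add p.fst p'.fst, h2.1, h2'.1] with x e e1 e2
      rw [WithLp.add_fst, e, Pi.add_apply, e1, e2]
    · filter_upwards [Lp.coeFn_add p.snd p'.snd, h2.2, h2'.2] with x e e1 e2
      rw [WithLp.add_snd, e, Pi.add_apply, e1, e2]
      symm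
      refine HasGradientAt.gradient ?_
      rw [hasGradientAt_iff_hasFDerivAt, map_add]
      exact (h1.hasGradientAt x).hasFDerivAt.add (h1'.hasGradientAt x).hasFDerivAt
  | smul c p _ h =>
    obtain ⟨ψ, h1, h2⟩ := h
    refine ⟨fun x => c * ψ x, h1.const_mul c, ?_, ?_⟩
    · filter_upwards [Lp.coeFn_smul c p.fst, h2.1] with x e e1
      rw [WithLp.smul_fst, e, Pi.smul_apply, e1, smul_eq_mul]
    · filter_upwards [Lp.coeFn_smul c p.snd, h2.2] with x e e1
      rw [WithLp.smul_snd, e, Pi.smul_apply, e1]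
      symm
      refine HasGradientAt.gradient ?_
      rw [hasGradientAt_iff_hasFDerivAt, map_smul]
      exact (h1.hasGradientAt x).hasFDerivAt.const_mul c

end

/-! ### The chain rule in `H^1_0(Ω)` -/

theorem abs_sub_le_of_abs_deriv_le {H : ℝ → ℝ} (hH : Differentiable ℝ H) {C : ℝ}
    (hC : ∀ y, |deriv H y| ≤ C) (a b : ℝ) : |H b - H a| ≤ C * |b - a| :=
  convex_univ.norm_image_sub_le_of_norm_deriv_le (𝕜 := ℝ) (fun x _ => hH x) (fun x _ => hC x)
    (mem_univ a) (mem_univ b)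

section

variable {d : ℕ} {Ω : Set (Sp d)} {w : Sp d → ℝ} {G : Sp d → Sp d}

theorem integrable_inner_Lp {α E : Type*} [MeasurableSpace α] {μ : Measure α}
    [NormedAddCommGroup E] [InnerProductSpace ℝ E] {f g : α → E} (hf : MemLp f 2 μ)
    (hg : MemLp g 2 μ) : Integrable (fun x => inner ℝ (f x) (g x)) μ := by
  refine (L2.integrable_inner (𝕜 := ℝ) (hf.toLp f) (hg.toLp g)).congr ?_
  filter_upwards [hf.coeFn_toLp, hg.coeFn_toLp] with x e1 e2
  rw [e1, e2]

theorem memLp_comp_lipschitz {α : Type*} [MeasurableSpace α] {μ : Measure α} {w : α → ℝ} {H : ℝ → ℝ}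
    (hH : ContDiff ℝ ∞ H)
    (h0 : H 0 = 0) {C : ℝ} (hC : ∀ y, |deriv H y| ≤ C) (hw : MemLp w 2 μ) :
    MemLp (fun x => H (w x)) 2 μ := by
  refine hw.of_le_mul (c := C) (hH.continuous.comp_aestronglyMeasurable hw.1)
    (Eventually.of_forall fun x => ?_)
  have := abs_sub_le_of_abs_deriv_le (hH.differentiable (by simp)) hC 0 (w x)
  simpa [h0] using this

theorem memLp_deriv_smul {α E : Type*} [MeasurableSpace α] {μ : Measure α} [NormedAddCommGroup E]
    [NormedSpace ℝ E] {w : α → ℝ} {G : α → E} {H : ℝ → ℝ} (hH : ContDiff ℝ ∞ H)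
    {C : ℝ} (hC : ∀ y, |deriv H y| ≤ C) (hw : AEStronglyMeasurable w μ) (hG : MemLp G 2 μ) :
    MemLp (fun x => deriv H (w x) • G x) 2 μ := by
  refine hG.of_le_mul (c := C)
    (((hH.continuous_deriv (by simp)).comp_aestronglyMeasurable hw).smul hG.1)
    (Eventually.of_forall fun x => ?_)
  rw [norm_smul]
  exact mul_le_mul_of_nonneg_right (hC _) (norm_nonneg _)

/-- The chain rule in `H^1_0(Ω)`. It is inherited from test functions `ψ n → w`. Weak convergence of
`∇(H ∘ ψ n)` suffices, since membership is tested against the orthogonal complement. -/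
theorem HasH10Grad.comp (h : HasH10Grad Ω w G) {H : ℝ → ℝ} (hH : ContDiff ℝ ∞ H) (h0 : H 0 = 0)
    {C : ℝ} (hC : ∀ y, |deriv H y| ≤ C) :
    HasH10Grad Ω (fun x => H (w x)) (fun x => deriv H (w x) • G x) := by
  have hw := h.memLp
  have hG := h.memLp_grad
  have hd : Continuous (deriv H) := hH.continuous_deriv (by simp)
  have hC0 : 0 ≤ C := (abs_nonneg _).trans (hC 0)
  have hX := memLp_comp_lipschitz hH h0 hC hw
  have hY := memLp_deriv_smul hH hC hw.1 hG
  refine hasH10Grad_of_orthogonal hX hY fun q hq => ?_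
  obtain ⟨p, hp, hp1, hp2⟩ := h
  obtain ⟨P, hPmem, hPlim⟩ := mem_closure_iff_seq_limit.1 hp
  choose ψ hψt hψp using fun n => exists_isTest_of_mem_span (hPmem n)
  have hlim1 : Tendsto (fun n => (P n).fst) atTop (𝓝 p.fst) :=
    ((WithLp.prod_continuous_ofLp 2 _ _).fst.tendsto p).comp hPlim
  have hlim2 : Tendsto (fun n => (P n).snd) atTop (𝓝 p.snd) :=
    ((WithLp.prod_continuous_ofLp 2 _ _).snd.tendsto p).comp hPlim
  obtain ⟨ns, hns, hae⟩ := (tendstoInMeasure_of_tendsto_Lp hlim1).exists_seq_tendsto_ae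
  have hψw : ∀ᵐ x ∂(volume.restrict Ω), Tendsto (fun i => ψ (ns i) x) atTop (𝓝 (w x)) := by
    filter_upwards [hae, hp1, ae_all_iff.2 fun n => (hψp n).1] with x h1 h2 h3
    rw [h2] at h1
    simpa only [h3] using h1
  have hψ2 : ∀ n, MemLp (ψ n) 2 (volume.restrict Ω) := fun n => (hψt n).hasH10Grad.memLp
  have hψg : ∀ n, MemLp (gradient (ψ n)) 2 (volume.restrict Ω) := fun n =>
    (hψt n).hasH10Grad.memLp_grad
  have hq1 := Lp.memLp q.fst
  have hq2 := Lp.memLp q.snd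
  have hXn : ∀ n, MemLp (fun x => H (ψ n x)) 2 (volume.restrict Ω) := fun n =>
    memLp_comp_lipschitz hH h0 hC (hψ2 n)
  have hYn : ∀ n, MemLp (fun x => deriv H (ψ n x) • gradient (ψ n) x) 2 (volume.restrict Ω) :=
    fun n => memLp_deriv_smul hH hC (hψ2 n).1 (hψg n)
  have hZn : ∀ n, MemLp (fun x => deriv H (ψ n x) • G x) 2 (volume.restrict Ω) :=
    fun n => memLp_deriv_smul hH hC (hψ2 n).1 hG
  have horth : ∀ n, (∫ x in Ω, inner ℝ (q.fst x) (H (ψ n x))) +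
      ∫ x in Ω, inner ℝ (q.snd x) (deriv H (ψ n x) • gradient (ψ n) x) = 0 := by
    intro n
    have := ((hψt n).comp hH h0).hasH10Grad.orthogonal hq
    simpa only [(hψt n).gradient_comp hH] using this
  have T1 : Tendsto (fun n => ∫ x in Ω, inner ℝ (q.fst x) (H (ψ n x))) atTop
      (𝓝 (∫ x in Ω, inner ℝ (q.fst x) (H (w x)))) := by
    have hl : Tendsto (fun n => (hXn n).toLp _) atTop (𝓝 (hX.toLp _)) := by
      rw [tendsto_iff_norm_sub_tendsto_zero]
      refine squeeze_zero (fun n => norm_nonneg _) (fun n => ?_)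
        (by simpa using (tendsto_iff_norm_sub_tendsto_zero.1 hlim1).const_mul C)
      refine Lp.norm_le_mul_norm_of_ae_le_mul ?_
      filter_upwards [Lp.coeFn_sub ((hXn n).toLp _) (hX.toLp _), (hXn n).coeFn_toLp, hX.coeFn_toLp,
        Lp.coeFn_sub (P n).fst p.fst, (hψp n).1, hp1] with x e1 e2 e3 e4 e5 e6
      rw [e1, e4, Pi.sub_apply, Pi.sub_apply, e2, e3, e5, e6]
      exact abs_sub_le_of_abs_deriv_le (hH.differentiable (by simp)) hC _ _
    have h2 := (tendsto_const_nhds (x := q.fst)).inner (𝕜 := ℝ) hl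
    simp only [L2.inner_def] at h2
    convert h2 using 1
    · ext n
      refine integral_congr_ae ?_
      filter_upwards [(hXn n).coeFn_toLp] with x e
      rw [e]
    · congr 1
      refine integral_congr_ae ?_
      filter_upwards [hX.coeFn_toLp] with x e
      rw [e]
  -- `H'(ψ) ∇ψ - H'(w) ∇w` is split into `H'(ψ) (∇ψ - ∇w)`, which is small in `L²`, and
  -- `(H'(ψ) - H'(w)) ∇w`, to which dominated convergence applies
  have T2 : Tendsto (fun n => ∫ x in Ω, inner ℝ (q.snd x) (deriv H (ψ n x) • gradient (ψ n) x -
      deriv H (ψ n x) • G x)) atTop (𝓝 0) := by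
    have hl : Tendsto (fun n => ((hYn n).sub (hZn n)).toLp _) atTop (𝓝 0) := by
      rw [tendsto_zero_iff_norm_tendsto_zero]
      refine squeeze_zero (fun n => norm_nonneg _) (fun n => ?_)
        (by simpa using (tendsto_iff_norm_sub_tendsto_zero.1 hlim2).const_mul C)
      refine Lp.norm_le_mul_norm_of_ae_le_mul ?_
      filter_upwards [((hYn n).sub (hZn n)).coeFn_toLp,
        Lp.coeFn_sub (P n).snd p.snd, (hψp n).2, hp2] with x e1 e4 e5 e6
      rw [e1, e4, Pi.sub_apply, Pi.sub_apply, e5, e6, ← smul_sub, norm_smul]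
      exact mul_le_mul_of_nonneg_right (hC _) (norm_nonneg _)
    have h2 := (tendsto_const_nhds (x := q.snd)).inner (𝕜 := ℝ) hl
    simp only [L2.inner_def, inner_zero_right] at h2
    refine h2.congr fun n => integral_congr_ae ?_
    filter_upwards [((hYn n).sub (hZn n)).coeFn_toLp] with x e
    rw [e]; rfl
  have T3 : Tendsto (fun i => ∫ x in Ω, inner ℝ (q.snd x) (deriv H (ψ (ns i) x) • G x)) atTop
      (𝓝 (∫ x in Ω, inner ℝ (q.snd x) (deriv H (w x) • G x))) := by
    refine tendsto_integral_of_dominated_convergence (fun x => C * (‖q.snd x‖ * ‖G x‖))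
      (fun i => (integrable_inner_Lp hq2 (hZn _)).1) ?_ (fun i => ?_) ?_
    · exact (hq2.norm.integrable_mul hG.norm).const_mul C
    · refine Eventually.of_forall fun x => ?_
      refine (norm_inner_le_norm _ _).trans ?_
      rw [norm_smul]
      have := mul_le_mul_of_nonneg_right (hC (ψ (ns i) x))
          (mul_nonneg (norm_nonneg (q.snd x)) (norm_nonneg (G x)))
      rw [Real.norm_eq_abs]
      linarith
    · filter_upwards [hψw] with x hx
      exact tendsto_const_nhds.inner (((hd.tendsto _).comp hx).smul_const _)
  have T4 := ((T1.comp hns.tendsto_atTop).add ((T2.comp hns.tendsto_atTop).add T3))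
  rw [zero_add] at T4
  refine tendsto_nhds_unique T4 (tendsto_const_nhds.congr fun i => ?_)
  simp only [Function.comp_apply]
  have hYZ : Integrable (fun x => inner ℝ (q.snd x) (deriv H (ψ (ns i) x) • gradient (ψ (ns i)) x -
      deriv H (ψ (ns i) x) • G x)) (volume.restrict Ω) :=
    integrable_inner_Lp hq2 ((hYn _).sub (hZn _))
  rw [← horth (ns i), ← integral_add hYZ (integrable_inner_Lp hq2 (hZn _))]
  congr 2
  ext x
  rw [← inner_add_right, sub_add_cancel]

end

/-! ### Steklov averages in time -/

section

variable {α β F : Type*} [MeasurableSpace α] [MeasurableSpace β]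
  [NormedAddCommGroup F] {μ : Measure α} {ν : Measure β}

theorem memLp_two_iff_lintegral {f : α → F} :
    MemLp f 2 μ ↔ AEStronglyMeasurable f μ ∧ ∫⁻ x, ‖f x‖ₑ ^ 2 ∂μ < ⊤ := by
  refine and_congr_right fun _ => ?_
  rw [eLpNorm_lt_top_iff_lintegral_rpow_enorm_lt_top two_ne_zero ENNReal.ofNat_ne_top]
  simp

theorem eLpNorm_two_sq (f : α → F) : eLpNorm f 2 μ ^ 2 = ∫⁻ x, ‖f x‖ₑ ^ 2 ∂μ := by
  have := eLpNorm_nnreal_pow_eq_lintegral (f := f) (μ := μ) (p := 2) two_ne_zero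
  simpa using this

variable [NormedSpace ℝ F]

/-- Jensen's inequality for the square of the norm. -/
theorem enorm_integral_sq_le {f : β → F} (hf : AEStronglyMeasurable f ν) :
    ‖∫ s, f s ∂ν‖ₑ ^ 2 ≤ ν univ * ∫⁻ s, ‖f s‖ₑ ^ 2 ∂ν := by
  have h1 : ‖∫ s, f s ∂ν‖ₑ ≤ eLpNorm f 2 ν * ν univ ^ (1 / 2 : ℝ) := by
    refine (enorm_integral_le_lintegral_enorm f).trans ?_
    rw [← eLpNorm_one_eq_lintegral_enorm]
    refine (eLpNorm_le_eLpNorm_mul_rpow_measure_univ (p := 1) (q := 2) (by norm_num) hf).trans_eq ?_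
    norm_num
  calc ‖∫ s, f s ∂ν‖ₑ ^ 2 ≤ (eLpNorm f 2 ν * ν univ ^ (1 / 2 : ℝ)) ^ 2 := by gcongr
    _ = ν univ * ∫⁻ s, ‖f s‖ₑ ^ 2 ∂ν := by
      rw [mul_pow, eLpNorm_two_sq, mul_comm]
      congr 1
      rw [← ENNReal.rpow_natCast, ← ENNReal.rpow_mul]
      norm_num

/-- Jensen's inequality `enorm_integral_sq_le`, integrated over a parameter. -/
theorem lintegral_enorm_integral_sq_le [SFinite μ] [SFinite ν] {f : α × β → F}
    (hf : StronglyMeasurable f) :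
    ∫⁻ x, ‖∫ s, f (x, s) ∂ν‖ₑ ^ 2 ∂μ ≤ ν univ * ∫⁻ s, ∫⁻ x, ‖f (x, s)‖ₑ ^ 2 ∂μ ∂ν := by
  have hm : Measurable fun p : α × β => ‖f p‖ₑ ^ 2 := hf.enorm.pow_const 2
  calc ∫⁻ x, ‖∫ s, f (x, s) ∂ν‖ₑ ^ 2 ∂μ
      ≤ ∫⁻ x, ν univ * ∫⁻ s, ‖f (x, s)‖ₑ ^ 2 ∂ν ∂μ :=
        lintegral_mono fun x => enorm_integral_sq_le
          (hf.comp_measurable measurable_prodMk_left).aestronglyMeasurable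
    _ = ν univ * ∫⁻ x, ∫⁻ s, ‖f (x, s)‖ₑ ^ 2 ∂ν ∂μ := by
        rw [lintegral_const_mul _ hm.lintegral_prod_right']
    _ = _ := by rw [lintegral_lintegral_swap hm.aemeasurable]

end

section

variable {d : ℕ} {F : Type*} [NormedAddCommGroup F] {δ M : ℝ} {Ψ : ℝ × Sp d → F}

theorem measurePreserving_timeShift (s : ℝ) :
    MeasurePreserving (fun z : ℝ × Sp d => (z.1 + s, z.2)) volume volume :=
  (measurePreserving_add_right volume s).prod (MeasurePreserving.id volume)

theorem stronglyMeasurable_shift (hΨ : StronglyMeasurable Ψ) :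
    StronglyMeasurable fun p : (ℝ × Sp d) × ℝ => Ψ (p.1.1 + p.2, p.1.2) :=
  hΨ.comp_measurable (by fun_prop)

theorem lintegral_timeShift (hΨ : StronglyMeasurable Ψ) (s : ℝ) :
    ∫⁻ z : ℝ × Sp d, ‖Ψ (z.1 + s, z.2)‖ₑ ^ 2 = ∫⁻ z, ‖Ψ z‖ₑ ^ 2 :=
  (measurePreserving_timeShift s).lintegral_comp (f := fun z => ‖Ψ z‖ₑ ^ 2) (hΨ.enorm.pow_const 2)

/-- As `(x, s) ↦ (t + s, x)` preserves the measure, every time slice of a Steklov average can be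
controlled, not only almost every one. -/
theorem memLp_slice_shift (h2 : MemLp Ψ 2 volume) (t : ℝ) :
    MemLp (fun p : Sp d × ℝ => Ψ (t + p.2, p.1)) 2 (volume.prod volume) := by
  have h1 : MeasurePreserving (fun p : Sp d × ℝ => ((t + p.2, p.1) : ℝ × Sp d))
      (volume.prod volume) (volume.prod volume) :=
    ((measurePreserving_add_left volume t).prod (MeasurePreserving.id volume)).comp
      Measure.measurePreserving_swap
  exact h2.comp_measurePreserving h1

/-- Continuity of time translations in `L²`. -/
theorem tendsto_lintegral_timeShift_sub (h2 : MemLp Ψ 2 volume) :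
    Tendsto (fun s : ℝ => ∫⁻ z : ℝ × Sp d, ‖Ψ (z.1 + s, z.2) - Ψ z‖ₑ ^ 2) (𝓝 0) (𝓝 0) := by
  have hcont : Continuous fun s : ℝ => (⟨fun z : ℝ × Sp d => (z.1 + s, z.2), by fun_prop⟩ :
      C(ℝ × Sp d, ℝ × Sp d)) :=
    ContinuousMap.continuous_of_continuous_uncurry _
      (by simp only [Function.uncurry_def, ContinuousMap.coe_mk]; fun_prop)
  have h := (continuous_const (y := h2.toLp Ψ)).compMeasurePreservingLp hcont
    (fun s => measurePreserving_timeShift s) ENNReal.ofNat_ne_top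
  have h0 := h.tendsto 0
  rw [tendsto_iff_edist_tendsto_0] at h0
  have h1 := ((ENNReal.continuous_pow 2).tendsto 0).comp h0
  rw [zero_pow two_ne_zero] at h1
  refine h1.congr fun s => ?_
  rw [Function.comp_apply, Lp.edist_def, eLpNorm_two_sq]
  refine lintegral_congr_ae ?_
  filter_upwards [Lp.coeFn_compMeasurePreserving (h2.toLp Ψ) (measurePreserving_timeShift s),
    Lp.coeFn_compMeasurePreserving (h2.toLp Ψ) (measurePreserving_timeShift (d := d) 0),
    h2.coeFn_toLp, (measurePreserving_timeShift s).quasiMeasurePreserving.ae h2.coeFn_toLp]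
    with z e1 e2 e3 e4
  simp only [ContinuousMap.coe_mk, Pi.sub_apply]
  rw [e1, e2]
  simp only [Function.comp_apply, add_zero]
  rw [e3, e4]

variable [InnerProductSpace ℝ F]

/-- The Steklov average in time over `(t, t + δ]`. -/
def steklov (δ : ℝ) (Ψ : ℝ × Sp d → F) (z : ℝ × Sp d) : F :=
  δ⁻¹ • ∫ s in Ioc 0 δ, Ψ (z.1 + s, z.2)

theorem stronglyMeasurable_steklov (hΨ : StronglyMeasurable Ψ) :
    StronglyMeasurable (steklov δ Ψ) :=
  ((stronglyMeasurable_shift hΨ).integral_prod_right).const_smul _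

theorem norm_steklov_le (hδ : 0 < δ) (hM : ∀ z, ‖Ψ z‖ ≤ M) (z : ℝ × Sp d) :
    ‖steklov δ Ψ z‖ ≤ M := by
  have h := norm_setIntegral_le_of_norm_le_const (μ := volume) (s := Ioc 0 δ) (C := M)
    (f := fun s => Ψ (z.1 + s, z.2)) (by simp) (fun s _ => hM _)
  rw [Real.volume_real_Ioc_of_le hδ.le, sub_zero] at h
  rw [steklov, norm_smul, norm_inv, Real.norm_eq_abs, abs_of_pos hδ, inv_mul_le_iff₀ hδ]
  linarith

theorem memLp_steklov (hΨ : StronglyMeasurable Ψ) (h2 : MemLp Ψ 2 volume) :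
    MemLp (steklov δ Ψ) 2 volume := by
  refine MemLp.const_smul (memLp_two_iff_lintegral.2
    ⟨((stronglyMeasurable_shift hΨ).integral_prod_right).aestronglyMeasurable, ?_⟩) _
  refine (lintegral_enorm_integral_sq_le (stronglyMeasurable_shift hΨ)).trans_lt ?_
  simp only [lintegral_timeShift hΨ, lintegral_const]
  exact ENNReal.mul_lt_top (by simp) (ENNReal.mul_lt_top (memLp_two_iff_lintegral.1 h2).2 (by simp))

theorem memLp_steklov_slice (hΨ : StronglyMeasurable Ψ) (h2 : MemLp Ψ 2 volume) (t : ℝ) :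
    MemLp (fun x => steklov δ Ψ (t, x)) 2 volume := by
  have hm : StronglyMeasurable fun p : Sp d × ℝ => Ψ (t + p.2, p.1) :=
    hΨ.comp_measurable (by fun_prop)
  refine MemLp.const_smul (memLp_two_iff_lintegral.2
    ⟨hm.integral_prod_right.aestronglyMeasurable, ?_⟩) _
  refine (lintegral_enorm_integral_sq_le hm).trans_lt ?_
  refine ENNReal.mul_lt_top (by simp) ?_
  refine (setLIntegral_le_lintegral _ _).trans_lt ?_
  rw [← lintegral_prod_symm _ (hm.enorm.pow_const 2).aemeasurable]
  exact (memLp_two_iff_lintegral.1 (memLp_slice_shift h2 t)).2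

/-- The spatial inner product of a function with a time slice of a Steklov average is the average of
the inner products with the time slices. -/
theorem integral_inner_steklov [CompleteSpace F] {Ω : Set (Sp d)} (hΨ : StronglyMeasurable Ψ)
    (h2 : MemLp Ψ 2 volume)
    {q : Sp d → F} (hq : MemLp q 2 (volume.restrict Ω)) (t : ℝ) :
    ∫ x in Ω, inner ℝ (q x) (steklov δ Ψ (t, x)) =
        δ⁻¹ * ∫ s in Ioc 0 δ, ∫ x in Ω, inner ℝ (q x) (Ψ (t + s, x)) ∧
      Integrable (fun s => ∫ x in Ω, inner ℝ (q x) (Ψ (t + s, x))) (volume.restrict (Ioc 0 δ)) := by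
  have h3 : MemLp (fun p : Sp d × ℝ => Ψ (t + p.2, p.1)) 2
      ((volume.restrict Ω).prod (volume.restrict (Ioc 0 δ))) := by
    rw [Measure.prod_restrict]
    exact (memLp_slice_shift h2 t).restrict _
  have hq' : MemLp (fun p : Sp d × ℝ => q p.1) 2
      ((volume.restrict Ω).prod (volume.restrict (Ioc 0 δ))) := hq.comp_fst _
  have hi := integrable_inner_Lp hq' h3
  have h4 : ∀ᵐ x ∂(volume.restrict Ω),
      Integrable (fun s => Ψ (t + s, x)) (volume.restrict (Ioc 0 δ)) := by
    have hm : Measurable fun p : Sp d × ℝ => ‖Ψ (t + p.2, p.1)‖ₑ ^ 2 :=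
      (hΨ.comp_measurable (by fun_prop)).enorm.pow_const 2
    have h5 := (memLp_two_iff_lintegral.1 h3).2
    rw [lintegral_prod _ hm.aemeasurable] at h5
    filter_upwards [ae_lt_top hm.lintegral_prod_right' h5.ne] with x hx
    exact MemLp.integrable one_le_two (memLp_two_iff_lintegral.2
      ⟨(hΨ.comp_measurable (by fun_prop)).aestronglyMeasurable, hx⟩)
  refine ⟨?_, hi.integral_prod_right⟩
  rw [← integral_integral_swap hi, ← integral_const_mul]
  refine integral_congr_ae ?_
  filter_upwards [h4] with x hx
  rw [steklov, inner_smul_right, integral_inner hx]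

/-- Steklov averages converge in `L²`. -/
theorem tendsto_steklov [CompleteSpace F] (hΨ : StronglyMeasurable Ψ) (h2 : MemLp Ψ 2 volume) :
    Tendsto (fun δ => ∫⁻ z, ‖steklov δ Ψ z - Ψ z‖ₑ ^ 2) (𝓝[>] 0) (𝓝 0) := by
  have ht := tendsto_lintegral_timeShift_sub h2
  rw [ENNReal.tendsto_nhds_zero] at ht ⊢
  intro ε hε
  obtain ⟨r, hr, hball⟩ := Metric.eventually_nhds_iff.1 (ht ε hε)
  filter_upwards [Ioo_mem_nhdsGT hr] with δ hδ
  have hm : StronglyMeasurable fun p : (ℝ × Sp d) × ℝ => Ψ (p.1.1 + p.2, p.1.2) - Ψ p.1 :=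
    (stronglyMeasurable_shift hΨ).sub (hΨ.comp_measurable measurable_fst)
  have hi : ∀ᵐ z : ℝ × Sp d, Integrable (fun s => Ψ (z.1 + s, z.2))
      (volume.restrict (Ioc 0 δ)) := by
    have hm' : Measurable fun p : (ℝ × Sp d) × ℝ => ‖Ψ (p.1.1 + p.2, p.1.2)‖ₑ ^ 2 :=
      (stronglyMeasurable_shift hΨ).enorm.pow_const 2
    have h5 : ∫⁻ z : ℝ × Sp d, ∫⁻ s in Ioc 0 δ, ‖Ψ (z.1 + s, z.2)‖ₑ ^ 2 < ⊤ := by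
      rw [lintegral_lintegral_swap hm'.aemeasurable]
      simp only [lintegral_timeShift hΨ, lintegral_const]
      exact ENNReal.mul_lt_top (memLp_two_iff_lintegral.1 h2).2 (by simp)
    filter_upwards [ae_lt_top hm'.lintegral_prod_right' h5.ne] with z hz
    exact MemLp.integrable one_le_two (memLp_two_iff_lintegral.2
      ⟨(hΨ.comp_measurable (by fun_prop)).aestronglyMeasurable, hz⟩)
  have e1 : ∫⁻ z, ‖steklov δ Ψ z - Ψ z‖ₑ ^ 2 =
      ∫⁻ z : ℝ × Sp d, ENNReal.ofReal δ⁻¹ ^ 2 * ‖∫ s in Ioc 0 δ, (Ψ (z.1 + s, z.2) - Ψ z)‖ₑ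
          ^ 2 := by
    refine lintegral_congr_ae ?_
    filter_upwards [hi] with z hz
    have e : steklov δ Ψ z - Ψ z = δ⁻¹ • ∫ s in Ioc 0 δ, (Ψ (z.1 + s, z.2) - Ψ z) := by
      rw [integral_sub hz (by simp), integral_const,
        smul_sub, steklov, measureReal_restrict_apply_univ,
        Real.volume_real_Ioc_of_le hδ.1.le, sub_zero, smul_smul, inv_mul_cancel₀ hδ.1.ne', one_smul]
    rw [e, enorm_smul, mul_pow, Real.enorm_of_nonneg (inv_nonneg.2 hδ.1.le)]
  have hJ := lintegral_enorm_integral_sq_le (μ := volume) (ν := volume.restrict (Ioc 0 δ)) hm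
  rw [e1, lintegral_const_mul _ ((hm.integral_prod_right).enorm.pow_const 2)]
  calc _ ≤ ENNReal.ofReal δ⁻¹ ^ 2 * ((volume.restrict (Ioc 0 δ)) univ *
        ∫⁻ s in Ioc 0 δ, ∫⁻ z : ℝ × Sp d, ‖Ψ (z.1 + s, z.2) - Ψ z‖ₑ ^ 2) := by gcongr
    _ ≤ ENNReal.ofReal δ⁻¹ ^ 2 * ((volume.restrict (Ioc 0 δ)) univ * ∫⁻ s in Ioc 0 δ, ε) := by
        gcongr _ * (_ * ?_)
        refine setLIntegral_mono measurable_const fun s hs => hball ?_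
        rw [Real.dist_eq, sub_zero, abs_of_pos hs.1]
        exact hs.2.trans_lt hδ.2
    _ = ε := by
        simp only [lintegral_const, Measure.restrict_apply_univ, Real.volume_Ioc, sub_zero]
        have : ENNReal.ofReal δ⁻¹ * ENNReal.ofReal δ = 1 := by
          rw [← ENNReal.ofReal_mul (inv_nonneg.2 hδ.1.le), inv_mul_cancel₀ hδ.1.ne',
            ENNReal.ofReal_one]
        calc _ = ε * (ENNReal.ofReal δ⁻¹ * ENNReal.ofReal δ) ^ 2 := by ring
          _ = ε := by rw [this]; simp

end

/-! ### Test functions without regularity in time -/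

theorem tendsto_eLpNorm_steklov {d : ℕ} {F : Type*} [NormedAddCommGroup F] [InnerProductSpace ℝ F]
    [CompleteSpace F] {Ψ : ℝ × Sp d → F} (hΨ : StronglyMeasurable Ψ) (h2 : MemLp Ψ 2 volume) :
    Tendsto (fun n : ℕ => eLpNorm (steklov (1 / ((n : ℝ) + 1)) Ψ - Ψ) 2 volume) atTop (𝓝 0) := by
  have hδ : Tendsto (fun n : ℕ => 1 / ((n : ℝ) + 1)) atTop (𝓝[>] 0) :=
    tendsto_nhdsWithin_iff.2 ⟨tendsto_one_div_add_atTop_nhds_zero_nat,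
      Eventually.of_forall fun n => by simp only [mem_Ioi]; positivity⟩
  have h1 := ((ENNReal.continuous_rpow_const (y := 1 / 2)).tendsto 0).comp
    ((tendsto_steklov hΨ h2).comp hδ)
  rw [ENNReal.zero_rpow_of_pos (by norm_num)] at h1
  refine h1.congr fun n => ?_
  simp only [Function.comp_apply]
  have e := eLpNorm_two_sq (μ := volume) (steklov (1 / ((n : ℝ) + 1)) Ψ - Ψ)
  simp only [Pi.sub_apply] at e
  rw [← e, ← ENNReal.rpow_natCast, ← ENNReal.rpow_mul]
  norm_num

theorem abs_integral_inner_le {α E : Type*} [MeasurableSpace α] {μ : Measure α}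
    [NormedAddCommGroup E] [InnerProductSpace ℝ E] {f g : α → E} (hf : MemLp f 2 μ)
    (hg : MemLp g 2 μ) :
    |∫ x, inner ℝ (f x) (g x) ∂μ| ≤ (eLpNorm f 2 μ).toReal * (eLpNorm g 2 μ).toReal := by
  have h := abs_real_inner_le_norm (hf.toLp f) (hg.toLp g)
  rw [Lp.norm_toLp, Lp.norm_toLp, L2.inner_def] at h
  refine le_of_eq_of_le ?_ h
  congr 1
  refine integral_congr_ae ?_
  filter_upwards [hf.coeFn_toLp, hg.coeFn_toLp] with x e1 e2
  rw [e1, e2]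

theorem tendsto_integral_inner {α E : Type*} [MeasurableSpace α] {μ : Measure α}
    [NormedAddCommGroup E] [InnerProductSpace ℝ E] {Φ f₀ : α → E} {f : ℕ → α → E}
    (hΦ : MemLp Φ 2 μ) (hf : ∀ n, MemLp (f n) 2 μ) (hf₀ : MemLp f₀ 2 μ)
    (hl : Tendsto (fun n => eLpNorm (f n - f₀) 2 μ) atTop (𝓝 0)) :
    Tendsto (fun n => ∫ x, inner ℝ (Φ x) (f n x) ∂μ) atTop (𝓝 (∫ x, inner ℝ (Φ x) (f₀ x) ∂μ)) := by
  rw [tendsto_iff_norm_sub_tendsto_zero]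
  have h3 := (ENNReal.tendsto_toReal ENNReal.zero_ne_top).comp hl
  refine squeeze_zero (fun n => norm_nonneg _) (fun n => ?_)
    (by simpa using h3.const_mul (eLpNorm Φ 2 μ).toReal)
  rw [← integral_sub (integrable_inner_Lp hΦ (hf n)) (integrable_inner_Lp hΦ hf₀)]
  simp only [← inner_sub_right]
  exact abs_integral_inner_le hΦ ((hf n).sub hf₀)

section

variable {d : ℕ} {T : ℝ} {Ω : Set (Sp d)}

theorem restrict_cyl (T : ℝ) (Ω : Set (Sp d)) :
    (volume : Measure (ℝ × Sp d)).restrict (cyl T Ω) =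
      (volume.restrict (Ioo 0 T)).prod (volume.restrict Ω) := by
  rw [Measure.prod_restrict]; rfl

theorem measurableSet_cyl (hΩ : MeasurableSet Ω) : MeasurableSet (cyl T Ω) :=
  measurableSet_Ioo.prod hΩ

theorem volume_cyl_lt_top (hΩ : volume Ω < ⊤) : volume (cyl T Ω) < ⊤ := by
  rw [cyl, Measure.volume_eq_prod, Measure.prod_prod]
  exact ENNReal.mul_lt_top (by simp) hΩ

theorem ae_slice_time {P : ℝ × Sp d → Prop} (h : ∀ᵐ z ∂(volume.restrict (cyl T Ω)), P z) :
    ∀ᵐ t ∂(volume.restrict (Ioo 0 T)), ∀ᵐ x ∂(volume.restrict Ω), P (t, x) := by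
  rw [restrict_cyl] at h
  exact Measure.ae_ae_of_ae_prod h

theorem ae_slice_space {P : ℝ × Sp d → Prop} (h : ∀ᵐ z ∂(volume.restrict (cyl T Ω)), P z) :
    ∀ᵐ x ∂(volume.restrict Ω), ∀ᵐ t ∂(volume.restrict (Ioo 0 T)), P (t, x) := by
  rw [restrict_cyl] at h
  exact Measure.ae_ae_of_ae_prod (Measure.measurePreserving_swap.quasiMeasurePreserving.ae h)

theorem memL1Lp_of_bdd {M : ℝ} {w : ℝ × Sp d → ℝ} (hΩ : volume Ω < ⊤) (hw : StronglyMeasurable w)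
    (hM : ∀ z, ‖w z‖ ≤ M) : MemL1Lp T Ω 2 w := by
  refine ⟨hw.aestronglyMeasurable, ?_⟩
  have h1 : ∀ t, eLpNorm (fun x => w (t, x)) 2 (volume.restrict Ω) ≤
      (volume.restrict Ω) univ ^ ((2 : ℝ≥0∞).toReal)⁻¹ * ENNReal.ofReal M := fun t =>
    eLpNorm_le_of_ae_bound (Eventually.of_forall fun x => hM _)
  refine (lintegral_mono h1).trans_lt ?_
  rw [lintegral_const]
  refine ENNReal.mul_lt_top
    (ENNReal.mul_lt_top (ENNReal.rpow_lt_top_of_nonneg (by simp) ?_) (by simp)) (by simp)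
  simpa using hΩ.ne

variable {M δ : ℝ} {η : ℝ × Sp d → ℝ} {E : ℝ × Sp d → Sp d}

theorem memLp_of_bdd_support (hΩm : MeasurableSet Ω) (hΩ : volume Ω < ⊤) (hη : StronglyMeasurable η)
    (hM : ∀ z, ‖η z‖ ≤ M) (h0 : ∀ z, z ∉ cyl T Ω → η z = 0) : MemLp η 2 volume := by
  have h1 : MemLp η 2 (volume.restrict (cyl T Ω)) := by
    have : IsFiniteMeasure ((volume : Measure (ℝ × Sp d)).restrict (cyl T Ω)) :=
      ⟨by simpa using volume_cyl_lt_top hΩ⟩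
    exact MemLp.of_bound hη.aestronglyMeasurable M (Eventually.of_forall hM)
  rw [← memLp_indicator_iff_restrict (measurableSet_cyl hΩm)] at h1
  rwa [indicator_eq_self.2 fun z hz => by_contra fun h => hz (h0 z h)] at h1

/-- The Steklov averages of a bounded function in `L²(0,T; H^1_0(Ω))`, extended by zero to all
times, are admissible test functions. -/
theorem isTestFunction_steklov (hΩm : MeasurableSet Ω) (hΩ : volume Ω < ⊤) (hδ : 0 < δ)
    (hη : StronglyMeasurable η) (hE : StronglyMeasurable E) (hM : ∀ z, ‖η z‖ ≤ M)
    (h0 : ∀ z, z ∉ cyl T Ω → η z = 0) (hE2 : MemLp E 2 volume)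
    (hs : ∀ᵐ t : ℝ, HasH10Grad Ω (fun x => η (t, x)) (fun x => E (t, x))) :
    IsTestFunction T Ω (steklov δ η) (fun z => δ⁻¹ * (η (z.1 + δ, z.2) - η z)) (steklov δ E) := by
  have hη2 := memLp_of_bdd_support hΩm hΩ hη hM h0
  have hfin : IsFiniteMeasure ((volume : Measure (ℝ × Sp d)).restrict (cyl T Ω)) :=
    ⟨by simpa using volume_cyl_lt_top hΩ⟩
  have hηδ : StronglyMeasurable (steklov δ η) := stronglyMeasurable_steklov hη
  have hηt : StronglyMeasurable fun z : ℝ × Sp d => δ⁻¹ * (η (z.1 + δ, z.2) - η z) :=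
    ((hη.comp_measurable (by fun_prop)).sub hη).const_mul _
  have hηtM : ∀ z : ℝ × Sp d, ‖δ⁻¹ * (η (z.1 + δ, z.2) - η z)‖ ≤ δ⁻¹ * (M + M) := by
    intro z
    rw [norm_mul, norm_inv, Real.norm_eq_abs, abs_of_pos hδ]
    exact mul_le_mul_of_nonneg_left ((norm_sub_le _ _).trans (add_le_add (hM _) (hM _)))
      (inv_nonneg.2 hδ.le)
  have hint : ∀ x a b, IntervalIntegrable (fun s => η (s, x)) volume a b := by
    intro x a b
    have : IsFiniteMeasure (volume.restrict (uIoc a b)) := ⟨by simp [uIoc]⟩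
    rw [intervalIntegrable_iff]
    exact Integrable.of_bound (hη.comp_measurable (by fun_prop)).aestronglyMeasurable M
      (Eventually.of_forall fun s => hM _)
  have hst : ∀ t x, steklov δ η (t, x) = δ⁻¹ * ∫ s in t..(t + δ), η (s, x) := by
    intro t x
    rw [steklov, ← intervalIntegral.integral_of_le hδ.le, smul_eq_mul]
    simp only
    rw [intervalIntegral.integral_comp_add_left (fun s => η (s, x)) t, add_zero]
  have hprim : ∀ t x, steklov δ η (0, x) + ∫ s in (0 : ℝ)..t, δ⁻¹ * (η (s + δ, x) - η (s, x)) =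
      steklov δ η (t, x) := by
    intro t x
    have hsh : IntervalIntegrable (fun s => η (s + δ, x)) volume 0 t := by
      have := (hint x (0 + δ) (t + δ)).comp_add_right δ
      simpa using this
    rw [hst, hst, intervalIntegral.integral_const_mul, intervalIntegral.integral_sub hsh
      (hint x 0 t),
      intervalIntegral.integral_comp_add_right (fun s => η (s, x)) δ]
    have e1 := intervalIntegral.integral_add_adjacent_intervals (hint x 0 δ) (hint x δ (t + δ))
    have e2 := intervalIntegral.integral_add_adjacent_intervals (hint x 0 t) (hint x t (t + δ))
    simp only [zero_add]
    rw [← mul_add]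
    congr 1
    linarith
  refine ⟨⟨fun x => steklov δ η (0, x), ⟨memL1Lp_of_bdd hΩ hηδ (norm_steklov_le hδ hM),
    memL1Lp_of_bdd hΩ hηt hηtM, (memLp_steklov_slice hη hη2 0).restrict _, ?_⟩, ?_⟩,
      ⟨?_, ?_, ?_⟩, ?_, ?_⟩
  · exact Eventually.of_forall fun z => (hprim z.1 z.2).symm
  -- the average looks forward in time, where `η` vanishes after `T`
  · refine Eventually.of_forall fun x => ?_
    simp only
    rw [hprim, hst]
    have : ∫ s in T..(T + δ), η (s, x) = ∫ s in T..(T + δ), 0 := by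
      refine intervalIntegral.integral_congr fun s hs => ?_
      rw [uIcc_of_le (by linarith)] at hs
      exact h0 _ fun h => by linarith [h.1.2, hs.1]
    rw [this]; simp
  · exact (memLp_steklov hη hη2).restrict _
  · exact (memLp_steklov hE hE2).restrict _
  -- a time slice of the average is orthogonal to the orthogonal complement of `H^1_0(Ω)`, as almost
  -- all slices of `(η, E)` are
  · refine Eventually.of_forall fun t => ?_
    refine hasH10Grad_of_orthogonal ((memLp_steklov_slice hη hη2 t).restrict _)
      ((memLp_steklov_slice hE hE2 t).restrict _) fun q hq => ?_
    obtain ⟨e1, i1⟩ := integral_inner_steklov (δ := δ) hη hη2 (Lp.memLp q.fst) t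
    obtain ⟨e2, i2⟩ := integral_inner_steklov (δ := δ) hE hE2 (Lp.memLp q.snd) t
    rw [e1, e2, ← mul_add, ← integral_add i1 i2]
    have h3 : ∀ᵐ s : ℝ, HasH10Grad Ω (fun x => η (t + s, x)) (fun x => E (t + s, x)) :=
      (measurePreserving_add_left volume t).quasiMeasurePreserving.ae hs
    rw [integral_eq_zero_of_ae, mul_zero]
    filter_upwards [ae_restrict_of_ae h3] with s h4
    exact h4.orthogonal hq
  · exact memLp_top_of_bound hηδ.aestronglyMeasurable M
      (Eventually.of_forall (norm_steklov_le hδ hM))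
  · exact memLp_top_of_bound hηt.aestronglyMeasurable _ (Eventually.of_forall hηtM)

/-- An identity that holds for all admissible test functions also holds for all bounded functions in
`L²(0,T; H^1_0(Ω))`, without regularity in time. -/
theorem identity_of_memL2H10 (hΩm : MeasurableSet Ω) (hΩ : volume Ω < ⊤)
    {g : ℝ × Sp d → ℝ} {Φ : ℝ × Sp d → Sp d} (hg : IntegrableOn g (cyl T Ω))
    (hΦ : MemLp Φ 2 (volume.restrict (cyl T Ω)))
    (hid : ∀ (η ηt : ℝ × Sp d → ℝ) (Gη : ℝ × Sp d → Sp d), IsTestFunction T Ω η ηt Gη →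
      ∫ z in cyl T Ω, (g z * η z + inner ℝ (Φ z) (Gη z)) = 0)
    (hη : MemL2H10 T Ω η E) (hM : ∀ᵐ z ∂(volume.restrict (cyl T Ω)), ‖η z‖ ≤ M) :
    ∫ z in cyl T Ω, (g z * η z + inner ℝ (Φ z) (E z)) = 0 := by
  have hcm := measurableSet_cyl (T := T) hΩm
  -- everywhere defined, measurable and bounded representatives, extended by zero
  set η' : ℝ × Sp d → ℝ := indicator (cyl T Ω) fun z =>
      max (-|M|) (min |M| (hη.memLp.1.mk η z)) with hη'
  set E' : ℝ × Sp d → Sp d := indicator (cyl T Ω) (hη.memLp_grad.1.mk E) with hE'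
  have hη'm : StronglyMeasurable η' :=
    ((stronglyMeasurable_const.sup
      (stronglyMeasurable_const.inf hη.memLp.1.stronglyMeasurable_mk))).indicator hcm
  have hE'm : StronglyMeasurable E' := hη.memLp_grad.1.stronglyMeasurable_mk.indicator hcm
  have hη'eq : η' =ᵐ[volume.restrict (cyl T Ω)] η := by
    filter_upwards [ae_restrict_mem hcm, hη.memLp.1.ae_eq_mk, hM] with z hz e1 e2
    rw [hη', indicator_of_mem hz, ← e1]
    have h3 := abs_le.1 (e2.trans (le_abs_self M))
    rw [min_eq_right h3.2, max_eq_right h3.1]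
  have hE'eq : E' =ᵐ[volume.restrict (cyl T Ω)] E := by
    filter_upwards [ae_restrict_mem hcm, hη.memLp_grad.1.ae_eq_mk] with z hz e1
    rw [hE', indicator_of_mem hz, ← e1]
  have hη'M : ∀ z, ‖η' z‖ ≤ |M| := by
    intro z
    by_cases hz : z ∈ cyl T Ω
    · rw [hη', indicator_of_mem hz, Real.norm_eq_abs, abs_le]
      exact ⟨le_max_left _ _, max_le (by linarith [abs_nonneg M]) (min_le_left _ _)⟩
    · rw [hη', indicator_of_notMem hz]; simp
  have hη'0 : ∀ z, z ∉ cyl T Ω → η' z = 0 := fun z hz => indicator_of_notMem hz _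
  have hE'2 : MemLp E' 2 volume := by
    rw [hE', memLp_indicator_iff_restrict hcm]
    exact hη.memLp_grad.ae_eq hη.memLp_grad.1.ae_eq_mk
  have hη'2 := memLp_of_bdd_support hΩm hΩ hη'm hη'M hη'0
  have hs : ∀ᵐ t : ℝ, HasH10Grad Ω (fun x => η' (t, x)) (fun x => E' (t, x)) := by
    have h1 := hη.slice
    have h2 := ae_slice_time hη'eq
    have h3 := ae_slice_time hE'eq
    rw [ae_restrict_iff' measurableSet_Ioo] at h1 h2 h3
    filter_upwards [h1, h2, h3] with t h1 h2 h3
    by_cases ht : t ∈ Ioo 0 T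
    · exact (h1 ht).congr (EventuallyEq.symm (h2 ht)) (EventuallyEq.symm (h3 ht))
    · have hz : ∀ x, (t, x) ∉ cyl T Ω := fun x hx => ht hx.1
      simp only [hη', hE', indicator_of_notMem (hz _)]
      exact hasH10Grad_zero Ω
  set δ : ℕ → ℝ := fun n => 1 / ((n : ℝ) + 1) with hδ
  have hδ0 : ∀ n, 0 < δ n := fun n => by positivity
  have hzero : ∀ n, ∫ z in cyl T Ω,
      (g z * steklov (δ n) η' z + inner ℝ (Φ z) (steklov (δ n) E' z)) = 0 :=
    fun n => hid _ _ _ (isTestFunction_steklov hΩm hΩ (hδ0 n) hη'm hE'm hη'M hη'0 hE'2 hs)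
  have hl1 := tendsto_eLpNorm_steklov hη'm hη'2
  have hl2 := tendsto_eLpNorm_steklov hE'm hE'2
  obtain ⟨ns, hns, hae⟩ := (tendstoInMeasure_of_tendsto_eLpNorm two_ne_zero
    (fun n => (stronglyMeasurable_steklov hη'm).aestronglyMeasurable) hη'm.aestronglyMeasurable
    hl1).exists_seq_tendsto_ae
  have hsM : ∀ n z, ‖steklov (δ n) η' z‖ ≤ |M| := fun n => norm_steklov_le (hδ0 n) hη'M
  have igη : ∀ ζ : ℝ × Sp d → ℝ, StronglyMeasurable ζ → (∀ z, ‖ζ z‖ ≤ |M|) →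
      Integrable (fun z => g z * ζ z) (volume.restrict (cyl T Ω)) := fun ζ h1 h2 =>
    Integrable.mul_bdd (c := |M|) hg h1.aestronglyMeasurable (Eventually.of_forall h2)
  have T1 : Tendsto (fun i => ∫ z in cyl T Ω, g z * steklov (δ (ns i)) η' z) atTop
      (𝓝 (∫ z in cyl T Ω, g z * η' z)) := by
    refine tendsto_integral_of_dominated_convergence (fun z => |g z| * |M|)
      (fun i => (igη _ (stronglyMeasurable_steklov hη'm) (hsM _)).1) (hg.abs.mul_const _)
      (fun i => Eventually.of_forall fun z => ?_) ?_
    · rw [norm_mul]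
      exact mul_le_mul_of_nonneg_left (hsM _ z) (norm_nonneg _)
    · filter_upwards [ae_restrict_of_ae hae] with z hz using hz.const_mul _
  have hSE : ∀ n, MemLp (steklov (δ n) E') 2 (volume.restrict (cyl T Ω)) :=
    fun n => (memLp_steklov hE'm hE'2).restrict _
  have hE'r : MemLp E' 2 (volume.restrict (cyl T Ω)) := hE'2.restrict _
  have T2 : Tendsto (fun n => ∫ z in cyl T Ω, inner ℝ (Φ z) (steklov (δ n) E' z)) atTop
      (𝓝 (∫ z in cyl T Ω, inner ℝ (Φ z) (E' z))) := by
    refine tendsto_integral_inner hΦ hSE hE'r (tendsto_of_tendsto_of_tendsto_of_le_of_le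
      tendsto_const_nhds hl2 (fun _ => zero_le) fun n => ?_)
    exact eLpNorm_mono_measure _ Measure.restrict_le_self
  have T3 := T1.add (T2.comp hns.tendsto_atTop)
  have e : ∀ i, (∫ z in cyl T Ω, g z * steklov (δ (ns i)) η' z) +
      ∫ z in cyl T Ω, inner ℝ (Φ z) (steklov (δ (ns i)) E' z) = 0 := by
    intro i
    rw [← integral_add (igη _ (stronglyMeasurable_steklov hη'm) (hsM _))
      (integrable_inner_Lp hΦ (hSE _))]
    exact hzero _
  have h4 := tendsto_nhds_unique T3 (tendsto_const_nhds.congr fun i => (e i).symm)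
  rw [← integral_add (igη _ hη'm hη'M) (integrable_inner_Lp hΦ hE'r)] at h4
  rw [← h4]
  refine integral_congr_ae ?_
  filter_upwards [hη'eq, hE'eq] with z e1 e2
  rw [e1, e2]

end

/-! ### Integration by parts in time, and testing with a sign function -/

/-- Fubini's theorem on the triangle `0 < s < t < T`. -/
theorem integral_mul_primitive {T : ℝ} (hT : 0 < T) {f h : ℝ → ℝ} (hf : IntegrableOn f (Ioo 0 T))
    (hh : IntegrableOn h (Ioo 0 T)) :
    ∫ t in Ioo 0 T, f t * ∫ s in (0 : ℝ)..t, h s =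
      ∫ t in Ioo 0 T, (∫ s in t..T, f s) * h t := by
  have hTT : T ∈ Ioc 0 T := ⟨hT, le_rfl⟩
  have hfi : IntervalIntegrable f volume 0 T :=
    (intervalIntegrable_iff_integrableOn_Ioo_of_le hT.le).2 hf
  -- after time reversal of `f`, both sides are triple convolutions at time `T`
  have hr : IntegrableOn (fun s => f (T - s)) (Ioo 0 T) := by
    have := (hfi.comp_sub_left T).symm
    rw [sub_self, sub_zero] at this
    exact (intervalIntegrable_iff_integrableOn_Ioo_of_le hT.le).1 this
  have e1 : ∫ t in Ioo 0 T, f t * ∫ s in (0 : ℝ)..t, h s =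
      conv (fun s => f (T - s)) (conv (fun _ => 1) h) T := by
    rw [conv, intervalIntegral.integral_of_le hT.le, integral_Ioc_eq_integral_Ioo]
    simp only [sub_sub_cancel, conv_one_left]
  have e2 : ∫ t in Ioo 0 T, (∫ s in t..T, f s) * h t =
      conv (conv (fun _ => 1) (fun s => f (T - s))) h T := by
    rw [conv, intervalIntegral.integral_of_le hT.le, integral_Ioc_eq_integral_Ioo]
    simp only [conv_one_left, intervalIntegral.integral_comp_sub_left, sub_sub_cancel, sub_zero]
  rw [e1, e2, conv_comm, conv_one_conv_assoc hh hr hTT, conv_one_conv_assoc hr hh hTT,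
    conv_comm_fun]

section

variable {d : ℕ} {T : ℝ} {Ω : Set (Sp d)}

theorem integrableOn_of_memL1Lp_one {w : ℝ × Sp d → ℝ} (hw : MemL1Lp T Ω 1 w) :
    IntegrableOn w (cyl T Ω) := by
  refine ⟨hw.1, ?_⟩
  have h1 := hw.1
  have h2 := hw.2
  rw [restrict_cyl] at h1 ⊢
  rw [HasFiniteIntegral, lintegral_prod _ h1.enorm]
  simpa only [eLpNorm_one_eq_lintegral_enorm] using h2

theorem integrableOn_slice {w : ℝ × Sp d → ℝ} (hw : IntegrableOn w (cyl T Ω)) :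
    ∀ᵐ x ∂(volume.restrict Ω), IntegrableOn (fun t => w (t, x)) (Ioo 0 T) := by
  rw [IntegrableOn, restrict_cyl] at hw
  exact hw.prod_left_ae

theorem setIntegral_cyl_space {w : ℝ × Sp d → ℝ} (hw : IntegrableOn w (cyl T Ω)) :
    ∫ z in cyl T Ω, w z = ∫ x in Ω, ∫ t in Ioo 0 T, w (t, x) := by
  rw [IntegrableOn, restrict_cyl] at hw
  rw [restrict_cyl]
  exact integral_prod_symm _ hw

/-- Integration by parts in time, for a function vanishing at `t = 0` and a test function vanishing
at `t = T`. -/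
theorem integral_deriv_mul_eq (hT : 0 < T) (hΩ : volume Ω < ⊤) {W h η ηt : ℝ × Sp d → ℝ}
    {Gη : ℝ × Sp d → Sp d}
    (hW : HasW11Deriv T Ω 1 W h 0) (hη : IsTestFunction T Ω η ηt Gη) :
    ∫ z in cyl T Ω, -(ηt z) * W z = ∫ z in cyl T Ω, h z * η z := by
  obtain ⟨a, ha, haT⟩ := hη.w11
  have hWi := integrableOn_of_memL1Lp_one hW.mem
  have hhi := integrableOn_of_memL1Lp_one hW.mem_deriv
  have i1 : IntegrableOn (fun z => -(ηt z) * W z) (cyl T Ω) :=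
    Integrable.mul_of_top_right hWi hη.bounded_deriv.neg
  have i2 : IntegrableOn (fun z => h z * η z) (cyl T Ω) := Integrable.mul_of_top_left hhi hη.bounded
  have hfin : IsFiniteMeasure ((volume : Measure (ℝ × Sp d)).restrict (cyl T Ω)) :=
    ⟨by simpa using volume_cyl_lt_top hΩ⟩
  have hηti : IntegrableOn ηt (cyl T Ω) := hη.bounded_deriv.integrable le_top
  rw [setIntegral_cyl_space i1, setIntegral_cyl_space i2]
  refine integral_congr_ae ?_
  filter_upwards [haT, integrableOn_slice hηti, integrableOn_slice hhi,
    ae_slice_space hW.primitive, ae_slice_space ha.primitive] with x hx h1 h2 h3 h4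
  have hint : ∀ b ∈ Icc 0 T, ∀ c ∈ Icc 0 T, IntervalIntegrable (fun s => ηt (s, x)) volume b c := by
    intro b hb c hc
    have h0 : IntervalIntegrable (fun s => ηt (s, x)) volume 0 T :=
      (intervalIntegrable_iff_integrableOn_Ioo_of_le hT.le).2 h1
    refine h0.mono_set ?_
    rw [uIcc_of_le hT.le]
    exact uIcc_subset_Icc hb hc
  have e1 : ∫ t in Ioo 0 T, -(ηt (t, x)) * W (t, x) =
      -∫ t in Ioo 0 T, ηt (t, x) * ∫ s in (0 : ℝ)..t, h (s, x) := by
    rw [← integral_neg]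
    refine integral_congr_ae ?_
    filter_upwards [h3] with t ht
    rw [ht, Pi.zero_apply, zero_add, neg_mul]
  rw [e1, integral_mul_primitive hT h1 h2, ← integral_neg]
  refine integral_congr_ae ?_
  filter_upwards [h4, ae_restrict_mem measurableSet_Ioo] with t ht htT
  have hm : t ∈ Icc 0 T := ⟨htT.1.le, htT.2.le⟩
  have h5 := intervalIntegral.integral_add_adjacent_intervals
    (hint 0 ⟨le_rfl, hT.le⟩ t hm) (hint t hm T ⟨hT.le, le_rfl⟩)
  have h6 : η (t, x) = -∫ s in t..T, ηt (s, x) := by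
    rw [ht]; linarith
  rw [h6]; ring

theorem mulVecE_sub (M : Matrix (Fin d) (Fin d) ℝ) (ξ ζ : Sp d) :
    mulVecE M (ξ - ζ) = mulVecE M ξ - mulVecE M ζ := by
  ext i
  simp [mulVecE, Matrix.mulVec, dotProduct, mul_sub]

theorem HA.memLp_mulVecE {A : ℝ × Sp d → Matrix (Fin d) (Fin d) ℝ} (hA : HA T Ω A)
    {G : ℝ × Sp d → Sp d} (hG : MemLp G 2 (volume.restrict (cyl T Ω))) :
    MemLp (fun z => mulVecE (A z) (G z)) 2 (volume.restrict (cyl T Ω)) := by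
  have hcomp : ∀ j, MemLp (fun z => G z j) 2 (volume.restrict (cyl T Ω)) := fun j => by
    refine hG.of_le ?_ (Eventually.of_forall fun z => PiLp.norm_apply_le (G z) j)
    exact (EuclideanSpace.proj (𝕜 := ℝ) j).continuous.comp_aestronglyMeasurable hG.1
  have hsum : MemLp (fun z => ∑ i, (∑ j, A z i j * G z j) • EuclideanSpace.single i (1 : ℝ)) 2
      (volume.restrict (cyl T Ω)) := by
    refine memLp_finsetSum _ fun i _ => ?_
    have h1 : MemLp (fun z => ∑ j, A z i j * G z j) 2 (volume.restrict (cyl T Ω)) :=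
      memLp_finsetSum _ fun j _ => (hcomp j).mul (hA.bounded i j)
    exact (ContinuousLinearMap.toSpanSingleton ℝ (EuclideanSpace.single i (1 : ℝ))).comp_memLp' h1
  refine hsum.ae_eq (Eventually.of_forall fun z => ?_)
  ext i
  simp [mulVecE, Matrix.mulVec, dotProduct, Finset.sum_apply, Pi.single_apply]

/-- The weak formulation after integration by parts in time. -/
theorem IsWeakSolution.exists_identity (hT : 0 < T) (hΩ : volume Ω < ⊤) {k φ : ℝ → ℝ}
    {A : ℝ × Sp d → Matrix (Fin d) (Fin d) ℝ} (hA : HA T Ω A) {u₀ : Sp d → ℝ}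
    {f u h : ℝ × Sp d → ℝ} (hf : IntegrableOn f (cyl T Ω))
    (hu : IsWeakSolution T Ω k A φ u₀ f u) (hr : HasW11Deriv T Ω 1 (memory k u₀ u) h 0) :
    ∃ G : ℝ × Sp d → Sp d, MemL2H10 T Ω (fun z => φ (u z)) G ∧
      ∀ (η ηt : ℝ × Sp d → ℝ) (Gη : ℝ × Sp d → Sp d), IsTestFunction T Ω η ηt Gη →
        ∫ z in cyl T Ω, ((h z - f z) * η z + inner ℝ (mulVecE (A z) (G z)) (Gη z)) = 0 := by
  obtain ⟨G, hG, hid⟩ := hu.weak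
  refine ⟨G, hG, fun η ηt Gη hη => ?_⟩
  have hhi := integrableOn_of_memL1Lp_one hr.mem_deriv
  have i1 : IntegrableOn (fun z => -(ηt z) * memory k u₀ u z) (cyl T Ω) :=
    Integrable.mul_of_top_right (integrableOn_of_memL1Lp_one hr.mem) hη.bounded_deriv.neg
  have i2 : IntegrableOn (fun z => h z * η z) (cyl T Ω) := Integrable.mul_of_top_left hhi hη.bounded
  have i3 : IntegrableOn (fun z => f z * η z) (cyl T Ω) := Integrable.mul_of_top_left hf hη.bounded
  have i4 : IntegrableOn (fun z => inner ℝ (mulVecE (A z) (G z)) (Gη z)) (cyl T Ω) :=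
    integrable_inner_Lp (hA.memLp_mulVecE hG.memLp_grad) hη.l2h10.memLp_grad
  have h1 := hid η ηt Gη hη
  rw [integral_add i1 i4, integral_deriv_mul_eq hT hΩ hr hη] at h1
  simp only [sub_mul]
  have i5 : IntegrableOn (fun z => h z * η z - f z * η z) (cyl T Ω) := i2.sub i3
  rw [integral_add i5 i4, integral_sub i2 i3]
  linarith

theorem exists_deriv_posApprox_bound (n : ℕ) : ∃ C, ∀ y, |deriv (posApprox n) y| ≤ C := by
  have hcont : Continuous (deriv Real.smoothTransition) :=
    (Real.smoothTransition.contDiff (n := 1)).continuous_deriv le_rfl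
  obtain ⟨C, hC⟩ := (isCompact_Icc (a := (0 : ℝ)) (b := 1)).exists_bound_of_continuousOn
    hcont.continuousOn
  have hC0 : 0 ≤ C := (norm_nonneg _).trans (hC 0 (by simp))
  have hb : ∀ y, |deriv Real.smoothTransition y| ≤ C := by
    intro y
    by_cases hy : y ∈ Icc (0 : ℝ) 1
    · exact hC y hy
    · have h0 : deriv Real.smoothTransition y = 0 := by
        rcases lt_or_ge y 0 with h | h
        · refine (EventuallyEq.deriv_eq (f := fun _ => (0 : ℝ)) ?_).trans (deriv_const _ _)
          filter_upwards [Iio_mem_nhds h] with s hs using Real.smoothTransition.zero_of_nonpos hs.le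
        · have h1 : 1 < y := not_le.1 fun h2 => hy ⟨h, h2⟩
          refine (EventuallyEq.deriv_eq (f := fun _ => (1 : ℝ)) ?_).trans (deriv_const _ _)
          filter_upwards [Ioi_mem_nhds h1] with s hs using Real.smoothTransition.one_of_one_le hs.le
      rw [h0, abs_zero]; exact hC0
  refine ⟨n * C, fun y => ?_⟩
  have : deriv (posApprox n) y = n * deriv Real.smoothTransition (n * y) := by
    unfold posApprox
    rw [deriv_comp_mul_left, smul_eq_mul]
  rw [this, abs_mul, Nat.abs_cast]
  exact mul_le_mul_of_nonneg_left (hb _) n.cast_nonneg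

/-- Testing the equation for the difference of two solutions with (approximations of)
`ψ(t) sign⁺(φ(u₁) - φ(u₂))`: by ellipticity, the diffusion term has a sign. -/
theorem integral_heaviside_le (hΩm : MeasurableSet Ω) (hΩ : volume Ω < ⊤)
    {A : ℝ × Sp d → Matrix (Fin d) (Fin d) ℝ} (hA : HA T Ω A) {w g : ℝ × Sp d → ℝ}
    {G : ℝ × Sp d → Sp d} (hw : MemL2H10 T Ω w G) (hg : IntegrableOn g (cyl T Ω))
    (hid : ∀ (η ηt : ℝ × Sp d → ℝ) (Gη : ℝ × Sp d → Sp d), IsTestFunction T Ω η ηt Gη →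
        ∫ z in cyl T Ω, (g z * η z + inner ℝ (mulVecE (A z) (G z)) (Gη z)) = 0)
    {ψ : ℝ → ℝ} {C : ℝ} (hψm : AEStronglyMeasurable ψ (volume.restrict (Ioo 0 T)))
    (hψC : ∀ t ∈ Ioo 0 T, |ψ t| ≤ C) (hψ0 : ∀ t ∈ Ioo 0 T, 0 ≤ ψ t) :
    ∫ z in cyl T Ω, g z * (ψ z.1 * heaviside (w z)) ≤ 0 := by
  have hcm := measurableSet_cyl (T := T) hΩm
  have hψm' : AEStronglyMeasurable (fun z : ℝ × Sp d => ψ z.1) (volume.restrict (cyl T Ω)) := by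
    rw [restrict_cyl]; exact hψm.comp_fst
  have hψb : ∀ᵐ z ∂(volume.restrict (cyl T Ω)), ‖ψ z.1‖ ≤ C := by
    filter_upwards [ae_restrict_mem hcm] with z hz using hψC _ hz.1
  have hηm : ∀ n, AEStronglyMeasurable (fun z => ψ z.1 * posApprox n (w z))
      (volume.restrict (cyl T Ω)) :=
    fun n => hψm'.mul ((continuous_posApprox n).comp_aestronglyMeasurable hw.memLp.1)
  have hηb : ∀ n, ∀ᵐ z ∂(volume.restrict (cyl T Ω)), ‖ψ z.1 * posApprox n (w z)‖ ≤ C := by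
    intro n
    filter_upwards [hψb] with z hz
    rw [norm_mul]
    exact (mul_le_of_le_one_right (norm_nonneg _) (abs_posApprox_le_one _ _)).trans hz
  have hle : ∀ n, ∫ z in cyl T Ω, g z * (ψ z.1 * posApprox n (w z)) ≤ 0 := by
    intro n
    obtain ⟨D, hD⟩ := exists_deriv_posApprox_bound n
    have hH := contDiff_posApprox n
    have hH0 : posApprox n 0 = 0 := posApprox_of_nonpos n le_rfl
    have m1 := memLp_comp_lipschitz hH hH0 hD hw.memLp
    have m2 := memLp_deriv_smul hH hD hw.memLp.1 hw.memLp_grad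
    have hmem : MemL2H10 T Ω (fun z => ψ z.1 * posApprox n (w z))
        (fun z => ψ z.1 • (deriv (posApprox n) (w z) • G z)) := by
      refine ⟨m1.of_le_mul (c := C) (hηm n) ?_, m2.of_le_mul (c := C) (hψm'.smul m2.1) ?_, ?_⟩
      · filter_upwards [hψb] with z hz
        rw [norm_mul]
        exact mul_le_mul_of_nonneg_right hz (norm_nonneg _)
      · filter_upwards [hψb] with z hz
        rw [norm_smul]
        exact mul_le_mul_of_nonneg_right hz (norm_nonneg _)
      · filter_upwards [hw.slice] with t ht
        exact (ht.comp hH hH0 hD).const_smul (ψ t)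
    have h1 := identity_of_memL2H10 hΩm hΩ hg (hA.memLp_mulVecE hw.memLp_grad) hid hmem (hηb n)
    have i1 : IntegrableOn (fun z => g z * (ψ z.1 * posApprox n (w z))) (cyl T Ω) :=
      Integrable.mul_bdd (c := C) hg (hηm n) (hηb n)
    rw [integral_add i1 (integrable_inner_Lp (hA.memLp_mulVecE hw.memLp_grad)
      hmem.memLp_grad)] at h1
    obtain ⟨ν, hν, hco⟩ := hA.coercive
    have h2 : 0 ≤ ∫ z in cyl T Ω, inner ℝ (mulVecE (A z) (G z))
        (ψ z.1 • (deriv (posApprox n) (w z) • G z)) := by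
      refine integral_nonneg_of_ae ?_
      filter_upwards [hco, ae_restrict_mem hcm] with z hz hzc
      rw [inner_smul_right, inner_smul_right]
      refine mul_nonneg (hψ0 _ hzc.1) (mul_nonneg (monotone_posApprox n).deriv_nonneg ?_)
      exact le_trans (by positivity) (hz (G z))
    linarith
  have hlim : Tendsto (fun n => ∫ z in cyl T Ω, g z * (ψ z.1 * posApprox n (w z))) atTop
      (𝓝 (∫ z in cyl T Ω, g z * (ψ z.1 * heaviside (w z)))) := by
    refine tendsto_integral_of_dominated_convergence (fun z => |g z| * C)
      (fun n => hg.1.mul (hηm n)) (hg.abs.mul_const C) (fun n => ?_) ?_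
    · filter_upwards [hηb n] with z hz
      rw [norm_mul]
      exact mul_le_mul_of_nonneg_left hz (norm_nonneg _)
    · exact Eventually.of_forall fun z => ((tendsto_posApprox _).const_mul _).const_mul _
  exact le_of_tendsto' hlim hle

end

/-! ### The contraction estimate -/

section

variable {d : ℕ} {T : ℝ} {Ω : Set (Sp d)}

theorem heaviside_sub_comp {φ : ℝ → ℝ} (hφ : StrictMono φ) (a b : ℝ) :
    heaviside (φ a - φ b) = heaviside (a - b) := by
  simp only [heaviside, sub_pos, hφ.lt_iff_lt]

/-- The equation for the difference of two solutions, tested with `ψ(t) sign⁺(u₁ - u₂)`. -/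
theorem integral_heaviside_deriv_le (hT : 0 < T) (hΩm : MeasurableSet Ω) (hΩ : volume Ω < ⊤)
    {k l φ : ℝ → ℝ} (hkl : IsPC k l) {A : ℝ × Sp d → Matrix (Fin d) (Fin d) ℝ} (hA : HA T Ω A)
    (hφm : StrictMono φ) {u₀₁ u₀₂ : Sp d → ℝ} {f₁ f₂ u₁ u₂ h₁ h₂ : ℝ × Sp d → ℝ}
    (hf₁ : IntegrableOn f₁ (cyl T Ω)) (hf₂ : IntegrableOn f₂ (cyl T Ω))
    (hu₁ : IsWeakSolution T Ω k A φ u₀₁ f₁ u₁) (hu₂ : IsWeakSolution T Ω k A φ u₀₂ f₂ u₂)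
    (hr₁ : HasW11Deriv T Ω 1 (memory k u₀₁ u₁) h₁ 0)
    (hr₂ : HasW11Deriv T Ω 1 (memory k u₀₂ u₂) h₂ 0) :
    ∫ z in cyl T Ω, (∫ s in (0 : ℝ)..(T - z.1), l s) *
        (heaviside (u₁ z - u₂ z) * (h₁ z - h₂ z)) ≤
      (∫ t in Ioo 0 T, |l t|) * ∫ z in cyl T Ω, max (f₁ z - f₂ z) 0 := by
  obtain ⟨G₁, hG₁, hid₁⟩ := hu₁.exists_identity hT hΩ hA hf₁ hr₁
  obtain ⟨G₂, hG₂, hid₂⟩ := hu₂.exists_identity hT hΩ hA hf₂ hr₂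
  have hcm := measurableSet_cyl (T := T) hΩm
  have hh₁ := integrableOn_of_memL1Lp_one hr₁.mem_deriv
  have hh₂ := integrableOn_of_memL1Lp_one hr₂.mem_deriv
  have hw : MemL2H10 T Ω (fun z => φ (u₁ z) - φ (u₂ z)) (fun z => G₁ z - G₂ z) := by
    refine ⟨hG₁.memLp.sub hG₂.memLp, hG₁.memLp_grad.sub hG₂.memLp_grad, ?_⟩
    filter_upwards [hG₁.slice, hG₂.slice] with t h1 h2 using h1.sub h2
  have hh : IntegrableOn (fun z => h₁ z - h₂ z) (cyl T Ω) := hh₁.sub hh₂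
  have hf : IntegrableOn (fun z => f₁ z - f₂ z) (cyl T Ω) := hf₁.sub hf₂
  have hg : IntegrableOn (fun z => (h₁ z - h₂ z) - (f₁ z - f₂ z)) (cyl T Ω) := hh.sub hf
  have hid : ∀ (η ηt : ℝ × Sp d → ℝ) (Gη : ℝ × Sp d → Sp d), IsTestFunction T Ω η ηt Gη →
      ∫ z in cyl T Ω, (((h₁ z - h₂ z) - (f₁ z - f₂ z)) * η z +
        inner ℝ (mulVecE (A z) (G₁ z - G₂ z)) (Gη z)) = 0 := by
    intro η ηt Gη hη
    have e1 := hid₁ η ηt Gη hη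
    have e2 := hid₂ η ηt Gη hη
    have i1 : IntegrableOn (fun z => (h₁ z - f₁ z) * η z + inner ℝ (mulVecE (A z) (G₁ z)) (Gη z))
        (cyl T Ω) :=
      (Integrable.mul_of_top_left (hh₁.sub hf₁) hη.bounded).add
        (integrable_inner_Lp (hA.memLp_mulVecE hG₁.memLp_grad) hη.l2h10.memLp_grad)
    have i2 : IntegrableOn (fun z => (h₂ z - f₂ z) * η z + inner ℝ (mulVecE (A z) (G₂ z)) (Gη z))
        (cyl T Ω) :=
      (Integrable.mul_of_top_left (hh₂.sub hf₂) hη.bounded).add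
        (integrable_inner_Lp (hA.memLp_mulVecE hG₂.memLp_grad) hη.l2h10.memLp_grad)
    have e3 := integral_sub i1 i2
    rw [e1, e2, sub_zero] at e3
    rw [← e3]
    congr 1; ext z
    rw [mulVecE_sub, inner_sub_left]
    ring
  have hψm := hkl.aestronglyMeasurable_weight hT
  have hψ0 : ∀ t ∈ Ioo 0 T, 0 ≤ ∫ s in (0 : ℝ)..(T - t), l s := fun t ht =>
    hkl.primitive_nonneg (by linarith [ht.2])
  have key := integral_heaviside_le hΩm hΩ hA hw hg hid hψm (fun t ht => hkl.abs_weight_le ht) hψ0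
  simp only [heaviside_sub_comp hφm] at key
  set L := ∫ t in Ioo 0 T, |l t| with hL
  have hL0 : 0 ≤ L := integral_nonneg fun _ => abs_nonneg _
  set θ : ℝ × Sp d → ℝ := fun z =>
      (∫ s in (0 : ℝ)..(T - z.1), l s) * heaviside (u₁ z - u₂ z) with hθ
  have hθm : AEStronglyMeasurable θ (volume.restrict (cyl T Ω)) := by
    refine AEStronglyMeasurable.mul ?_ ?_
    · rw [restrict_cyl]; exact hψm.comp_fst
    · exact (measurable_heaviside.comp_aemeasurable
        (hu₁.mem.memLp.1.sub hu₂.mem.memLp.1).aemeasurable).aestronglyMeasurable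
  have hθ0 : ∀ z ∈ cyl T Ω, 0 ≤ θ z := fun z hz => mul_nonneg (hψ0 _ hz.1) (heaviside_nonneg _)
  have hθL : ∀ z ∈ cyl T Ω, θ z ≤ L := fun z hz =>
    (mul_le_of_le_one_right (hψ0 _ hz.1) (heaviside_le_one _)).trans
      ((le_abs_self _).trans (hkl.abs_weight_le hz.1))
  have hθb : ∀ᵐ z ∂(volume.restrict (cyl T Ω)), ‖θ z‖ ≤ L := by
    filter_upwards [ae_restrict_mem hcm] with z hz
    rw [Real.norm_eq_abs, abs_of_nonneg (hθ0 z hz)]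
    exact hθL z hz
  have i1 : IntegrableOn (fun z => (h₁ z - h₂ z) * θ z) (cyl T Ω) := hh.mul_bdd hθm hθb
  have i2 : IntegrableOn (fun z => (f₁ z - f₂ z) * θ z) (cyl T Ω) := hf.mul_bdd hθm hθb
  have e1 : ∫ z in cyl T Ω, (h₁ z - h₂ z) * θ z ≤ ∫ z in cyl T Ω, (f₁ z - f₂ z) * θ z := by
    have e2 := integral_sub i1 i2
    have e3 : ∫ z in cyl T Ω, ((h₁ z - h₂ z) * θ z - (f₁ z - f₂ z) * θ z) ≤ 0 := by
      refine le_of_eq_of_le ?_ key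
      congr 1; ext z; ring
    linarith
  calc _ = ∫ z in cyl T Ω, (h₁ z - h₂ z) * θ z := by congr 1; ext z; ring
    _ ≤ _ := e1
    _ ≤ ∫ z in cyl T Ω, L * max (f₁ z - f₂ z) 0 := by
      refine setIntegral_mono_on i2 (hf.pos_part.const_mul L) hcm fun z hz => ?_
      calc (f₁ z - f₂ z) * θ z ≤ max (f₁ z - f₂ z) 0 * θ z :=
            mul_le_mul_of_nonneg_right (le_max_left _ _) (hθ0 z hz)
        _ ≤ max (f₁ z - f₂ z) 0 * L := mul_le_mul_of_nonneg_left (hθL z hz) (le_max_right _ _)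
        _ = _ := mul_comm _ _
    _ = _ := integral_const_mul _ _

/-- The estimate for the positive part of the difference of two solutions. -/
theorem integral_pos_part_sub_le (hT : 0 < T) (hΩm : MeasurableSet Ω) (hΩ : volume Ω < ⊤)
    {k l φ : ℝ → ℝ} (hkl : IsPC k l) {A : ℝ × Sp d → Matrix (Fin d) (Fin d) ℝ} (hA : HA T Ω A)
    (hφm : StrictMono φ) {u₀₁ u₀₂ : Sp d → ℝ} {f₁ f₂ u₁ u₂ : ℝ × Sp d → ℝ}
    (hu₀₁ : IntegrableOn u₀₁ Ω) (hu₀₂ : IntegrableOn u₀₂ Ω)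
    (hf₁ : IntegrableOn f₁ (cyl T Ω)) (hf₂ : IntegrableOn f₂ (cyl T Ω))
    (hu₁ : IsWeakSolution T Ω k A φ u₀₁ f₁ u₁) (hu₂ : IsWeakSolution T Ω k A φ u₀₂ f₂ u₂)
    (hr₁ : RegularMemory T Ω k u₀₁ u₁) (hr₂ : RegularMemory T Ω k u₀₂ u₂) :
    ∫ z in cyl T Ω, max (u₁ z - u₂ z) 0 ≤ T * (∫ x in Ω, max (u₀₁ x - u₀₂ x) 0) +
      (∫ t in Ioo 0 T, |l t|) * ∫ z in cyl T Ω, max (f₁ z - f₂ z) 0 := by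
  obtain ⟨h₁, hr₁⟩ := hr₁
  obtain ⟨h₂, hr₂⟩ := hr₂
  have hfin : IsFiniteMeasure ((volume : Measure (ℝ × Sp d)).restrict (cyl T Ω)) :=
    ⟨by simpa using volume_cyl_lt_top hΩ⟩
  have hcm := measurableSet_cyl (T := T) hΩm
  have hui₁ : IntegrableOn u₁ (cyl T Ω) := hu₁.mem.memLp.integrable one_le_two
  have hui₂ : IntegrableOn u₂ (cyl T Ω) := hu₂.mem.memLp.integrable one_le_two
  have hh₁ := integrableOn_of_memL1Lp_one hr₁.mem_deriv
  have hh₂ := integrableOn_of_memL1Lp_one hr₂.mem_deriv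
  have hu : IntegrableOn (fun z => u₁ z - u₂ z) (cyl T Ω) := hui₁.sub hui₂
  have hup : IntegrableOn (fun z => max (u₁ z - u₂ z) 0) (cyl T Ω) := hu.pos_part
  have hh : IntegrableOn (fun z => h₁ z - h₂ z) (cyl T Ω) := hh₁.sub hh₂
  have hu₀ : IntegrableOn (fun x => u₀₁ x - u₀₂ x) Ω := hu₀₁.sub hu₀₂
  have hk := hkl.k_locInt T hT
  set Θ : ℝ × Sp d → ℝ := fun z => (∫ s in (0 : ℝ)..(T - z.1), l s) *
        (heaviside (u₁ z - u₂ z) * (h₁ z - h₂ z)) with hΘ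
  have hΘi : IntegrableOn Θ (cyl T Ω) := by
    have h1 : IntegrableOn (fun z => heaviside (u₁ z - u₂ z) * (h₁ z - h₂ z)) (cyl T Ω) := by
      refine Integrable.bdd_mul (c := 1) hh (measurable_heaviside.comp_aemeasurable
        hu.1.aemeasurable).aestronglyMeasurable (Eventually.of_forall fun z => ?_)
      rw [Real.norm_eq_abs, abs_of_nonneg (heaviside_nonneg _)]
      exact heaviside_le_one _
    refine Integrable.bdd_mul (c := ∫ s in Ioo 0 T, |l s|) h1 ?_ ?_
    · rw [restrict_cyl]; exact (hkl.aestronglyMeasurable_weight hT).comp_fst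
    · filter_upwards [ae_restrict_mem hcm] with z hz using hkl.abs_weight_le hz.1
  refine le_trans ?_ (add_le_add le_rfl (integral_heaviside_deriv_le hT hΩm hΩ hkl hA hφm hf₁ hf₂
    hu₁ hu₂ hr₁ hr₂))
  rw [setIntegral_cyl_space hup, setIntegral_cyl_space hΘi, ← integral_const_mul]
  have j1 : Integrable (fun x => ∫ t in Ioo 0 T, max (u₁ (t, x) - u₂ (t, x)) 0)
      (volume.restrict Ω) := by
    rw [IntegrableOn, restrict_cyl] at hup
    exact hup.integral_prod_right
  have j2 : Integrable (fun x => ∫ t in Ioo 0 T, Θ (t, x)) (volume.restrict Ω) := by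
    rw [IntegrableOn, restrict_cyl] at hΘi
    exact hΘi.integral_prod_right
  have j3 : Integrable (fun x => T * max (u₀₁ x - u₀₂ x) 0) (volume.restrict Ω) :=
    hu₀.pos_part.const_mul T
  rw [← integral_add j3 j2]
  refine integral_mono_ae j1 (j3.add j2) ?_
  -- for almost every `x`, the scalar estimate applies to `t ↦ (u₁ - u₂)(t, x)`
  filter_upwards [integrableOn_slice hui₁, integrableOn_slice hui₂, integrableOn_slice hh₁,
    integrableOn_slice hh₂, ae_slice_space hr₁.primitive, ae_slice_space hr₂.primitive]
    with x a1 a2 b1 b2 c1 c2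
  have hc : ∀ c : ℝ, IntegrableOn (fun _ : ℝ => c) (Ioo 0 T) := fun c => by simp
  have v1 : IntegrableOn (fun t => u₁ (t, x) - u₀₁ x) (Ioo 0 T) := a1.sub (hc _)
  have v2 : IntegrableOn (fun t => u₂ (t, x) - u₀₂ x) (Ioo 0 T) := a2.sub (hc _)
  have hmain := hkl.integral_pos_part_le hT (v1.sub v2) (b1.sub b2) ?_ (u₀₁ x - u₀₂ x)
  · have e : ∀ t, u₀₁ x - u₀₂ x + (u₁ (t, x) - u₀₁ x - (u₂ (t, x) - u₀₂ x)) =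
        u₁ (t, x) - u₂ (t, x) := fun t => by ring
    simp only [Pi.sub_apply, e] at hmain
    exact hmain
  · filter_upwards [conv_sub_right hk v1 v2, c1, c2, ae_restrict_mem measurableSet_Ioo]
      with t e1 e2 e3 ht
    have hint : ∀ f : ℝ → ℝ, IntegrableOn f (Ioo 0 T) → IntervalIntegrable f volume 0 t := by
      intro f hf
      rw [intervalIntegrable_iff_integrableOn_Ioo_of_le ht.1.le]
      exact hf.mono_set (Ioo_subset_Ioo_right ht.2.le)
    simp only [memory, Pi.zero_apply, zero_add] at e2 e3
    simp only [Pi.sub_apply]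
    rw [intervalIntegral.integral_sub (hint _ b1) (hint _ b2), ← e2, ← e3]
    exact e1

end

end FracPME

end

theorem mainTheorem3 {d : ℕ} (hd : 1 ≤ d) (T : ℝ) (hT : 0 < T)
    (Ω : Set (FracPME.Sp d)) (hΩo : IsOpen Ω) (hΩc : IsConnected Ω)
    (hΩb : Bornology.IsBounded Ω)
    (k l : ℝ → ℝ) (hkl : FracPME.IsPC k l)
    (A : ℝ × FracPME.Sp d → Matrix (Fin d) (Fin d) ℝ) (hA : FracPME.HA T Ω A)
    (φ : ℝ → ℝ) (hφ : ContDiff ℝ 1 φ) (hφm : StrictMono φ)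
    (u₀₁ u₀₂ : FracPME.Sp d → ℝ) (hu₀₁ : IntegrableOn u₀₁ Ω) (hu₀₂ : IntegrableOn u₀₂ Ω)
    (f₁ f₂ : ℝ × FracPME.Sp d → ℝ)
    (hf₁ : IntegrableOn f₁ (FracPME.cyl T Ω)) (hf₂ : IntegrableOn f₂ (FracPME.cyl T Ω))
    (u₁ u₂ : ℝ × FracPME.Sp d → ℝ)
    (hu₁ : FracPME.IsWeakSolution T Ω k A φ u₀₁ f₁ u₁)
    (hu₂ : FracPME.IsWeakSolution T Ω k A φ u₀₂ f₂ u₂)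
    (hr₁ : FracPME.RegularMemory T Ω k u₀₁ u₁)
    (hr₂ : FracPME.RegularMemory T Ω k u₀₂ u₂) :
    (∫ z in FracPME.cyl T Ω, |u₁ z - u₂ z|
        ≤ T * (∫ x in Ω, |u₀₁ x - u₀₂ x|)
          + (∫ t in Ioo 0 T, |l t|) * ∫ z in FracPME.cyl T Ω, |f₁ z - f₂ z|) ∧
    (∫ z in FracPME.cyl T Ω, max (u₁ z - u₂ z) 0
        ≤ T * (∫ x in Ω, max (u₀₁ x - u₀₂ x) 0)
          + (∫ t in Ioo 0 T, |l t|) * ∫ z in FracPME.cyl T Ω, max (f₁ z - f₂ z) 0) ∧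
    (∫ z in FracPME.cyl T Ω, max (-(u₁ z - u₂ z)) 0
        ≤ T * (∫ x in Ω, max (-(u₀₁ x - u₀₂ x)) 0)
          + (∫ t in Ioo 0 T, |l t|) * ∫ z in FracPME.cyl T Ω, max (-(f₁ z - f₂ z)) 0) ∧
    ((∀ᵐ x ∂(volume.restrict Ω), u₀₁ x ≤ u₀₂ x) →
      (∀ᵐ z ∂(volume.restrict (FracPME.cyl T Ω)), f₁ z ≤ f₂ z) →
        ∀ᵐ z ∂(volume.restrict (FracPME.cyl T Ω)), u₁ z ≤ u₂ z) := by
  have hΩm := hΩo.measurableSet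
  have hΩ : volume Ω < ⊤ := hΩb.measure_lt_top
  have hfin : IsFiniteMeasure ((volume : Measure (ℝ × FracPME.Sp d)).restrict (FracPME.cyl T Ω)) :=
    ⟨by simpa using FracPME.volume_cyl_lt_top hΩ⟩
  have hu : IntegrableOn (fun z => u₁ z - u₂ z) (FracPME.cyl T Ω) :=
    (hu₁.mem.memLp.integrable one_le_two).sub (hu₂.mem.memLp.integrable one_le_two)
  have hu₀ : IntegrableOn (fun x => u₀₁ x - u₀₂ x) Ω := hu₀₁.sub hu₀₂
  have hf : IntegrableOn (fun z => f₁ z - f₂ z) (FracPME.cyl T Ω) := hf₁.sub hf₂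
  have hpos := FracPME.integral_pos_part_sub_le hT hΩm hΩ hkl hA hφm hu₀₁ hu₀₂ hf₁ hf₂ hu₁ hu₂ hr₁ hr₂
  have hneg := FracPME.integral_pos_part_sub_le hT hΩm hΩ hkl hA hφm hu₀₂ hu₀₁ hf₂ hf₁ hu₂ hu₁ hr₂ hr₁
  simp only [← neg_sub (u₁ _) (u₂ _), ← neg_sub (u₀₁ _) (u₀₂ _), ← neg_sub (f₁ _) (f₂ _)] at hneg
  have habs : ∀ y : ℝ, |y| = max y 0 + max (-y) 0 := fun y => by
    rcases le_total 0 y with h | h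
    · rw [abs_of_nonneg h, max_eq_left h, max_eq_right (neg_nonpos.2 h), add_zero]
    · rw [abs_of_nonpos h, max_eq_right h, max_eq_left (neg_nonneg.2 h), zero_add]
  refine ⟨?_, hpos, hneg, fun h₀ hff => ?_⟩
  · simp only [habs (_ - _)]
    rw [integral_add hu.pos_part hu.neg_part, integral_add hu₀.pos_part hu₀.neg_part,
      integral_add hf.pos_part hf.neg_part]
    linarith
  · have z1 : ∫ x in Ω, max (u₀₁ x - u₀₂ x) 0 = 0 := by
      refine integral_eq_zero_of_ae ?_
      filter_upwards [h₀] with x hx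
      exact max_eq_right (sub_nonpos.2 hx)
    have z2 : ∫ z in FracPME.cyl T Ω, max (f₁ z - f₂ z) 0 = 0 := by
      refine integral_eq_zero_of_ae ?_
      filter_upwards [hff] with z hz
      exact max_eq_right (sub_nonpos.2 hz)
    rw [z1, z2, mul_zero, mul_zero, add_zero] at hpos
    have z3 : ∫ z in FracPME.cyl T Ω, max (u₁ z - u₂ z) 0 = 0 :=
      le_antisymm hpos (integral_nonneg fun z => le_max_right _ _)
    have z4 := (integral_eq_zero_iff_of_nonneg (f := fun z => max (u₁ z - u₂ z) 0)
      (fun z => le_max_right (u₁ z - u₂ z) 0) hu.pos_part).1 z3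
    filter_upwards [z4] with z hz
    exact sub_nonpos.1 (max_eq_right_iff.1 hz)
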